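/- An \emph{Apollonian network} is a planar graph obtained from the complete graph $K_4$ (embedded in the sphere, with its four triangles as faces) by finitely often (possibly zero times) choosing a triangular face $\{v_1,v_2,v_3\}$ of the current graph and adding a new vertex inside it that is adjacent to exactly $v_1,v_2,v_3$, so that this face is replaced by three triangular faces. An \emph{Apollonian dual} is the dual graph of an Apollonian network: its vertices are the faces of the network, and two distinct faces are adjacent if and only if they share an edge. A \emph{strong embedding} of a finite graph $G$ on a closed surface $S$ is an injective continuous map $\beta\colon G\to S$ such that every connected component of $S\setminus\beta(G)$ (cell) is homeomorphic to an open disc and the closed walk of $G$ bounding each cell (the facial walk) is a cycle of $G$. Then every Apollonian dual that is not isomorphic to $K_4$ has a strong embedding on the Klein bottle. -/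

import Mathlib

/-! ### Apollonian networks and their duals -/

/-- Subdivision of the triangle `t` of the graph `T`: a new vertex `none` is added to `T`
and joined exactly to the vertices of `t`. -/
def subdivideGraph {V : Type} (T : SimpleGraph V) (t : Set V) : SimpleGraph (Option V) where
  Adj
    | some u, some v => T.Adj u v
    | some u, none => u ∈ t
    | none, some v => v ∈ t
    | none, none => False
  symm := ⟨by
    rintro (_ | u) (_ | v) h
    · exact h
    · exact h
    · exact h
    · exact T.adj_symm h⟩
  loopless := ⟨by
    rintro (_ | u) h
    · exact h
    · exact T.irrefl h⟩

/-- The faces after subdividing the face `t`, a face being recorded by its set of vertices: `t`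
is replaced by the three triangles spanned by the new vertex and two of the vertices of `t`. -/
def subdivideFaces {V : Type} (F : Set (Set V)) (t : Set V) : Set (Set (Option V)) :=
  {s | ∃ f ∈ F, f ≠ t ∧ s = some '' f} ∪ {s | ∃ x ∈ t, s = insert none (some '' (t \ {x}))}

/-- `IsApollonianNetwork V T F`: the graph `T` on the vertex set `V` is an Apollonian network,
obtained from `K₄` by recursively subdividing (triangular) faces, and `F` is the set of the faces
(given by their vertex sets) of its planar embedding. The faces of `K₄` are its four triangles. -/
inductive IsApollonianNetwork : (V : Type) → SimpleGraph V → Set (Set V) → Prop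
  | k4 : IsApollonianNetwork (Fin 4) (⊤ : SimpleGraph (Fin 4)) {s | s.ncard = 3}
  | subdivide {V : Type} {T : SimpleGraph V} {F : Set (Set V)} {t : Set V}
      (h : IsApollonianNetwork V T F) (ht : t ∈ F) :
      IsApollonianNetwork (Option V) (subdivideGraph T t) (subdivideFaces F t)

/-- The dual graph of a plane triangulation `T` with set of faces `F`: its vertices are the faces,
and two distinct faces are adjacent if they have an edge of `T` in common. -/
def dualGraph {V : Type} (T : SimpleGraph V) (F : Set (Set V)) : SimpleGraph F where
  Adj f g := f ≠ g ∧ ∃ e ∈ T.edgeSet, (∀ v ∈ e, v ∈ f.1) ∧ (∀ v ∈ e, v ∈ g.1)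
  symm := ⟨fun _ _ ⟨hne, e, he, hf, hg⟩ => ⟨hne.symm, e, he, hg, hf⟩⟩
  loopless := ⟨fun _ h => h.1 rfl⟩

/-- `G` is (isomorphic to) the dual graph of an Apollonian network. -/
def IsApollonianDual {W : Type*} (G : SimpleGraph W) : Prop :=
  ∃ (V : Type) (T : SimpleGraph V) (F : Set (Set V)),
    IsApollonianNetwork V T F ∧ Nonempty (G ≃g dualGraph T F)

/-! ### Embeddings of graphs on surfaces -/

open Classical in
/-- The point of `ℝ ^ W` that represents the vertex `v`. -/
noncomputable def vertexPoint {W : Type*} (v : W) : W → ℝ := Pi.single v 1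

/-- The finite graph `G` as a topological space: the union, in `ℝ ^ W`, of the vertices and of
the straight segments joining adjacent vertices. -/
def realization {W : Type*} (G : SimpleGraph W) : Set (W → ℝ) :=
  {x | ∃ u v, (u = v ∨ G.Adj u v) ∧ x ∈ segment ℝ (vertexPoint u) (vertexPoint v)}

theorem walkPoint_mem {W : Type*} {G : SimpleGraph W} {u v : W} (w : G.Walk u v) (s : ℝ) :
    AffineMap.lineMap (vertexPoint (w.getVert ⌊s⌋₊)) (vertexPoint (w.getVert (⌊s⌋₊ + 1)))
      (Int.fract s) ∈ realization G := by
  refine ⟨w.getVert ⌊s⌋₊, w.getVert (⌊s⌋₊ + 1), ?_, ?_⟩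
  · by_cases h : ⌊s⌋₊ < w.length
    · exact Or.inr (w.adj_getVert_succ h)
    · left
      rw [w.getVert_of_length_le (by omega), w.getVert_of_length_le (by omega)]
  · rw [segment_eq_image_lineMap]
    exact ⟨_, ⟨Int.fract_nonneg s, (Int.fract_lt_one s).le⟩, rfl⟩

/-- The position at time `s`, `0 ≤ s ≤ w.length`, when the walk `w` is traversed in the graph
with unit speed, each edge having length one. -/
noncomputable def walkPoint {W : Type*} {G : SimpleGraph W} {u v : W} (w : G.Walk u v) (s : ℝ) :
    realization G :=
  ⟨AffineMap.lineMap (vertexPoint (w.getVert ⌊s⌋₊)) (vertexPoint (w.getVert (⌊s⌋₊ + 1)))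
    (Int.fract s), walkPoint_mem w s⟩

/-- The cells of `β(G)`: the connected components of the complement of `β(G)`. -/
def cells {W S : Type*} [TopologicalSpace S] {G : SimpleGraph W} (β : C(realization G, S)) :
    Set (Set S) :=
  {c | ∃ x ∈ (Set.range β)ᶜ, c = connectedComponentIn (Set.range β)ᶜ x}

/-- `β` is a (cellular) embedding: it is injective, and its cells are open discs. -/
def IsCellularEmbedding {W S : Type*} [TopologicalSpace S] {G : SimpleGraph W}
    (β : C(realization G, S)) : Prop :=
  Function.Injective β ∧ ∀ c ∈ cells β, Nonempty (c ≃ₜ Metric.ball (0 : ℂ) 1)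

/-- The closed walk `w` bounds the cell `c`: there is a continuous map from the closed unit disc
that maps the open disc bijectively onto `c` and whose restriction to the unit circle traverses
`β(w)` once with constant speed. (In a Hausdorff space, the map of the open disc onto `c` is then
a homeomorphism, since the closed disc is compact and its boundary is mapped into `β(G)`.) -/
def IsFacialWalk {W S : Type*} [TopologicalSpace S] {G : SimpleGraph W}
    (β : C(realization G, S)) (c : Set S) {v : W} (w : G.Walk v v) : Prop :=
  ∃ φ : ℂ → S, ContinuousOn φ (Metric.closedBall 0 1) ∧ Set.BijOn φ (Metric.ball 0 1) c ∧
    ∀ θ ∈ Set.Icc (0 : ℝ) 1,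
      φ (Complex.exp (2 * Real.pi * θ * Complex.I)) = β (walkPoint w (θ * w.length))

/-- `β` is a strong embedding: a cellular embedding such that the facial walk bounding each cell
(it is unique up to the choice of its starting point and direction) is a cycle. -/
def IsStrongEmbedding {W S : Type*} [TopologicalSpace S] {G : SimpleGraph W}
    (β : C(realization G, S)) : Prop :=
  IsCellularEmbedding β ∧
    ∀ c ∈ cells β, ∃ (v : W) (w : G.Walk v v), IsFacialWalk β c w ∧ w.IsCycle

/-! ### The Klein bottle -/

/-- The identifications of boundary points of the unit square that yield the Klein bottle. -/
inductive KleinRel : unitInterval × unitInterval → unitInterval × unitInterval → Prop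
  | glue (x : unitInterval) : KleinRel (x, 0) (x, 1)
  | flip (y : unitInterval) : KleinRel (0, y) (1, unitInterval.symm y)

/-- The Klein bottle: the quotient of the unit square by the equivalence relation generated by
`(x, 0) ∼ (x, 1)` and `(0, y) ∼ (1, 1 - y)`. -/
def KleinBottle : Type := Quot KleinRel

instance : TopologicalSpace KleinBottle := inferInstanceAs (TopologicalSpace (Quot KleinRel))

/-! Adding a vertex inside a face of a triangulation replaces a cubic vertex of the dual graph by a
triangle (a truncation, `IsTriangulation.exists_truncate_iso`). Apollonian duals are thus the graphs
obtained from `K₄` by truncations, and the first truncation gives the triangular prism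
(`nonempty_prism_iso_truncate`). It remains to embed the prism strongly on the Klein bottle and to
see that truncating a cubic vertex preserves strong embeddability on the same surface.

The prism (`prismDrawing`): in the unit square, the lines `y = 0` and `y = 1/2` become disjoint
one-sided circles. Cutting along both leaves an annulus of circumference 2: the strips `0 < y < 1/2`
and `1/2 < y < 1`, joined across the flipped sides of the square. The two triangles of the prism are
drawn on the circles. The rungs at `x = 0` and `x = 2/3` in the lower strip and at `x = 1/3` in the
upper one are spaced 2/3 apart in the annulus, so they cut it into three rectangles, each bounded by
a Hamiltonian cycle that avoids one rung.

Truncation (`StrongDrawing.nonempty_truncate`): a small circle around `v` crosses each of the three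
edges at `v` once. Its interior becomes a new cell bounded by a triangle; each of the three cells at
`v` loses a corner, and its bounding cycle runs through two new vertices instead of `v`. Everything
else stays.

The induction runs on `StrongDrawing`, which partitions the surface into points, open arcs and open
cells, each cell forming a closed disc with its bounding cycle; its field `corner` provides the
three cells around a cubic vertex. Two topological facts carry the work. Planar convex bodies are
discs (`IsBodyFun.exists_homeomorph`), and by the Alexander trick any parametrization of the
boundary of a closed disc extends to the disc (`IsClosedDisc.exists_extension_ball`). The latter
makes charts of neighbouring cells agree along common edges, so that they glue around `v`
(`StrongDrawing.exists_vertexDisc`), and it turns constant-speed traversals of the bounding cycles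
into facial walks (`StrongDrawing.exists_isStrongEmbedding`). -/

/-! ### Discs and arcs -/

/-- A continuous map on a compact set factors continuously through every continuous map to a
Hausdorff space whose fibres it respects. -/
theorem exists_factor {X Z S : Type*} [TopologicalSpace X] [TopologicalSpace Z]
    [TopologicalSpace S] [T2Space Z] [Nonempty S] {K : Set X} (hK : IsCompact K) {π : X → Z}
    (hπ : ContinuousOn π K) {F : X → S} (hF : ContinuousOn F K)
    (h : ∀ x ∈ K, ∀ y ∈ K, π x = π y → F x = F y) :
    ∃ g : Z → S, ContinuousOn g (π '' K) ∧ ∀ x ∈ K, g (π x) = F x := by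
  classical
  let g : Z → S := fun z => if hz : ∃ x ∈ K, π x = z then F hz.choose else Classical.arbitrary S
  have hg : ∀ x ∈ K, g (π x) = F x := by
    intro x hx
    have hz : ∃ y ∈ K, π y = π x := ⟨x, hx, rfl⟩
    simp only [g, dif_pos hz]
    exact h _ hz.choose_spec.1 _ hx hz.choose_spec.2
  refine ⟨g, ?_, hg⟩
  -- By compactness, `π` carries relatively closed subsets of `K` to compact, hence closed, subsets
  -- of the Hausdorff space `Z`.
  rw [continuousOn_iff_isClosed]
  intro t ht
  obtain ⟨u, hu, hut⟩ := continuousOn_iff_isClosed.1 hF t ht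
  refine ⟨π '' (u ∩ K), ?_, ?_⟩
  · exact ((hK.inter_left hu).image_of_continuousOn (hπ.mono Set.inter_subset_right)).isClosed
  · ext z
    constructor
    · rintro ⟨hz, x, hx, rfl⟩
      have : x ∈ F ⁻¹' t ∩ K := ⟨by simpa [hg x hx] using hz, hx⟩
      rw [hut] at this
      exact ⟨⟨x, this, rfl⟩, x, hx, rfl⟩
    · rintro ⟨⟨x, hx, rfl⟩, -⟩
      have : x ∈ F ⁻¹' t ∩ K := by rw [hut]; exact hx
      exact ⟨by simpa [hg x hx.2] using this.1, x, hx.2, rfl⟩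

theorem exists_continuousOn_leftInverse {X Z : Type*} [TopologicalSpace X] [TopologicalSpace Z]
    [T2Space Z] [Nonempty X] {K : Set X} (hK : IsCompact K) {π : X → Z}
    (hπ : ContinuousOn π K) (hi : Set.InjOn π K) :
    ∃ g : Z → X, ContinuousOn g (π '' K) ∧ ∀ x ∈ K, g (π x) = x :=
  exists_factor hK hπ continuousOn_id fun _ hx _ hy hxy => hi hx hy hxy

/-! ### Closed discs, convex bodies and the Alexander trick -/

/-- `U` is an open disc and `J` its boundary circle: together they form a closed disc in `S`. -/
def IsClosedDisc {S : Type*} [TopologicalSpace S] (U J : Set S) : Prop :=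
  ∃ ψ : ℂ → S, ContinuousOn ψ (Metric.closedBall 0 1) ∧ Set.InjOn ψ (Metric.closedBall 0 1) ∧
    ψ '' Metric.ball 0 1 = U ∧ ψ '' Metric.sphere 0 1 = J

/-- A zero of `F` is not interior to the sublevel set: a point slightly beyond it, as seen from
`z₀`, would also have a nonpositive value, and convexity along the line to `z₀` would make `F`
negative at the zero itself. -/
theorem interior_sublevel {F : ℂ → ℝ} (hF : ConvexOn ℝ Set.univ F) (hc : Continuous F) {z₀ : ℂ}
    (h₀ : F z₀ < 0) : interior {z | F z ≤ 0} = {z | F z < 0} := by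
  apply Set.Subset.antisymm
  · intro z hz
    by_contra hlt
    have hz0 : F z = 0 := le_antisymm (by simpa using interior_subset hz) (not_lt.1 hlt)
    have hline : Continuous fun t : ℝ => z + t • (z - z₀) := by fun_prop
    have hev : ∀ᶠ t : ℝ in nhds 0, z + t • (z - z₀) ∈ {z | F z ≤ 0} := by
      apply hline.continuousAt
      simpa using mem_interior_iff_mem_nhds.1 hz
    obtain ⟨ε, hε, hball⟩ := Metric.eventually_nhds_iff.1 hev
    have h1 : F (z + (ε / 2) • (z - z₀)) ≤ 0 := hball (by
      rw [Real.dist_eq, sub_zero, abs_of_pos (by positivity)]; linarith)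
    have hpos : 0 < 1 + ε / 2 := by positivity
    obtain ⟨-, hF2⟩ := hF
    -- These weights express `z` as a convex combination of the point beyond it and `z₀`.
    have h2 := hF2 (Set.mem_univ (z + (ε / 2) • (z - z₀))) (Set.mem_univ z₀)
      (a := 1 / (1 + ε / 2)) (b := (ε / 2) / (1 + ε / 2)) (by positivity) (by positivity)
      (by field_simp)
    have h3 : (1 / (1 + ε / 2)) • (z + (ε / 2) • (z - z₀)) + ((ε / 2) / (1 + ε / 2)) • z₀ = z := by
      have hne : (1 + (ε : ℂ) / 2) ≠ 0 := by
        have : ((1 + ε / 2 : ℝ) : ℂ) ≠ 0 := by exact_mod_cast hpos.ne'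
        simpa using this
      have hne' : (2 + (ε : ℂ)) ≠ 0 := by
        have : ((2 + ε : ℝ) : ℂ) ≠ 0 := by exact_mod_cast (by positivity)
        simpa using this
      simp only [Complex.real_smul]
      push_cast
      field_simp
      ring
    rw [h3, hz0, smul_eq_mul, smul_eq_mul] at h2
    have h4 : (ε / 2) / (1 + ε / 2) * F z₀ < 0 := mul_neg_of_pos_of_neg (by positivity) h₀
    have h5 : 1 / (1 + ε / 2) * F (z + (ε / 2) • (z - z₀)) ≤ 0 :=
      mul_nonpos_of_nonneg_of_nonpos (by positivity) h1
    linarith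
  · exact interior_maximal (fun z hz => by simpa using le_of_lt (by simpa using hz))
      (isOpen_lt hc continuous_const)

/-- A convex function whose sublevel set is a planar convex body. -/
structure IsBodyFun (F : ℂ → ℝ) : Prop where
  convexOn : ConvexOn ℝ Set.univ F
  continuous : Continuous F
  exists_neg : ∃ z, F z < 0
  bounded : Bornology.IsBounded {z | F z ≤ 0}

/-- Mathlib's homeomorphism of a bounded convex set with nonempty interior onto the unit ball;
describing the body by a function makes its interior and frontier the explicit sets `F < 0` and `F =
0`. -/
theorem IsBodyFun.exists_homeomorph {F : ℂ → ℝ} (hF : IsBodyFun F) :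
    ∃ e : ℂ ≃ₜ ℂ, e '' {z | F z < 0} = Metric.ball 0 1 ∧
      e '' {z | F z ≤ 0} = Metric.closedBall 0 1 ∧ e '' {z | F z = 0} = Metric.sphere 0 1 := by
  obtain ⟨z₀, h₀⟩ := hF.exists_neg
  have hint := interior_sublevel hF.convexOn hF.continuous h₀
  have hcl : IsClosed {z | F z ≤ 0} := isClosed_le hF.continuous continuous_const
  have hcv : Convex ℝ {z | F z ≤ 0} := by simpa using hF.convexOn.convex_le 0
  obtain ⟨e, h1, h2, h3⟩ := exists_homeomorph_image_interior_closure_frontier_eq_unitBall hcv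
    (by rw [hint]; exact ⟨z₀, h₀⟩) hF.bounded
  have hfr : frontier {z | F z ≤ 0} = {z | F z = 0} := by
    rw [hcl.frontier_eq, hint]
    ext z
    simp [le_antisymm_iff]
  refine ⟨e, hint ▸ h1, ?_, hfr ▸ h3⟩
  rwa [hcl.closure_eq] at h2

theorem IsBodyFun.isClosedDisc {S : Type*} [TopologicalSpace S] {F : ℂ → ℝ} (hF : IsBodyFun F)
    {f : ℂ → S} (hc : ContinuousOn f {z | F z ≤ 0}) (hi : Set.InjOn f {z | F z ≤ 0}) :
    IsClosedDisc (f '' {z | F z < 0}) (f '' {z | F z = 0}) := by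
  obtain ⟨e, h1, h2, h3⟩ := hF.exists_homeomorph
  have hm : Set.MapsTo e.symm (Metric.closedBall 0 1) {z | F z ≤ 0} := by
    rw [← h2]
    rintro _ ⟨z, hz, rfl⟩
    simpa using hz
  refine ⟨f ∘ e.symm, hc.comp e.symm.continuous.continuousOn hm,
    hi.comp e.symm.injective.injOn hm, ?_, ?_⟩
  · rw [← h1, Set.image_comp, ← Set.image_comp e.symm e]
    simp
  · rw [← h3, Set.image_comp, ← Set.image_comp e.symm e]
    simp

theorem exists_eq_smul_sphere (z : ℂ) : ∃ w ∈ Metric.sphere (0 : ℂ) 1, z = ‖z‖ • w := by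
  by_cases hz : z = 0
  · exact ⟨1, by simp, by simp [hz]⟩
  · refine ⟨‖z‖⁻¹ • z, by simp [hz], ?_⟩
    rw [smul_smul, mul_inv_cancel₀ (norm_ne_zero_iff.2 hz), one_smul]

/-- The Alexander trick: a homeomorphism of boundary circles extends to the discs. -/
theorem IsClosedDisc.exists_extension_ball {S : Type*} [TopologicalSpace S] [T2Space S]
    {U J : Set S} (hD : IsClosedDisc U J) {h : ℂ → S}
    (hc : ContinuousOn h (Metric.sphere 0 1)) (hi : Set.InjOn h (Metric.sphere 0 1))
    (hJ : h '' Metric.sphere 0 1 = J) :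
    ∃ Ψ : ℂ → S, ContinuousOn Ψ (Metric.closedBall 0 1) ∧ Set.InjOn Ψ (Metric.closedBall 0 1) ∧
      Set.EqOn Ψ h (Metric.sphere 0 1) ∧ Ψ '' Metric.ball 0 1 = U := by
  obtain ⟨ψ, ψc, ψi, rfl, rfl⟩ := hD
  obtain ⟨χ, χc, hχ⟩ := exists_continuousOn_leftInverse (isCompact_closedBall 0 1) ψc ψi
  have hsub : Metric.sphere (0 : ℂ) 1 ⊆ Metric.closedBall 0 1 := Metric.sphere_subset_closedBall
  have key : ∀ z ∈ Metric.sphere (0 : ℂ) 1, χ (h z) ∈ Metric.sphere (0 : ℂ) 1 ∧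
      ψ (χ (h z)) = h z := by
    intro z hz
    obtain ⟨w, hw, hwz⟩ : h z ∈ ψ '' Metric.sphere 0 1 := hJ ▸ ⟨z, hz, rfl⟩
    rw [← hwz, hχ w (hsub hw)]
    exact ⟨hw, rfl⟩
  have gc : ContinuousOn (fun z => χ (h z)) (Metric.sphere 0 1) :=
    χc.comp hc fun z hz => ⟨_, hsub (key z hz).1, (key z hz).2⟩
  have gi : Set.InjOn (fun z => χ (h z)) (Metric.sphere 0 1) := by
    intro z hz w hw hzw
    apply hi hz hw
    rw [← (key z hz).2, ← (key w hw).2]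
    exact congrArg ψ hzw
  have gs : ∀ w ∈ Metric.sphere (0 : ℂ) 1, ∃ z ∈ Metric.sphere (0 : ℂ) 1, χ (h z) = w := by
    intro w hw
    obtain ⟨z, hz, hzw⟩ : ψ w ∈ h '' Metric.sphere 0 1 := hJ ▸ ⟨w, hw, rfl⟩
    exact ⟨z, hz, by rw [hzw, hχ w (hsub hw)]⟩
  -- Polar coordinates present the disc as a quotient of `[0, 1]` times the circle. The extension is
  -- radial, `r • z ↦ ψ (r • χ (h z))`; it descends to the disc because the whole fibre over the
  -- centre goes to `ψ 0`.
  let K : Set (ℝ × ℂ) := Set.Icc 0 1 ×ˢ Metric.sphere 0 1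
  have hK : IsCompact K := isCompact_Icc.prod (isCompact_sphere 0 1)
  have nrm : ∀ r ∈ Set.Icc (0 : ℝ) 1, ∀ z ∈ Metric.sphere (0 : ℂ) 1, ‖r • z‖ = r := by
    intro r hr z hz
    rw [norm_smul, mem_sphere_zero_iff_norm.1 hz, mul_one, Real.norm_of_nonneg hr.1]
  have inj : ∀ r ∈ Set.Icc (0 : ℝ) 1, ∀ z ∈ Metric.sphere (0 : ℂ) 1, ∀ r' ∈ Set.Icc (0 : ℝ) 1,
      ∀ z' ∈ Metric.sphere (0 : ℂ) 1, r • z = r' • z' → r = r' ∧ (r = 0 ∨ z = z') := by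
    intro r hr z hz r' hr' z' hz' e
    have h1 : r = r' := by rw [← nrm r hr z hz, e, nrm r' hr' z' hz']
    refine ⟨h1, ?_⟩
    by_cases h0 : r = 0
    · exact Or.inl h0
    · right
      rw [← h1] at e
      exact smul_right_injective ℂ h0 e
  have mem : ∀ p ∈ K, p.1 • χ (h p.2) ∈ Metric.closedBall (0 : ℂ) 1 := by
    rintro ⟨r, z⟩ ⟨hr, hz⟩
    simp only [mem_closedBall_zero_iff]
    rw [nrm r hr _ (key z hz).1]
    exact hr.2
  have : Nonempty S := ⟨ψ 0⟩
  obtain ⟨Ψ, Ψc, hΨ⟩ := exists_factor (S := S) (Z := ℂ) (hK := hK)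
    (π := fun p => p.1 • p.2) (F := fun p => ψ (p.1 • χ (h p.2)))
    (hπ := by fun_prop)
    (hF := ψc.comp (continuous_fst.continuousOn.smul
        (gc.comp continuous_snd.continuousOn fun p hp => hp.2)) mem)
    (h := by
      rintro ⟨r, z⟩ ⟨hr, hz⟩ ⟨r', z'⟩ ⟨hr', hz'⟩ e
      obtain ⟨rfl, rfl | rfl⟩ := inj r hr z hz r' hr' z' hz' e
      · simp
      · rfl)
  have him : (fun p : ℝ × ℂ => p.1 • p.2) '' K = Metric.closedBall 0 1 := by
    ext z
    constructor
    · rintro ⟨⟨r, z⟩, ⟨hr, hz⟩, rfl⟩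
      exact mem_closedBall_zero_iff.2 ((nrm r hr z hz).trans_le hr.2)
    · intro hz
      obtain ⟨w, hw, e⟩ := exists_eq_smul_sphere z
      exact ⟨(‖z‖, w), ⟨⟨norm_nonneg z, by simpa using hz⟩, hw⟩, e.symm⟩
  rw [him] at Ψc
  have val : ∀ z ∈ Metric.closedBall (0 : ℂ) 1, ∃ w ∈ Metric.sphere (0 : ℂ) 1,
      z = ‖z‖ • w ∧ Ψ z = ψ (‖z‖ • χ (h w)) := by
    intro z hz
    obtain ⟨w, hw, e⟩ := exists_eq_smul_sphere z
    refine ⟨w, hw, e, ?_⟩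
    rw [← hΨ (‖z‖, w) ⟨⟨norm_nonneg z, by simpa using hz⟩, hw⟩]
    exact congrArg Ψ e
  refine ⟨Ψ, Ψc, ?_, ?_, ?_⟩
  · intro z hz z' hz' e
    obtain ⟨w, hw, e1, e2⟩ := val z hz
    obtain ⟨w', hw', e1', e2'⟩ := val z' hz'
    have hr : ‖z‖ ∈ Set.Icc (0 : ℝ) 1 := ⟨norm_nonneg z, by simpa using hz⟩
    have hr' : ‖z'‖ ∈ Set.Icc (0 : ℝ) 1 := ⟨norm_nonneg z', by simpa using hz'⟩
    rw [e2, e2'] at e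
    have := ψi (mem (‖z‖, w) ⟨hr, hw⟩) (mem (‖z'‖, w') ⟨hr', hw'⟩) e
    obtain ⟨h1, h2⟩ := inj _ hr _ (key w hw).1 _ hr' _ (key w' hw').1 this
    rcases h2 with h2 | h2
    · rw [e1, e1', ← h1, h2, zero_smul, zero_smul]
    · rw [e1, e1', ← h1, gi hw hw' h2]
  · intro z hz
    have := hΨ (1, z) ⟨by simp, hz⟩
    simp only [one_smul] at this
    rw [this, (key z hz).2]
  · ext x
    constructor
    · rintro ⟨z, hz, rfl⟩
      obtain ⟨w, hw, e1, e2⟩ := val z (Metric.ball_subset_closedBall hz)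
      refine ⟨_, ?_, e2.symm⟩
      have hz1 : ‖z‖ < 1 := by simpa using hz
      rw [mem_ball_zero_iff, nrm _ ⟨norm_nonneg z, hz1.le⟩ _ (key w hw).1]
      exact hz1
    · rintro ⟨z, hz, rfl⟩
      have hz1 : ‖z‖ < 1 := by simpa using hz
      obtain ⟨w, hw, e1⟩ := exists_eq_smul_sphere z
      obtain ⟨y, hy, rfl⟩ := gs w hw
      have hr : ‖z‖ ∈ Set.Icc (0 : ℝ) 1 := ⟨norm_nonneg z, hz1.le⟩
      refine ⟨‖z‖ • y, ?_, ?_⟩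
      · rw [mem_ball_zero_iff, nrm _ hr _ hy]
        exact hz1
      · rw [hΨ (‖z‖, y) ⟨hr, hy⟩]
        exact congrArg ψ e1.symm

/-- The Alexander trick with a convex body as source, so that a cell can be parametrized by a
polygon whose sides follow prescribed arcs of the boundary. -/
theorem IsClosedDisc.exists_extension {S : Type*} [TopologicalSpace S] [T2Space S]
    {U J : Set S} (hD : IsClosedDisc U J) {F : ℂ → ℝ} (hF : IsBodyFun F) {h : ℂ → S}
    (hc : ContinuousOn h {z | F z = 0}) (hi : Set.InjOn h {z | F z = 0})
    (hJ : h '' {z | F z = 0} = J) :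
    ∃ Ψ : ℂ → S, ContinuousOn Ψ {z | F z ≤ 0} ∧ Set.InjOn Ψ {z | F z ≤ 0} ∧
      Set.EqOn Ψ h {z | F z = 0} ∧ Ψ '' {z | F z < 0} = U := by
  obtain ⟨e, h1, h2, h3⟩ := hF.exists_homeomorph
  have hm : Set.MapsTo e.symm (Metric.sphere 0 1) {z | F z = 0} := by
    rw [← h3]
    rintro _ ⟨z, hz, rfl⟩
    simpa using hz
  have hm' : Set.MapsTo e {z | F z ≤ 0} (Metric.closedBall 0 1) := by
    rw [← h2]
    exact Set.mapsTo_image _ _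
  obtain ⟨Ψ, Ψc, Ψi, Ψe, Ψu⟩ := hD.exists_extension_ball (h := h ∘ e.symm)
    (hc.comp e.symm.continuous.continuousOn hm) (hi.comp e.symm.injective.injOn hm) (by
      rw [← hJ, ← h3, Set.image_comp, ← Set.image_comp e.symm e]
      simp)
  refine ⟨Ψ ∘ e, Ψc.comp e.continuous.continuousOn hm', Ψi.comp e.injective.injOn hm', ?_, ?_⟩
  · intro z hz
    have : e z ∈ Metric.sphere (0 : ℂ) 1 := h3 ▸ ⟨z, hz, rfl⟩
    simpa using Ψe this
  · rw [Set.image_comp, h1, Ψu]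

theorem IsClosedDisc.isCompact {S : Type*} [TopologicalSpace S] {U J : Set S}
    (hD : IsClosedDisc U J) : IsCompact (U ∪ J) := by
  obtain ⟨ψ, ψc, -, rfl, rfl⟩ := hD
  rw [← Set.image_union, Metric.ball_union_sphere]
  exact (isCompact_closedBall 0 1).image_of_continuousOn ψc

/-! ### Arcs: reparametrization, reversal and concatenation -/

/-- `γ` parametrizes the open arc `O` with end points `x` and `y`. -/
def IsArcParam {S : Type*} [TopologicalSpace S] (γ : ℝ → S) (O : Set S) (x y : S) : Prop :=
  ContinuousOn γ (Set.Icc 0 1) ∧ Set.InjOn γ (Set.Icc 0 1) ∧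
    γ 0 = x ∧ γ 1 = y ∧ γ '' Set.Ioo 0 1 = O

/-- `O` is an open arc with end points `x` and `y`. -/
def IsArc {S : Type*} [TopologicalSpace S] (O : Set S) (x y : S) : Prop :=
  ∃ γ : ℝ → S, IsArcParam γ O x y

/-- Every injectivity check for glued arcs comes down to this: a common point can only be an end
point of both. -/
theorem IsArcParam.cross {S : Type*} [TopologicalSpace S] {γ δ : ℝ → S} {O O' : Set S}
    {x y x' y' : S} (hγ : IsArcParam γ O x y) (hδ : IsArcParam δ O' x' y') (hOO : Disjoint O O')
    (hx : x ∉ O') (hy : y ∉ O') (hx' : x' ∉ O) (hy' : y' ∉ O) {t s : ℝ} (ht : t ∈ Set.Icc 0 1)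
    (hs : s ∈ Set.Icc 0 1) (h : γ t = δ s) : (t = 0 ∨ t = 1) ∧ (s = 0 ∨ s = 1) := by
  obtain ⟨-, -, rfl, rfl, rfl⟩ := hγ
  obtain ⟨-, -, rfl, rfl, rfl⟩ := hδ
  have ht' : (t = 0 ∨ t = 1) ∨ t ∈ Set.Ioo 0 1 := by
    rcases ht.1.eq_or_lt with h1 | h1
    · exact Or.inl (Or.inl h1.symm)
    · rcases ht.2.eq_or_lt with h2 | h2
      · exact Or.inl (Or.inr h2)
      · exact Or.inr ⟨h1, h2⟩
  have hs' : (s = 0 ∨ s = 1) ∨ s ∈ Set.Ioo 0 1 := by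
    rcases hs.1.eq_or_lt with h1 | h1
    · exact Or.inl (Or.inl h1.symm)
    · rcases hs.2.eq_or_lt with h2 | h2
      · exact Or.inl (Or.inr h2)
      · exact Or.inr ⟨h1, h2⟩
  rcases ht' with ht' | ht' <;> rcases hs' with hs' | hs'
  · exact ⟨ht', hs'⟩
  · rcases ht' with rfl | rfl
    · exact (hx ⟨s, hs', h.symm⟩).elim
    · exact (hy ⟨s, hs', h.symm⟩).elim
  · rcases hs' with rfl | rfl
    · exact (hx' ⟨t, ht', h⟩).elim
    · exact (hy' ⟨t, ht', h⟩).elim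
  · exact (Set.disjoint_left.1 hOO ⟨t, ht', rfl⟩ ⟨s, hs', h.symm⟩).elim

theorem isArc_of_Icc {S : Type*} [TopologicalSpace S] {γ : ℝ → S} {a b : ℝ} (hab : a < b)
    (hc : ContinuousOn γ (Set.Icc a b)) (hi : Set.InjOn γ (Set.Icc a b)) :
    IsArc (γ '' Set.Ioo a b) (γ a) (γ b) := by
  have hpos : 0 < b - a := sub_pos.2 hab
  have hm : Set.MapsTo (fun t : ℝ => a + t * (b - a)) (Set.Icc 0 1) (Set.Icc a b) := by
    intro t ht
    constructor <;> nlinarith [ht.1, ht.2]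
  refine ⟨fun t => γ (a + t * (b - a)), hc.comp (by fun_prop) hm, ?_, by simp, by simp, ?_⟩
  · intro t ht t' ht' e
    have := hi (hm ht) (hm ht') e
    have h2 : t * (b - a) = t' * (b - a) := by simpa using this
    exact mul_right_cancel₀ hpos.ne' h2
  · ext x
    constructor
    · rintro ⟨t, ht, rfl⟩
      exact ⟨_, ⟨by nlinarith [ht.1, ht.2], by nlinarith [ht.1, ht.2]⟩, rfl⟩
    · rintro ⟨s, hs, rfl⟩
      refine ⟨(s - a) / (b - a), ⟨div_pos (by linarith [hs.1]) hpos,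
        (div_lt_one hpos).2 (by linarith [hs.2])⟩, ?_⟩
      change γ (a + (s - a) / (b - a) * (b - a)) = γ s
      rw [div_mul_cancel₀ _ hpos.ne', add_sub_cancel]

theorem IsArc.symm {S : Type*} [TopologicalSpace S] {O : Set S} {x y : S} (h : IsArc O x y) :
    IsArc O y x := by
  obtain ⟨γ, γc, γi, rfl, rfl, rfl⟩ := h
  have hm : Set.MapsTo (fun t : ℝ => 1 - t) (Set.Icc 0 1) (Set.Icc 0 1) := by
    intro t ht
    constructor <;> linarith [ht.1, ht.2]
  refine ⟨fun t => γ (1 - t), γc.comp (by fun_prop) hm, ?_, by simp, by simp, ?_⟩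
  · intro t ht t' ht' e
    have := γi (hm ht) (hm ht') e
    linarith
  · ext x
    constructor
    · rintro ⟨t, ht, rfl⟩
      exact ⟨1 - t, ⟨by linarith [ht.2], by linarith [ht.1]⟩, rfl⟩
    · rintro ⟨t, ht, rfl⟩
      exact ⟨1 - t, ⟨by linarith [ht.2], by linarith [ht.1]⟩, by simp⟩

theorem IsArc.trans {S : Type*} [TopologicalSpace S] {O O' : Set S} {x y z : S}
    (h : IsArc O x y) (h' : IsArc O' y z) (hOO : Disjoint O O') (hxO : x ∉ O') (hzO : z ∉ O)
    (hyO : y ∉ O) (hyO' : y ∉ O') (hxz : x ≠ z) : IsArc (O ∪ {y} ∪ O') x z := by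
  obtain ⟨γ, γc, γi, rfl, rfl, rfl⟩ := h
  obtain ⟨δ, δc, δi, hδ, rfl, rfl⟩ := h'
  let f : ℝ → S := fun t => if t ≤ 1 then γ t else δ (t - 1)
  have f1 : ∀ t ≤ 1, f t = γ t := fun t ht => if_pos ht
  have f2 : ∀ t ≥ 1, f t = δ (t - 1) := by
    intro t ht
    rcases ht.lt_or_eq with h | rfl
    · exact if_neg (not_le.2 h)
    · simp [f, hδ]
  have hc : ContinuousOn f (Set.Icc 0 2) := by
    have : Set.Icc (0 : ℝ) 2 = Set.Icc 0 1 ∪ Set.Icc 1 2 :=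
      (Set.Icc_union_Icc_eq_Icc (by norm_num) (by norm_num)).symm
    rw [this]
    refine ContinuousOn.union_of_isClosed ?_ ?_ isClosed_Icc isClosed_Icc
    · exact γc.congr fun t ht => f1 t ht.2
    · refine ContinuousOn.congr (f := fun t => δ (t - 1)) ?_ fun t ht => f2 t ht.1
      exact δc.comp (by fun_prop) fun t ht => ⟨by linarith [ht.1], by linarith [ht.2]⟩
  have cross : ∀ t ∈ Set.Icc (0 : ℝ) 1, ∀ s ∈ Set.Ioc (0 : ℝ) 1, γ t ≠ δ s := by
    intro t ht s hs e
    obtain ⟨h1, h2⟩ := IsArcParam.cross ⟨γc, γi, rfl, rfl, rfl⟩ ⟨δc, δi, hδ, rfl, rfl⟩ hOO hxO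
      hyO' hyO hzO ht ⟨hs.1.le, hs.2⟩ e
    obtain rfl : s = 1 := h2.resolve_left hs.1.ne'
    rcases h1 with rfl | rfl
    · exact hxz e
    · rw [← hδ] at e
      have := δi (by simp) (by simp) e
      norm_num at this
  have hi : Set.InjOn f (Set.Icc 0 2) := by
    intro t ht s hs e
    rcases le_or_gt t 1 with h | h <;> rcases le_or_gt s 1 with h' | h'
    · rw [f1 t h, f1 s h'] at e
      exact γi ⟨ht.1, h⟩ ⟨hs.1, h'⟩ e
    · rw [f1 t h, f2 s h'.le] at e
      exact (cross t ⟨ht.1, h⟩ _ ⟨by linarith, by linarith [hs.2]⟩ e).elim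
    · rw [f1 s h', f2 t h.le] at e
      exact (cross s ⟨hs.1, h'⟩ _ ⟨by linarith, by linarith [ht.2]⟩ e.symm).elim
    · rw [f2 t h.le, f2 s h'.le] at e
      have := δi ⟨by linarith, by linarith [ht.2]⟩ ⟨by linarith, by linarith [hs.2]⟩ e
      linarith
  have := isArc_of_Icc (by norm_num) hc hi
  rw [f1 0 (by norm_num), f2 2 (by norm_num), show (2 : ℝ) - 1 = 1 by norm_num] at this
  convert this using 1
  ext x
  constructor
  · rintro ((⟨t, ht, rfl⟩ | rfl) | ⟨t, ht, rfl⟩)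
    · exact ⟨t, ⟨ht.1, by linarith [ht.2]⟩, f1 t ht.2.le⟩
    · exact ⟨1, by norm_num, f1 1 le_rfl⟩
    · exact ⟨t + 1, ⟨by linarith [ht.1], by linarith [ht.2]⟩, by
        rw [f2 _ (by linarith [ht.1])]; simp⟩
  · rintro ⟨t, ht, rfl⟩
    rcases lt_trichotomy t 1 with h | rfl | h
    · exact Or.inl (Or.inl ⟨t, ⟨ht.1, h⟩, (f1 t h.le).symm⟩)
    · exact Or.inl (Or.inr (f1 1 le_rfl))
    · exact Or.inr ⟨t - 1, ⟨by linarith, by linarith [ht.2]⟩, (f2 t h.le).symm⟩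

/-! ### Cycles as graphs -/

/-- `C` consists of the edges of a cycle of `G`. -/
def IsCycleIn {W : Type*} (G C : SimpleGraph W) : Prop :=
  ∃ (v : W) (w : G.Walk v v), w.IsCycle ∧ ∀ x y, s(x, y) ∈ w.edges ↔ C.Adj x y

theorem IsCycleIn.le {W : Type*} {G C : SimpleGraph W} (h : IsCycleIn G C) : C ≤ G := by
  obtain ⟨v, w, -, hw⟩ := h
  intro x y hxy
  exact w.adj_of_mem_edges ((hw x y).2 hxy)

/-- Rotate the closed walk so that it starts at `v` and remove its first and last edges. This
splitting of a cycle into a vertex, two edges and a path is the form in which cycles are used;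
`IsCycleIn.of_path` is the converse. -/
theorem IsCycleIn.exists_path {W : Type*} {G C : SimpleGraph W} (h : IsCycleIn G C) {v a : W}
    (ha : C.Adj v a) : ∃ (b : W) (q : G.Walk a b), q.IsPath ∧ v ∉ q.support ∧ a ≠ b ∧
      ∀ x y, C.Adj x y ↔ s(x, y) ∈ q.edges ∨ s(x, y) = s(v, a) ∨ s(x, y) = s(v, b) := by
  classical
  obtain ⟨u, w, hc, hw⟩ := h
  have hv : v ∈ w.support := w.fst_mem_support_of_mem_edges ((hw v a).2 ha)
  have hc' := hc.rotate hv
  have hw' : ∀ x y, s(x, y) ∈ (w.rotate v hv).edges ↔ C.Adj x y := by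
    intro x y
    rw [(w.rotate_edges v hv).mem_iff, hw]
  generalize w.rotate v hv = w' at hc' hw'
  cases w' with
  | nil => exact (hc'.not_nil (by simp)).elim
  | @cons _ c _ hvc p =>
    rw [SimpleGraph.Walk.cons_isCycle_iff] at hc'
    obtain ⟨hp, hne⟩ := hc'
    -- Reversing the remaining path turns its last edge into a first one, so that the second edge at
    -- `v` can also be split off by `cons`.
    obtain ⟨p', hp'⟩ : ∃ p' : G.Walk v c, p' = p.reverse := ⟨_, rfl⟩
    have hpp : p = p'.reverse := by rw [hp', SimpleGraph.Walk.reverse_reverse]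
    subst hpp
    clear hp'
    rw [SimpleGraph.Walk.isPath_reverse_iff] at hp
    simp only [SimpleGraph.Walk.edges_reverse, List.mem_reverse] at hne
    cases p' with
    | nil => exact (G.irrefl hvc).elim
    | @cons _ d _ hvd q =>
      rw [SimpleGraph.Walk.cons_isPath_iff] at hp
      have hdc : d ≠ c := by
        rintro rfl
        simp at hne
      have hC : ∀ x y, C.Adj x y ↔ s(x, y) ∈ q.edges ∨ s(x, y) = s(v, d) ∨ s(x, y) = s(v, c) := by
        intro x y
        rw [← hw']
        simp only [SimpleGraph.Walk.edges_cons, SimpleGraph.Walk.edges_reverse, List.mem_cons,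
          List.mem_reverse]
        tauto
      have hvq : ∀ x, s(v, x) ∉ q.edges := fun x hx =>
        hp.2 (q.fst_mem_support_of_mem_edges hx)
      rcases (hC v a).1 ha with h | h | h
      · exact (hvq a h).elim
      · obtain rfl : a = d := Sym2.congr_right.1 h
        exact ⟨c, q, hp.1, hp.2, hdc, hC⟩
      · obtain rfl : a = c := Sym2.congr_right.1 h
        refine ⟨d, q.reverse, hp.1.reverse, by simpa using hp.2, hdc.symm, fun x y => ?_⟩
        rw [hC, SimpleGraph.Walk.edges_reverse, List.mem_reverse]
        tauto

theorem IsCycleIn.of_path {W : Type*} {G C : SimpleGraph W} {v a b : W} (q : G.Walk a b)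
    (hq : q.IsPath) (hv : v ∉ q.support) (hab : a ≠ b) (ha : G.Adj v a) (hb : G.Adj v b)
    (hC : ∀ x y, C.Adj x y ↔ s(x, y) ∈ q.edges ∨ s(x, y) = s(v, a) ∨ s(x, y) = s(v, b)) :
    IsCycleIn G C := by
  refine ⟨v, SimpleGraph.Walk.cons ha (q.concat hb.symm), ?_, ?_⟩
  · rw [SimpleGraph.Walk.cons_isCycle_iff]
    refine ⟨hq.concat hv _, ?_⟩
    rw [SimpleGraph.Walk.edges_concat]
    simp only [List.concat_eq_append, List.mem_append, List.mem_singleton, not_or]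
    refine ⟨fun h => hv (q.fst_mem_support_of_mem_edges h), fun h => hab ?_⟩
    rw [Sym2.eq_swap] at h
    exact Sym2.congr_left.1 h
  · intro x y
    rw [hC, SimpleGraph.Walk.edges_cons, SimpleGraph.Walk.edges_concat]
    simp only [List.concat_eq_append, List.mem_append, List.mem_cons]
    rw [Sym2.eq_swap (a := b)]
    tauto

theorem IsCycleIn.eq_or_eq {W : Type*} {G C : SimpleGraph W} (h : IsCycleIn G C) {v a b : W}
    (ha : C.Adj v a) (hb : C.Adj v b) (hab : a ≠ b) {c : W} (hc : C.Adj v c) :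
    c = a ∨ c = b := by
  obtain ⟨b', q, -, hv, -, hC⟩ := h.exists_path ha
  have key : ∀ c, C.Adj v c → c = a ∨ c = b' := by
    intro c hc
    rcases (hC v c).1 hc with h | h | h
    · exact (hv (q.fst_mem_support_of_mem_edges h)).elim
    · exact Or.inl (Sym2.congr_right.1 h)
    · exact Or.inr (Sym2.congr_right.1 h)
  rcases key b hb with h1 | rfl
  · exact (hab h1.symm).elim
  · exact key c hc

theorem IsCycleIn.exists_path_of_adj {W : Type*} {G C : SimpleGraph W} (h : IsCycleIn G C)
    {v a b : W} (ha : C.Adj v a) (hb : C.Adj v b) (hab : a ≠ b) :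
    ∃ q : G.Walk a b, q.IsPath ∧ v ∉ q.support ∧
      ∀ x y, C.Adj x y ↔ s(x, y) ∈ q.edges ∨ s(x, y) = s(v, a) ∨ s(x, y) = s(v, b) := by
  obtain ⟨b', q, hq, hv, hne, hC⟩ := h.exists_path ha
  have hb' : C.Adj v b' := (hC v b').2 (Or.inr (Or.inr rfl))
  obtain rfl : b' = b := (h.eq_or_eq ha hb hab hb').resolve_left hne.symm
  exact ⟨q, hq, hv, hC⟩

theorem IsCycleIn.map {W W' : Type*} {G C : SimpleGraph W} {G' C' : SimpleGraph W'}
    (h : IsCycleIn G C) (f : G ≃g G') (hC : ∀ x y, C'.Adj (f x) (f y) ↔ C.Adj x y) :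
    IsCycleIn G' C' := by
  obtain ⟨v, w, hc, hw⟩ := h
  refine ⟨f v, w.map f.toHom, hc.map f.injective, fun x y => ?_⟩
  obtain ⟨x, rfl⟩ := f.surjective x
  obtain ⟨y, rfl⟩ := f.surjective y
  rw [hC, ← hw, SimpleGraph.Walk.edges_map, List.mem_map]
  constructor
  · rintro ⟨e, he, hxy⟩
    have : Sym2.map f e = Sym2.map f s(x, y) := hxy
    rwa [← Sym2.map.injective f.injective this]
  · intro he
    exact ⟨_, he, rfl⟩

/-! ### Strong drawings -/

/-- The points of the vertices and open edges of the subgraph `C`. -/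
def drawnSet {W S : Type*} (pt : W → S) (O : W → W → Set S) (C : SimpleGraph W) : Set S :=
  {x | ∃ u w, C.Adj u w ∧ (x = pt u ∨ x ∈ O u w)}

/-- A strong embedding of `G` on the space `S`, described by the position `pt v` of each vertex
`v`, the open arc `O u w` of each edge `uw`, the cells `U i` and their bounding cycles `C i`.
Each pair of adjacent edges is consecutive on exactly one bounding cycle. -/
structure StrongDrawing {W : Type*} (G : SimpleGraph W) (S : Type*) [TopologicalSpace S]
    (ι : Type*) where
  pt : W → S
  O : W → W → Set S
  U : ι → Set S
  C : ι → SimpleGraph W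
  O_symm : ∀ u w, O u w = O w u
  cover : ∀ x, (∃ u, x = pt u) ∨ (∃ u w, G.Adj u w ∧ x ∈ O u w) ∨ ∃ i, x ∈ U i
  pt_inj : Function.Injective pt
  adj_of_mem : ∀ {x u w}, x ∈ O u w → G.Adj u w
  pt_notMem_O : ∀ v u w, pt v ∉ O u w
  pt_notMem_U : ∀ v i, pt v ∉ U i
  O_notMem_U : ∀ {x u w} i, x ∈ O u w → x ∉ U i
  U_inj : ∀ {x i j}, x ∈ U i → x ∈ U j → i = j
  O_inj : ∀ {x u w u' w'}, x ∈ O u w → x ∈ O u' w' → s(u, w) = s(u', w')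
  isArc : ∀ {u w}, G.Adj u w → IsArc (O u w) (pt u) (pt w)
  isDisc : ∀ i, IsClosedDisc (U i) (drawnSet pt O (C i))
  isCycle : ∀ i, IsCycleIn G (C i)
  corner : ∀ {v a b}, G.Adj v a → G.Adj v b → a ≠ b → ∃! i, (C i).Adj v a ∧ (C i).Adj v b

/-- Transport of a drawing along an isomorphism of graphs. -/
def StrongDrawing.map {W W' : Type*} {G : SimpleGraph W} {G' : SimpleGraph W'} {S : Type*}
    [TopologicalSpace S] {ι : Type*} (D : StrongDrawing G S ι) (f : G' ≃g G) :
    StrongDrawing G' S ι where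
  pt u := D.pt (f u)
  O u w := D.O (f u) (f w)
  U := D.U
  C i := (D.C i).comap f
  O_symm _ _ := D.O_symm _ _
  cover x := by
    rcases D.cover x with ⟨u, h⟩ | ⟨u, w, h, hx⟩ | h
    · exact Or.inl ⟨f.symm u, by simpa using h⟩
    · exact Or.inr (Or.inl ⟨f.symm u, f.symm w, f.symm.map_adj_iff.2 h, by simpa using hx⟩)
    · exact Or.inr (Or.inr h)
  pt_inj := D.pt_inj.comp f.injective
  adj_of_mem h := f.map_adj_iff.1 (D.adj_of_mem h)
  pt_notMem_O _ _ _ := D.pt_notMem_O _ _ _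
  pt_notMem_U _ _ := D.pt_notMem_U _ _
  O_notMem_U _ h := D.O_notMem_U _ h
  U_inj h h' := D.U_inj h h'
  O_inj h h' := Sym2.map.injective f.injective (D.O_inj h h')
  isArc h := D.isArc (f.map_adj_iff.2 h)
  isDisc i := by
    convert D.isDisc i using 1
    ext x
    constructor
    · rintro ⟨u, w, h, hx⟩
      exact ⟨f u, f w, h, hx⟩
    · rintro ⟨u, w, h, hx⟩
      exact ⟨f.symm u, f.symm w, by simpa using h, by simpa using hx⟩
  isCycle i := (D.isCycle i).map f.symm fun x y => by simp
  corner {v a b} ha hb hab := D.corner (f.map_adj_iff.2 ha) (f.map_adj_iff.2 hb)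
    (f.injective.ne hab)

namespace StrongDrawing

variable {W : Type*} {G : SimpleGraph W} {S : Type*} [TopologicalSpace S] {ι : Type*}
  (D : StrongDrawing G S ι)

/-- The boundary circle of a cell. -/
abbrev J (i : ι) : Set S := drawnSet D.pt D.O (D.C i)

theorem notMem_J {i : ι} {x : S} (hx : x ∈ D.U i) (j : ι) : x ∉ D.J j := by
  rintro ⟨u, w, -, rfl | h⟩
  · exact D.pt_notMem_U _ _ hx
  · exact D.O_notMem_U _ h hx

theorem adj_of_mem_J {i : ι} {x : S} {u w : W} (hx : x ∈ D.O u w) (hJ : x ∈ D.J i) :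
    (D.C i).Adj u w := by
  obtain ⟨u', w', h, rfl | hx'⟩ := hJ
  · exact (D.pt_notMem_O _ _ _ hx).elim
  · have e := D.O_inj hx hx'
    rwa [← SimpleGraph.mem_edgeSet, e]

/-- A path of the graph is drawn as an arc. -/
theorem isArc_of_path {a b : W} (q : G.Walk a b) (hq : q.IsPath) (hab : a ≠ b) :
    IsArc ({x | ∃ u w, s(u, w) ∈ q.edges ∧ x ∈ D.O u w} ∪
      {x | ∃ u ∈ q.support, u ≠ a ∧ u ≠ b ∧ x = D.pt u}) (D.pt a) (D.pt b) := by
  induction q with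
  | nil => exact (hab rfl).elim
  | @cons a c b hac p ih =>
    rw [SimpleGraph.Walk.cons_isPath_iff] at hq
    by_cases hcb : c = b
    · subst hcb
      have hp : p = SimpleGraph.Walk.nil := (SimpleGraph.Walk.isPath_iff_nil.1 hq.1).eq_nil
      subst hp
      convert D.isArc hac using 1
      ext x
      simp only [SimpleGraph.Walk.edges_cons, SimpleGraph.Walk.edges_nil, List.mem_cons,
        List.not_mem_nil, or_false,
        SimpleGraph.Walk.support_cons, SimpleGraph.Walk.support_nil,
        Set.mem_union]
      constructor
      · rintro (⟨u, w, h, hx⟩ | ⟨u, h, h1, h2, -⟩)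
        · rcases Sym2.eq_iff.1 h with ⟨rfl, rfl⟩ | ⟨rfl, rfl⟩
          · exact hx
          · rwa [D.O_symm]
        · rcases h with h | h
          · exact (h1 h).elim
          · exact (h2 h).elim
      · intro hx
        exact Or.inl ⟨a, c, rfl, hx⟩
    · have h1 := D.isArc hac
      have h2 := ih hq.1 hcb
      have hapt : ∀ x, s(a, x) ∉ p.edges := fun x hx => hq.2 (p.fst_mem_support_of_mem_edges hx)
      have := h1.trans h2 ?_ ?_ ?_ ?_ ?_ ?_
      · convert this using 1
        ext x
        simp only [SimpleGraph.Walk.edges_cons, List.mem_cons, SimpleGraph.Walk.support_cons,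
          Set.mem_union, Set.mem_ofPred_eq, Set.mem_singleton_iff]
        constructor
        · rintro (⟨u, w, h | h, hx⟩ | ⟨u, h | h, hu1, hu2, rfl⟩)
          · rcases Sym2.eq_iff.1 h with ⟨rfl, rfl⟩ | ⟨rfl, rfl⟩
            · exact Or.inl (Or.inl hx)
            · exact Or.inl (Or.inl (D.O_symm _ _ ▸ hx))
          · exact Or.inr (Or.inl ⟨u, w, h, hx⟩)
          · exact (hu1 h).elim
          · by_cases huc : u = c
            · exact Or.inl (Or.inr (by rw [huc]))
            · exact Or.inr (Or.inr ⟨u, h, huc, hu2, rfl⟩)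
        · rintro ((hx | rfl) | ⟨u, w, h, hx⟩ | ⟨u, h, hu1, hu2, rfl⟩)
          · exact Or.inl ⟨a, c, Or.inl rfl, hx⟩
          · exact Or.inr ⟨c, Or.inr p.start_mem_support, hac.ne', hcb, rfl⟩
          · exact Or.inl ⟨u, w, Or.inr h, hx⟩
          · refine Or.inr ⟨u, Or.inr h, ?_, hu2, rfl⟩
            rintro rfl
            exact hq.2 h
      · rw [Set.disjoint_left]
        rintro x hx (⟨u, w, h, hx'⟩ | ⟨u, h, hu1, hu2, rfl⟩)
        · rw [← D.O_inj hx hx'] at h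
          exact hapt c h
        · exact D.pt_notMem_O _ _ _ hx
      · rintro (⟨u, w, h, hx'⟩ | ⟨u, h, hu1, hu2, hx⟩)
        · exact D.pt_notMem_O _ _ _ hx'
        · rw [← D.pt_inj hx] at h
          exact hq.2 h
      · exact D.pt_notMem_O _ _ _
      · exact D.pt_notMem_O _ _ _
      · rintro (⟨u, w, h, hx'⟩ | ⟨u, h, hu1, hu2, hx⟩)
        · exact D.pt_notMem_O _ _ _ hx'
        · exact hu1 (D.pt_inj hx).symm
      · exact fun h => hab (D.pt_inj h)

end StrongDrawing

/-! ### The three convex bodies used in the truncation of a vertex -/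

/-- The redundant factors `1 *` and `0 *` in `starFun` and `rectFun` put their terms in exactly this
form, so that the coefficients are found by unification. -/
theorem convexOn_affine (a b c : ℝ) :
    ConvexOn ℝ Set.univ (fun z : ℂ => a * z.re + b * z.im + c) := by
  refine ⟨convex_univ, fun x _ y _ s t _ _ hst => le_of_eq ?_⟩
  simp only [Complex.add_re, Complex.add_im, Complex.smul_re, Complex.smul_im, smul_eq_mul]
  linear_combination (-c) * hst

theorem ConvexOn.max {F G : ℂ → ℝ} (hF : ConvexOn ℝ Set.univ F) (hG : ConvexOn ℝ Set.univ G) :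
    ConvexOn ℝ Set.univ (fun z => max (F z) (G z)) :=
  hF.sup hG

theorem isBounded_of_abs_le {A : Set ℂ} (r : ℝ) (h : ∀ z ∈ A, |z.re| ≤ r ∧ |z.im| ≤ r) :
    Bornology.IsBounded A := by
  rw [isBounded_iff_forall_norm_le]
  refine ⟨r + r, fun z hz => ?_⟩
  exact (Complex.norm_le_abs_re_add_abs_im z).trans (add_le_add (h z hz).1 (h z hz).2)

/-- The sublevel set is the triangle with the corners `0`, `1` and `I`. -/
noncomputable def triangleFun (z : ℂ) : ℝ := max (max (-z.re) (-z.im)) (z.re + z.im - 1)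

theorem triangleFun_le {z : ℂ} : triangleFun z ≤ 0 ↔ 0 ≤ z.re ∧ 0 ≤ z.im ∧ z.re + z.im ≤ 1 := by
  simp only [triangleFun, max_le_iff, Left.neg_nonpos_iff, sub_nonpos, and_assoc]

theorem triangleFun_lt {z : ℂ} : triangleFun z < 0 ↔ 0 < z.re ∧ 0 < z.im ∧ z.re + z.im < 1 := by
  simp only [triangleFun, max_lt_iff, Left.neg_neg_iff, sub_neg, and_assoc]

theorem triangleFun_eq {z : ℂ} : triangleFun z = 0 ↔
    (0 ≤ z.re ∧ 0 ≤ z.im ∧ z.re + z.im ≤ 1) ∧ (z.re = 0 ∨ z.im = 0 ∨ z.re + z.im = 1) := by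
  rw [le_antisymm_iff, triangleFun_le, ← not_lt (a := triangleFun z), triangleFun_lt]
  grind

theorem continuous_triangleFun : Continuous triangleFun := by
  unfold triangleFun; fun_prop

theorem convexOn_triangleFun : ConvexOn ℝ Set.univ triangleFun := by
  have := ((convexOn_affine (-1) 0 0).max (convexOn_affine 0 (-1) 0)).max (convexOn_affine 1 1 (-1))
  convert this using 2 with z
  simp [triangleFun, sub_eq_add_neg]

theorem isBodyFun_triangleFun : IsBodyFun triangleFun where
  convexOn := convexOn_triangleFun
  continuous := continuous_triangleFun
  exists_neg := ⟨⟨1 / 3, 1 / 3⟩, by rw [triangleFun_lt]; norm_num⟩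
  bounded := isBounded_of_abs_le 1 fun z hz => by
    obtain ⟨h1, h2, h3⟩ := triangleFun_le.1 hz
    constructor <;> rw [abs_le] <;> constructor <;> linarith

/-- The sublevel set is the triangle with one corner cut off. -/
noncomputable def trapezoidFun (z : ℂ) : ℝ := max (triangleFun z) (1 / 2 - (z.re + z.im))

theorem trapezoidFun_le {z : ℂ} :
    trapezoidFun z ≤ 0 ↔ triangleFun z ≤ 0 ∧ 1 / 2 ≤ z.re + z.im := by
  simp only [trapezoidFun, max_le_iff, sub_nonpos]

theorem trapezoidFun_lt {z : ℂ} :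
    trapezoidFun z < 0 ↔ triangleFun z < 0 ∧ 1 / 2 < z.re + z.im := by
  simp only [trapezoidFun, max_lt_iff, sub_neg]

theorem isBodyFun_trapezoidFun : IsBodyFun trapezoidFun where
  convexOn := by
    convert convexOn_triangleFun.max (convexOn_affine (-1) (-1) (1 / 2)) using 2 with z
    simp only [trapezoidFun]
    congr 1
    ring
  continuous := by
    have := continuous_triangleFun
    unfold trapezoidFun
    fun_prop
  exists_neg := ⟨⟨1 / 3, 1 / 3⟩, by rw [trapezoidFun_lt, triangleFun_lt]; norm_num⟩
  bounded := isBodyFun_triangleFun.bounded.subset fun _ hz => (trapezoidFun_le.1 hz).1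

/-- The coordinates of a point with respect to the three rays through `-1 - I`, `1` and `I`, one of
the coordinates being zero. -/
noncomputable def rayCoord (z : ℂ) : Fin 3 → ℝ :=
  ![-min 0 (min z.re z.im), z.re - min 0 (min z.re z.im), z.im - min 0 (min z.re z.im)]

theorem rayCoord_nonneg (z : ℂ) (i : Fin 3) : 0 ≤ rayCoord z i := by
  fin_cases i <;> simp [rayCoord]

theorem exists_rayCoord_eq_zero (z : ℂ) : ∃ k, rayCoord z k = 0 := by
  rcases le_total 0 (min z.re z.im) with h | h
  · exact ⟨0, by simp only [rayCoord, min_eq_left h]; simp⟩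
  · rcases le_total z.re z.im with h' | h'
    · rw [min_eq_left h'] at h
      exact ⟨1, by simp only [rayCoord, min_eq_left h', min_eq_right h]; simp⟩
    · rw [min_eq_right h'] at h
      exact ⟨2, by simp only [rayCoord, min_eq_right h', min_eq_right h]; simp⟩

theorem rayCoord_injective : Function.Injective rayCoord := by
  intro z w h
  have h0 := congrFun h 0
  have h1 := congrFun h 1
  have h2 := congrFun h 2
  simp only [rayCoord, Matrix.cons_val] at h0 h1 h2
  exact Complex.ext (by linarith) (by linarith)

theorem exists_rayCoord_eq {e : Fin 3 → ℝ} (he : ∀ i, 0 ≤ e i) {k : Fin 3} (hk : e k = 0) :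
    ∃ z, rayCoord z = e := by
  refine ⟨⟨e 1 - e 0, e 2 - e 0⟩, ?_⟩
  have h0 := he 0
  have h1 := he 1
  have h2 := he 2
  have hm : min 0 (min (e 1 - e 0) (e 2 - e 0)) = - e 0 := by
    apply le_antisymm
    · fin_cases k <;> simp at hk <;> simp [hk]
    · simp [h0, h1, h2]
  funext i
  fin_cases i <;> simp [rayCoord, hm]

theorem continuous_rayCoord (i : Fin 3) : Continuous fun z => rayCoord z i := by
  fin_cases i <;> simp only [rayCoord] <;> simp <;> fun_prop

/-- The sublevel set is a triangle composed of three triangles at the origin. -/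
noncomputable def starFun (z : ℂ) : ℝ :=
  max (max (1 * z.re + 1 * z.im + -(1 / 2)) ((-2) * z.re + 1 * z.im + -(1 / 2)))
    (1 * z.re + (-2) * z.im + -(1 / 2))

/-- With `m = min 0 (min z.re z.im)`, the sum of the ray coordinates is `z.re + z.im - 3 * m`, and
`-3 * m` is the maximum of `0`, `-3 * z.re` and `-3 * z.im`. The body is thus made of three
triangles of coordinate sum at most 1/2, one in each sector between two rays. -/
theorem starFun_eq (z : ℂ) : starFun z = rayCoord z 0 + rayCoord z 1 + rayCoord z 2 - 1 / 2 := by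
  simp only [rayCoord, Matrix.cons_val, starFun]
  grind

theorem isBodyFun_starFun : IsBodyFun starFun where
  convexOn := ((convexOn_affine _ _ _).max (convexOn_affine _ _ _)).max (convexOn_affine _ _ _)
  continuous := by unfold starFun; fun_prop
  exists_neg := ⟨0, by simp [starFun]⟩
  bounded := isBounded_of_abs_le 1 fun z hz => by
    simp only [Set.mem_ofPred_eq, starFun, max_le_iff] at hz
    constructor <;> rw [abs_le] <;> constructor <;> linarith

/-! ### Triangular charts of the cells -/

namespace StrongDrawing

variable {W : Type*} {G : SimpleGraph W} {S : Type*} [TopologicalSpace S] {ι : Type*}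
  (D : StrongDrawing G S ι)

/-- A cell is parametrized by a triangle, two sides of which are given edges of the cell. -/
theorem exists_chart [T2Space S] {i : ι} {v a b : W} (ha : (D.C i).Adj v a)
    (hb : (D.C i).Adj v b) (hab : a ≠ b) {γ δ : ℝ → S}
    (hγ : IsArcParam γ (D.O v a) (D.pt v) (D.pt a))
    (hδ : IsArcParam δ (D.O v b) (D.pt v) (D.pt b)) :
    ∃ Ψ : ℂ → S, ContinuousOn Ψ {z | triangleFun z ≤ 0} ∧ Set.InjOn Ψ {z | triangleFun z ≤ 0} ∧
      Ψ '' {z | triangleFun z < 0} = D.U i ∧ Ψ '' {z | triangleFun z = 0} = D.J i ∧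
      ∀ t ∈ Set.Icc (0 : ℝ) 1, Ψ ⟨t, 0⟩ = γ t ∧ Ψ ⟨0, t⟩ = δ t := by
  -- The rest of the bounding cycle is a path from `a` to `b`. Drawn as the arc `ε`, it serves as
  -- the third side of the triangle, opposite `v`.
  obtain ⟨q, hq, hvq, hC⟩ := (D.isCycle i).exists_path_of_adj ha hb hab
  obtain ⟨ε, hε⟩ := D.isArc_of_path q hq hab
  obtain ⟨P, hP⟩ : ∃ P, P = ({x | ∃ u w, s(u, w) ∈ q.edges ∧ x ∈ D.O u w} ∪
      {x | ∃ u ∈ q.support, u ≠ a ∧ u ≠ b ∧ x = D.pt u}) := ⟨_, rfl⟩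
  rw [← hP] at hε
  have hOP : ∀ c, Disjoint (D.O v c) P := by
    intro c
    rw [Set.disjoint_left, hP]
    rintro x hx (⟨u, w, h, hx'⟩ | ⟨u, -, -, -, rfl⟩)
    · rw [← D.O_inj hx hx'] at h
      exact hvq (q.fst_mem_support_of_mem_edges h)
    · exact D.pt_notMem_O _ _ _ hx
  have hPpt : ∀ c, D.pt c ∈ P → c ∈ q.support ∧ c ≠ a ∧ c ≠ b := by
    intro c hc
    rw [hP] at hc
    rcases hc with ⟨u, w, h, hx'⟩ | ⟨u, h1, h2, h3, h⟩
    · exact (D.pt_notMem_O _ _ _ hx').elim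
    · rw [D.pt_inj h]
      exact ⟨h1, h2, h3⟩
  have hvP : D.pt v ∉ P := fun h => hvq (hPpt v h).1
  have haP : D.pt a ∉ P := fun h => (hPpt a h).2.1 rfl
  have hbP : D.pt b ∉ P := fun h => (hPpt b h).2.2 rfl
  have hav : D.pt a ≠ D.pt v := fun h => ha.ne (D.pt_inj h).symm
  have hbv : D.pt b ≠ D.pt v := fun h => hb.ne (D.pt_inj h).symm
  have hab' : D.pt a ≠ D.pt b := fun h => hab (D.pt_inj h)
  have hOO : Disjoint (D.O v a) (D.O v b) := by
    rw [Set.disjoint_left]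
    intro x hx hx'
    exact hab (Sym2.congr_right.1 (D.O_inj hx hx'))
  have cγδ : ∀ t ∈ Set.Icc (0 : ℝ) 1, ∀ s ∈ Set.Icc (0 : ℝ) 1, γ t = δ s → t = 0 ∧ s = 0 := by
    intro t ht s hs h
    obtain ⟨h1, h2⟩ := hγ.cross hδ hOO (D.pt_notMem_O _ _ _) (D.pt_notMem_O _ _ _)
      (D.pt_notMem_O _ _ _) (D.pt_notMem_O _ _ _) ht hs h
    obtain ⟨-, -, h3, h4, -⟩ := hγ
    obtain ⟨-, -, h5, h6, -⟩ := hδ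
    rcases h1 with rfl | rfl <;> rcases h2 with rfl | rfl
    · exact ⟨rfl, rfl⟩
    · exact (hbv (by rw [← h6, ← h, h3])).elim
    · exact (hav (by rw [← h4, h, h5])).elim
    · exact (hab' (by rw [← h4, h, h6])).elim
  have cγε : ∀ t ∈ Set.Icc (0 : ℝ) 1, ∀ s ∈ Set.Icc (0 : ℝ) 1, γ t = ε s → t = 1 ∧ s = 0 := by
    intro t ht s hs h
    obtain ⟨h1, h2⟩ := hγ.cross hε (hOP a) hvP haP
      (D.pt_notMem_O _ _ _) (D.pt_notMem_O _ _ _) ht hs h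
    obtain ⟨-, -, h3, h4, -⟩ := hγ
    obtain ⟨-, -, h5, h6, -⟩ := hε
    rcases h1 with rfl | rfl <;> rcases h2 with rfl | rfl
    · exact (hav (by rw [← h5, ← h, h3])).elim
    · exact (hbv (by rw [← h6, ← h, h3])).elim
    · exact ⟨rfl, rfl⟩
    · exact (hab' (by rw [← h4, h, h6])).elim
  have cδε : ∀ t ∈ Set.Icc (0 : ℝ) 1, ∀ s ∈ Set.Icc (0 : ℝ) 1, δ t = ε s → t = 1 ∧ s = 1 := by
    intro t ht s hs h
    obtain ⟨h1, h2⟩ := hδ.cross hε (hOP b) hvP hbP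
      (D.pt_notMem_O _ _ _) (D.pt_notMem_O _ _ _) ht hs h
    obtain ⟨-, -, h3, h4, -⟩ := hδ
    obtain ⟨-, -, h5, h6, -⟩ := hε
    rcases h1 with rfl | rfl <;> rcases h2 with rfl | rfl
    · exact (hav (by rw [← h5, ← h, h3])).elim
    · exact (hbv (by rw [← h6, ← h, h3])).elim
    · exact (hab' (by rw [← h5, ← h, h4])).elim
    · exact ⟨rfl, rfl⟩
  obtain ⟨γc, γi, γ0, γ1, γO⟩ := hγ
  obtain ⟨δc, δi, δ0, δ1, δO⟩ := hδ
  obtain ⟨εc, εi, ε0, ε1, εP⟩ := hε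
  -- The boundary map follows `γ` on the real side, `δ` on the imaginary side and `ε` on the
  -- hypotenuse, whose points are written `⟨1 - t, t⟩`; hence the parameter `z.im` of `ε`.
  let h : ℂ → S := fun z => if z.im = 0 then γ z.re else if z.re = 0 then δ z.im else ε z.im
  have h1 : ∀ t, h ⟨t, 0⟩ = γ t := fun t => if_pos rfl
  have h2 : ∀ t, h ⟨0, t⟩ = δ t := by
    intro t
    by_cases ht : t = 0
    · subst ht
      rw [h1, γ0, δ0]
    · simp [h, ht]
  have h3 : ∀ t, h ⟨1 - t, t⟩ = ε t := by
    intro t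
    by_cases ht : t = 0
    · subst ht
      rw [sub_zero, h1, γ1, ε0]
    · by_cases ht' : 1 - t = 0
      · obtain rfl : t = 1 := by linarith
        rw [sub_self, h2, δ1, ε1]
      · simp [h, ht, ht']
  have cases : ∀ z, triangleFun z = 0 ↔ (∃ t ∈ Set.Icc (0 : ℝ) 1, z = ⟨t, 0⟩) ∨
      (∃ t ∈ Set.Icc (0 : ℝ) 1, z = ⟨0, t⟩) ∨ (∃ t ∈ Set.Icc (0 : ℝ) 1, z = ⟨1 - t, t⟩) := by
    intro z
    rw [triangleFun_eq]
    constructor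
    · rintro ⟨⟨h1, h2, h3⟩, h | h | h⟩
      · exact Or.inr (Or.inl ⟨z.im, ⟨h2, by linarith⟩, Complex.ext h rfl⟩)
      · exact Or.inl ⟨z.re, ⟨h1, by linarith⟩, Complex.ext rfl h⟩
      · exact Or.inr (Or.inr ⟨z.im, ⟨h2, by linarith⟩, Complex.ext (by simp; linarith) rfl⟩)
    · rintro (⟨t, ht, rfl⟩ | ⟨t, ht, rfl⟩ | ⟨t, ht, rfl⟩) <;> obtain ⟨ht0, ht1⟩ := ht <;> simp <;>
        simp [ht0, ht1]
  have hc : ContinuousOn h {z | triangleFun z = 0} := by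
    have c1 : ContinuousOn h {z | z.im = 0 ∧ z.re ∈ Set.Icc 0 1} := by
      refine ContinuousOn.congr (γc.comp Complex.continuous_re.continuousOn fun z hz => hz.2) ?_
      intro z hz
      exact if_pos hz.1
    have c2 : ContinuousOn h {z | z.re = 0 ∧ z.im ∈ Set.Icc 0 1} := by
      refine ContinuousOn.congr (δc.comp Complex.continuous_im.continuousOn fun z hz => hz.2) ?_
      intro z hz
      rw [show z = ⟨0, z.im⟩ from Complex.ext hz.1 rfl]
      exact h2 _
    have c3 : ContinuousOn h {z | z.re = 1 - z.im ∧ z.im ∈ Set.Icc 0 1} := by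
      refine ContinuousOn.congr (εc.comp Complex.continuous_im.continuousOn fun z hz => hz.2) ?_
      intro z hz
      rw [show z = ⟨1 - z.im, z.im⟩ from Complex.ext hz.1 rfl]
      exact h3 _
    have k1 : IsClosed {z : ℂ | z.im = 0 ∧ z.re ∈ Set.Icc (0 : ℝ) 1} :=
      (isClosed_eq Complex.continuous_im continuous_const).inter
        (isClosed_Icc.preimage Complex.continuous_re)
    have k2 : IsClosed {z : ℂ | z.re = 0 ∧ z.im ∈ Set.Icc (0 : ℝ) 1} :=
      (isClosed_eq Complex.continuous_re continuous_const).inter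
        (isClosed_Icc.preimage Complex.continuous_im)
    have k3 : IsClosed {z : ℂ | z.re = 1 - z.im ∧ z.im ∈ Set.Icc (0 : ℝ) 1} :=
      (isClosed_eq Complex.continuous_re (by fun_prop)).inter
        (isClosed_Icc.preimage Complex.continuous_im)
    refine ((c1.union_of_isClosed c2 k1 k2).union_of_isClosed c3 (k1.union k2) k3).mono ?_
    intro z hz
    rcases (cases z).1 hz with ⟨t, ht, rfl⟩ | ⟨t, ht, rfl⟩ | ⟨t, ht, rfl⟩
    · exact Or.inl (Or.inl ⟨rfl, ht⟩)
    · exact Or.inl (Or.inr ⟨rfl, ht⟩)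
    · exact Or.inr ⟨rfl, ht⟩
  have hi : Set.InjOn h {z | triangleFun z = 0} := by
    intro z hz w hw e
    rcases (cases z).1 hz with ⟨t, ht, rfl⟩ | ⟨t, ht, rfl⟩ | ⟨t, ht, rfl⟩ <;>
      rcases (cases w).1 hw with ⟨s, hs, rfl⟩ | ⟨s, hs, rfl⟩ | ⟨s, hs, rfl⟩ <;>
      simp only [h1, h2, h3] at e
    · rw [γi ht hs e]
    · obtain ⟨rfl, rfl⟩ := cγδ t ht s hs e
      rfl
    · obtain ⟨rfl, rfl⟩ := cγε t ht s hs e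
      simp
    · obtain ⟨rfl, rfl⟩ := cγδ s hs t ht e.symm
      rfl
    · rw [δi ht hs e]
    · obtain ⟨rfl, rfl⟩ := cδε t ht s hs e
      simp
    · obtain ⟨rfl, rfl⟩ := cγε s hs t ht e.symm
      simp
    · obtain ⟨rfl, rfl⟩ := cδε s hs t ht e.symm
      simp
    · rw [εi ht hs e]
  have hJ : h '' {z | triangleFun z = 0} = D.J i := by
    have param : ∀ {f : ℝ → S} {x y : S} {A : Set S}, f 0 = x → f 1 = y → f '' Set.Ioo 0 1 = A →
        ∀ p, (∃ t ∈ Set.Icc (0 : ℝ) 1, f t = p) ↔ p = x ∨ p = y ∨ p ∈ A := by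
      rintro f _ _ _ rfl rfl rfl p
      constructor
      · rintro ⟨t, ht, rfl⟩
        rcases ht.1.eq_or_lt with rfl | h1
        · exact Or.inl rfl
        · rcases ht.2.eq_or_lt with rfl | h2
          · exact Or.inr (Or.inl rfl)
          · exact Or.inr (Or.inr ⟨t, ⟨h1, h2⟩, rfl⟩)
      · rintro (rfl | rfl | ⟨t, ht, rfl⟩)
        · exact ⟨0, by simp, rfl⟩
        · exact ⟨1, by simp, rfl⟩
        · exact ⟨t, ⟨ht.1.le, ht.2.le⟩, rfl⟩
    have step : ∀ p, p ∈ h '' {z | triangleFun z = 0} ↔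
        (p = D.pt v ∨ p = D.pt a ∨ p ∈ D.O v a) ∨ (p = D.pt v ∨ p = D.pt b ∨ p ∈ D.O v b) ∨
          (p = D.pt a ∨ p = D.pt b ∨ p ∈ P) := by
      intro p
      rw [← param γ0 γ1 γO, ← param δ0 δ1 δO, ← param ε0 ε1 εP]
      constructor
      · rintro ⟨z, hz, rfl⟩
        rcases (cases z).1 hz with ⟨t, ht, rfl⟩ | ⟨t, ht, rfl⟩ | ⟨t, ht, rfl⟩
        · exact Or.inl ⟨t, ht, (h1 t).symm⟩
        · exact Or.inr (Or.inl ⟨t, ht, (h2 t).symm⟩)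
        · exact Or.inr (Or.inr ⟨t, ht, (h3 t).symm⟩)
      · rintro (⟨t, ht, rfl⟩ | ⟨t, ht, rfl⟩ | ⟨t, ht, rfl⟩)
        · exact ⟨_, (cases _).2 (Or.inl ⟨t, ht, rfl⟩), h1 t⟩
        · exact ⟨_, (cases _).2 (Or.inr (Or.inl ⟨t, ht, rfl⟩)), h2 t⟩
        · exact ⟨_, (cases _).2 (Or.inr (Or.inr ⟨t, ht, rfl⟩)), h3 t⟩
    ext p
    rw [step]
    have hqe : ∀ u w, s(u, w) ∈ q.edges → (D.C i).Adj u w := fun u w h => (hC u w).2 (Or.inl h)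
    constructor
    · have mv : D.pt v ∈ D.J i := ⟨v, a, ha, Or.inl rfl⟩
      have ma : D.pt a ∈ D.J i := ⟨a, v, ha.symm, Or.inl rfl⟩
      have mb : D.pt b ∈ D.J i := ⟨b, v, hb.symm, Or.inl rfl⟩
      rintro ((rfl | rfl | h) | (rfl | rfl | h) | (rfl | rfl | h))
      · exact mv
      · exact ma
      · exact ⟨v, a, ha, Or.inr h⟩
      · exact mv
      · exact mb
      · exact ⟨v, b, hb, Or.inr h⟩
      · exact ma
      · exact mb
      · rw [hP] at h
        rcases h with ⟨u, w, h, hx⟩ | ⟨u, hu, -, -, rfl⟩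
        · exact ⟨u, w, hqe u w h, Or.inr hx⟩
        · rw [SimpleGraph.Walk.mem_support_iff_exists_mem_edges_of_not_nil
            (fun hn => hab hn.eq)] at hu
          obtain ⟨e, he, hue⟩ := hu
          obtain ⟨w, rfl⟩ := hue
          exact ⟨u, w, hqe u w he, Or.inl rfl⟩
    · have hpt : ∀ u ∈ q.support, p = D.pt u → p = D.pt a ∨ p = D.pt b ∨ p ∈ P := by
        rintro u hu rfl
        by_cases h1 : u = a
        · exact Or.inl (by rw [h1])
        · by_cases h2 : u = b
          · exact Or.inr (Or.inl (by rw [h2]))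
          · rw [hP]
            exact Or.inr (Or.inr (Or.inr ⟨u, hu, h1, h2, rfl⟩))
      rintro ⟨u, w, huw, hp⟩
      rcases (hC u w).1 huw with h | h | h
      · rcases hp with hp | hp
        · exact Or.inr (Or.inr (hpt u (q.fst_mem_support_of_mem_edges h) hp))
        · rw [hP]
          exact Or.inr (Or.inr (Or.inr (Or.inr (Or.inl ⟨u, w, h, hp⟩))))
      · rcases Sym2.eq_iff.1 h with ⟨rfl, rfl⟩ | ⟨rfl, rfl⟩
        · tauto
        · rw [D.O_symm] at hp
          tauto
      · rcases Sym2.eq_iff.1 h with ⟨rfl, rfl⟩ | ⟨rfl, rfl⟩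
        · tauto
        · rw [D.O_symm] at hp
          tauto
  obtain ⟨Ψ, Ψc, Ψi, Ψe, ΨU⟩ := (D.isDisc i).exists_extension isBodyFun_triangleFun hc hi hJ
  refine ⟨Ψ, Ψc, Ψi, ΨU, by rw [Ψe.image_eq, hJ], fun t ht => ⟨?_, ?_⟩⟩
  · rw [Ψe ((cases _).2 (Or.inl ⟨t, ht, rfl⟩)), h1]
  · rw [Ψe ((cases _).2 (Or.inr (Or.inl ⟨t, ht, rfl⟩))), h2]

end StrongDrawing

theorem fin3_cases (k j : Fin 3) : j = k ∨ j = k + 1 ∨ j = k + 2 := by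
  revert k j; decide

theorem fin3_add (k : Fin 3) : k + 1 + 1 = k + 2 ∧ k + 1 + 2 = k ∧ k + 2 + 1 = k ∧
    k + 2 + 2 = k + 1 ∧ k + 1 ≠ k ∧ k + 2 ≠ k ∧ k + 1 ≠ k + 2 := by
  revert k; decide

/-! ### A disc around a cubic vertex -/

namespace StrongDrawing

variable {W : Type*} {G : SimpleGraph W} {S : Type*} [TopologicalSpace S] {ι : Type*}
  (D : StrongDrawing G S ι)

/-- An open disc `N` around the vertex `v`, whose boundary circle `M` cuts the edges from `v` to
its neighbours `n k` in the points `m k` and the cells `f k` at `v` in arcs. -/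
structure VertexDisc (v : W) (n : Fin 3 → W) (f : Fin 3 → ι) where
  N : Set S
  M : Set S
  m : Fin 3 → S
  disjoint : ∀ {x}, x ∈ N → x ∉ M
  pt_mem : D.pt v ∈ N
  eq_of_pt_mem : ∀ {u}, D.pt u ∈ N ∪ M → u = v
  eq_of_O_mem : ∀ {x u w}, x ∈ D.O u w → x ∈ N ∪ M → u = v ∨ w = v
  m_mem_O : ∀ k, m k ∈ D.O v (n k)
  m_mem_M : ∀ k, m k ∈ M
  eq_m : ∀ {x k}, x ∈ D.O v (n k) → x ∈ M → x = m k
  eq_of_U_mem : ∀ {x i}, x ∈ D.U i → x ∈ N ∪ M → ∃ k, i = f k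
  M_cases : ∀ {x}, x ∈ M → (∃ k, x = m k) ∨ ∃ k, x ∈ D.U (f k)
  isArc_O : ∀ k, IsArc (D.O v (n k) \ (N ∪ M)) (m k) (D.pt (n k))
  isArc_U : ∀ k, IsArc (M ∩ D.U (f k)) (m (k + 1)) (m (k + 2))
  isDisc_N : IsClosedDisc N M
  isDisc_U : ∀ k, IsClosedDisc (D.U (f k) \ (N ∪ M)) ((D.J (f k) \ N) ∪ (M ∩ D.U (f k)))

/-- The cell `f k` lies between the edges to `n (k + 1)` and `n (k + 2)`, opposite `n k`. Its
triangular chart has the corner `v` at the origin, and neighbouring charts agree on their common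
edge. Hence the sum of the two chart coordinates is well defined near `v`: it is less than 1/2 on
`N` and equal to 1/2 on `M`. The three cut-off corners fit together as the sectors of `starFun`;
what remains of each cell is the trapezoid. -/
theorem exists_vertexDisc [T2Space S] {v : W} {n : Fin 3 → W} (hn : Function.Injective n)
    {f : Fin 3 → ι} (hf1 : ∀ k, (D.C (f k)).Adj v (n (k + 1)))
    (hf2 : ∀ k, (D.C (f k)).Adj v (n (k + 2))) : Nonempty (D.VertexDisc v n f) := by
  have hvn : ∀ k, G.Adj v (n k) := by
    intro k
    have := (D.isCycle _).le (hf2 (k + 1))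
    rwa [(fin3_add k).2.1] at this
  -- A cycle has only two edges at `v`, and on `f k` these go to `n (k + 1)` and `n (k + 2)`.
  have hf0 : ∀ k, ¬ (D.C (f k)).Adj v (n k) := by
    intro k h
    obtain ⟨-, -, -, -, h5, h6, h7⟩ := fin3_add k
    rcases (D.isCycle _).eq_or_eq (hf1 k) (hf2 k) (hn.ne h7) h with e | e
    · exact h5 (hn e).symm
    · exact h6 (hn e).symm
  have hfi : ∀ {k j}, f k = f j → k = j := by
    intro k j e
    obtain ⟨h1, h2, h3, h4, h5, h6, h7⟩ := fin3_add k
    rcases fin3_cases k j with rfl | rfl | rfl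
    · rfl
    · have := hf2 (k + 1)
      rw [h2, ← e] at this
      exact (hf0 _ this).elim
    · have := hf1 (k + 2)
      rw [h3, ← e] at this
      exact (hf0 _ this).elim
  -- One parametrization is fixed per edge, before the charts are chosen: both charts along an edge
  -- use the same `γ`.
  choose γ hγ using fun k => D.isArc (hvn k)
  choose Ψ Ψc Ψi ΨU ΨJ Ψγ using fun k => D.exists_chart (hf1 k) (hf2 k)
    (hn.ne (fin3_add k).2.2.2.2.2.2) (hγ (k + 1)) (hγ (k + 2))
  have γO : ∀ k t, 0 < t → t < 1 → γ k t ∈ D.O v (n k) := by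
    intro k t h0 h1
    obtain ⟨-, -, -, -, h⟩ := hγ k
    exact h ▸ ⟨t, ⟨h0, h1⟩, rfl⟩
  have γ0 : ∀ k, γ k 0 = D.pt v := fun k => (hγ k).2.2.1
  have Ψre : ∀ k t, 0 ≤ t → t ≤ 1 → Ψ k ⟨t, 0⟩ = γ (k + 1) t := fun k t h0 h1 =>
    (Ψγ k t ⟨h0, h1⟩).1
  have Ψim : ∀ k t, 0 ≤ t → t ≤ 1 → Ψ k ⟨0, t⟩ = γ (k + 2) t := fun k t h0 h1 =>
    (Ψγ k t ⟨h0, h1⟩).2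
  have ΨmU : ∀ k a b, 0 < a → 0 < b → a + b < 1 → Ψ k ⟨a, b⟩ ∈ D.U (f k) := by
    intro k a b ha hb hab
    rw [← ΨU k]
    exact ⟨_, triangleFun_lt.2 ⟨ha, hb, hab⟩, rfl⟩
  have Ψcl : ∀ k a b, 0 ≤ a → 0 ≤ b → a + b ≤ 1 →
      Ψ k ⟨a, b⟩ ∈ D.U (f k) ∨ Ψ k ⟨a, b⟩ ∈ D.J (f k) := by
    intro k a b ha hb hab
    have := triangleFun_le (z := ⟨a, b⟩).2 ⟨ha, hb, hab⟩
    rcases this.lt_or_eq with h | h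
    · exact Or.inl (ΨU k ▸ ⟨_, h, rfl⟩)
    · exact Or.inr (ΨJ k ▸ ⟨_, h, rfl⟩)
  have Ψinj : ∀ k a b c d, 0 ≤ a → 0 ≤ b → a + b ≤ 1 → 0 ≤ c → 0 ≤ d → c + d ≤ 1 →
      Ψ k ⟨a, b⟩ = Ψ k ⟨c, d⟩ → a = c ∧ b = d := by
    intro k a b c d ha hb hab hc hd hcd e
    have := Ψi k (triangleFun_le (z := ⟨a, b⟩).2 ⟨ha, hb, hab⟩)
      (triangleFun_le (z := ⟨c, d⟩).2 ⟨hc, hd, hcd⟩) e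
    exact ⟨congrArg Complex.re this, congrArg Complex.im this⟩
  -- a point of the charts at `f k` and `f j` has the same coordinates in both
  have key : ∀ k j a b c d, 0 ≤ a → 0 ≤ b → a + b ≤ 1 → 0 ≤ c → 0 ≤ d → c + d < 1 →
      Ψ k ⟨a, b⟩ = Ψ j ⟨c, d⟩ → (j = k ∧ a = c ∧ b = d) ∨ (j = k + 1 ∧ a = 0 ∧ d = 0 ∧ b = c) ∨
        (j = k + 2 ∧ b = 0 ∧ c = 0 ∧ a = d) := by
    intro k j a b c d ha hb hab hc hd hcd e
    obtain ⟨h1, h2, h3, h4, h5, h6, h7⟩ := fin3_add k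
    -- The condition `c + d < 1` keeps the second point off the side opposite `v`, where closed
    -- cells may touch in other ways. Then `noU` excludes the interior of another cell, and `noO`
    -- the edge to `n k`, which does not bound `f k`; the common edge remains.
    have noU : j ≠ k → ¬ (0 < c ∧ 0 < d) := by
      rintro hjk ⟨hc, hd⟩
      have hU := ΨmU j c d hc hd hcd
      rcases Ψcl k a b ha hb hab with h | h
      · rw [e] at h
        exact hjk (hfi (D.U_inj hU h))
      · rw [e] at h
        exact D.notMem_J hU _ h
    have noO : ∀ t, 0 ≤ t → t < 1 → Ψ k ⟨a, b⟩ = γ k t → t = 0 := by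
      intro t ht0 ht1 e
      by_contra hne
      have hO := γO k t (lt_of_le_of_ne ht0 (Ne.symm hne)) ht1
      rcases Ψcl k a b ha hb hab with h | h
      · rw [e] at h
        exact D.O_notMem_U _ hO h
      · rw [e] at h
        exact hf0 k (D.adj_of_mem_J hO h)
    rcases fin3_cases k j with rfl | rfl | rfl
    · exact Or.inl ⟨rfl, Ψinj _ a b c d ha hb hab hc hd hcd.le e⟩
    · refine Or.inr (Or.inl ⟨rfl, ?_⟩)
      have hd0 : d = 0 := by
        rcases hd.eq_or_lt with h | h
        · exact h.symm
        · have hc0 : c = 0 := by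
            by_contra hne
            exact noU h5 ⟨lt_of_le_of_ne hc (Ne.symm hne), h⟩
          subst hc0
          rw [Ψim _ d hd (by linarith), h2] at e
          exact noO d hd (by linarith) e
      subst hd0
      rw [Ψre _ c hc (by linarith), h1, ← Ψim k c hc (by linarith)] at e
      obtain ⟨h8, h9⟩ := Ψinj k a b 0 c ha hb hab le_rfl hc (by linarith) e
      exact ⟨h8, rfl, h9⟩
    · refine Or.inr (Or.inr ⟨rfl, ?_⟩)
      have hc0 : c = 0 := by
        rcases hc.eq_or_lt with h | h
        · exact h.symm
        · have hd0 : d = 0 := by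
            by_contra hne
            exact noU h6 ⟨h, lt_of_le_of_ne hd (Ne.symm hne)⟩
          subst hd0
          rw [Ψre _ c hc (by linarith), h3] at e
          exact noO c hc (by linarith) e
      subst hc0
      rw [Ψim _ d hd (by linarith), h4, ← Ψre k d hd (by linarith)] at e
      obtain ⟨h8, h9⟩ := Ψinj k a b d 0 ha hb hab hd le_rfl (by linarith) e
      exact ⟨h9, rfl, h8⟩
  have keySum : ∀ k j a b c d, 0 ≤ a → 0 ≤ b → a + b ≤ 1 → 0 ≤ c → 0 ≤ d → c + d < 1 →
      Ψ k ⟨a, b⟩ = Ψ j ⟨c, d⟩ → a + b = c + d := by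
    intro k j a b c d ha hb hab hc hd hcd e
    rcases key k j a b c d ha hb hab hc hd hcd e with
      ⟨-, rfl, rfl⟩ | ⟨-, rfl, rfl, rfl⟩ | ⟨-, rfl, rfl, rfl⟩
    · rfl
    · simp
    · simp
  obtain ⟨N, hN⟩ : ∃ N : Set S, ∀ x, x ∈ N ↔
      ∃ k a b, 0 ≤ a ∧ 0 ≤ b ∧ a + b < 1 / 2 ∧ x = Ψ k ⟨a, b⟩ := ⟨{x | _}, fun x => Iff.rfl⟩
  obtain ⟨M, hM⟩ : ∃ M : Set S, ∀ x, x ∈ M ↔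
      ∃ k a b, 0 ≤ a ∧ 0 ≤ b ∧ a + b = 1 / 2 ∧ x = Ψ k ⟨a, b⟩ := ⟨{x | _}, fun x => Iff.rfl⟩
  have hNM : ∀ x, x ∈ N ∪ M ↔
      ∃ k a b, 0 ≤ a ∧ 0 ≤ b ∧ a + b ≤ 1 / 2 ∧ x = Ψ k ⟨a, b⟩ := by
    intro x
    rw [Set.mem_union, hN, hM]
    constructor
    · rintro (⟨k, a, b, ha, hb, hab, rfl⟩ | ⟨k, a, b, ha, hb, hab, rfl⟩)
      · exact ⟨k, a, b, ha, hb, hab.le, rfl⟩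
      · exact ⟨k, a, b, ha, hb, hab.le, rfl⟩
    · rintro ⟨k, a, b, ha, hb, hab, rfl⟩
      rcases hab.lt_or_eq with h | h
      · exact Or.inl ⟨k, a, b, ha, hb, h, rfl⟩
      · exact Or.inr ⟨k, a, b, ha, hb, h, rfl⟩
  -- membership of a chart point in `N` and `M`
  have ΨN : ∀ k a b, 0 ≤ a → 0 ≤ b → a + b ≤ 1 → (Ψ k ⟨a, b⟩ ∈ N ↔ a + b < 1 / 2) := by
    intro k a b ha hb hab
    rw [hN]
    constructor
    · rintro ⟨j, c, d, hc, hd, hcd, e⟩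
      rw [keySum k j a b c d ha hb hab hc hd (by linarith) e]
      exact hcd
    · intro h
      exact ⟨k, a, b, ha, hb, h, rfl⟩
  have ΨM : ∀ k a b, 0 ≤ a → 0 ≤ b → a + b ≤ 1 → (Ψ k ⟨a, b⟩ ∈ M ↔ a + b = 1 / 2) := by
    intro k a b ha hb hab
    rw [hM]
    constructor
    · rintro ⟨j, c, d, hc, hd, hcd, e⟩
      rw [keySum k j a b c d ha hb hab hc hd (by linarith) e]
      exact hcd
    · intro h
      exact ⟨k, a, b, ha, hb, h, rfl⟩
  have γN : ∀ k t, 0 ≤ t → t ≤ 1 → (γ k t ∈ N ↔ t < 1 / 2) := by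
    intro k t h0 h1
    -- The edge to `n k` is the imaginary side of the chart with index `k + 1`, since `k + 1 + 2 =
    -- k`.
    have := ΨN (k + 1) 0 t le_rfl h0 (by linarith)
    rwa [Ψim _ t h0 h1, (fin3_add k).2.1, zero_add] at this
  have γM : ∀ k t, 0 ≤ t → t ≤ 1 → (γ k t ∈ M ↔ t = 1 / 2) := by
    intro k t h0 h1
    have := ΨM (k + 1) 0 t le_rfl h0 (by linarith)
    rwa [Ψim _ t h0 h1, (fin3_add k).2.1, zero_add] at this
  -- the location of a chart point
  have loc : ∀ k a b, 0 ≤ a → 0 ≤ b → a + b < 1 → Ψ k ⟨a, b⟩ = D.pt v ∨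
      (∃ j t, 0 < t ∧ t < 1 ∧ t = a + b ∧ Ψ k ⟨a, b⟩ = γ j t) ∨
        (0 < a ∧ 0 < b ∧ Ψ k ⟨a, b⟩ ∈ D.U (f k)) := by
    intro k a b ha hb hab
    rcases ha.eq_or_lt with rfl | ha'
    · rcases hb.eq_or_lt with rfl | hb'
      · left
        rw [Ψre k 0 le_rfl (by norm_num), γ0]
      · exact Or.inr (Or.inl ⟨k + 2, b, hb', by linarith, by ring, Ψim k b hb (by linarith)⟩)
    · rcases hb.eq_or_lt with rfl | hb'
      · exact Or.inr (Or.inl ⟨k + 1, a, ha', by linarith, by ring, Ψre k a ha (by linarith)⟩)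
      · exact Or.inr (Or.inr ⟨ha', hb', ΨmU k a b ha' hb' hab⟩)
  have UM : ∀ k x, x ∈ D.U (f k) → x ∈ N ∪ M →
      ∃ a b, 0 < a ∧ 0 < b ∧ a + b ≤ 1 / 2 ∧ x = Ψ k ⟨a, b⟩ := by
    intro k x hx hxN
    obtain ⟨j, a, b, ha, hb, hab, rfl⟩ := (hNM x).1 hxN
    rcases loc j a b ha hb (by linarith) with h | ⟨i, t, h0, h1, -, h⟩ | ⟨h0, h1, h⟩
    · exact (D.pt_notMem_U _ _ (h ▸ hx)).elim
    · exact (D.O_notMem_U _ (γO i t h0 h1) (h ▸ hx)).elim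
    · obtain rfl := hfi (D.U_inj h hx)
      exact ⟨a, b, h0, h1, hab, rfl⟩
  refine ⟨⟨N, M, fun k => γ k (1 / 2), ?_, ?_, ?_, ?_, ?_, ?_, ?_, ?_, ?_, ?_, ?_, ?_, ?_⟩⟩
  · intro x hx hx'
    obtain ⟨k, a, b, ha, hb, hab, rfl⟩ := (hN x).1 hx
    rw [ΨM k a b ha hb (by linarith)] at hx'
    linarith
  · rw [← γ0 0, γN 0 0 le_rfl (by norm_num)]
    norm_num
  · intro u hu
    obtain ⟨k, a, b, ha, hb, hab, e⟩ := (hNM _).1 hu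
    rcases loc k a b ha hb (by linarith) with h | ⟨i, t, h0, h1, -, h⟩ | ⟨-, -, h⟩
    · exact D.pt_inj (e.trans h)
    · have := γO i t h0 h1
      rw [← h, ← e] at this
      exact (D.pt_notMem_O _ _ _ this).elim
    · rw [← e] at h
      exact (D.pt_notMem_U _ _ h).elim
  · intro x u w hx hxN
    obtain ⟨k, a, b, ha, hb, hab, rfl⟩ := (hNM _).1 hxN
    rcases loc k a b ha hb (by linarith) with h | ⟨i, t, h0, h1, -, h⟩ | ⟨-, -, h⟩
    · rw [h] at hx
      exact (D.pt_notMem_O _ _ _ hx).elim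
    · have := γO i t h0 h1
      rw [← h] at this
      rcases Sym2.eq_iff.1 (D.O_inj hx this) with ⟨h, -⟩ | ⟨-, h⟩
      · exact Or.inl h
      · exact Or.inr h
    · exact (D.O_notMem_U _ hx h).elim
  · exact fun k => γO k _ (by norm_num) (by norm_num)
  · exact fun k => (γM k _ (by norm_num) (by norm_num)).2 rfl
  · intro x k hx hxM
    obtain ⟨-, -, -, -, h⟩ := hγ k
    obtain ⟨t, ht, rfl⟩ : x ∈ γ k '' Set.Ioo 0 1 := h ▸ hx
    rw [(γM k t ht.1.le ht.2.le).1 hxM]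
  · intro x i hx hxN
    obtain ⟨k, a, b, ha, hb, hab, rfl⟩ := (hNM _).1 hxN
    rcases loc k a b ha hb (by linarith) with h | ⟨i, t, h0, h1, -, h⟩ | ⟨-, -, h⟩
    · rw [h] at hx
      exact (D.pt_notMem_U _ _ hx).elim
    · rw [h] at hx
      exact (D.O_notMem_U _ (γO i t h0 h1) hx).elim
    · exact ⟨k, D.U_inj hx h⟩
  · intro x hx
    obtain ⟨k, a, b, ha, hb, hab, rfl⟩ := (hM _).1 hx
    rcases loc k a b ha hb (by linarith) with h | ⟨i, t, h0, h1, ht, h⟩ | ⟨-, -, h⟩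
    · rw [h, ← γ0 0, γM 0 0 le_rfl (by norm_num)] at hx
      norm_num at hx
    · exact Or.inl ⟨i, by rw [h, ht, hab]⟩
    · exact Or.inr ⟨k, h⟩
  · intro k
    obtain ⟨h1, h2, h3, h4, h5⟩ := hγ k
    have hsub : Set.Icc (1 / 2 : ℝ) 1 ⊆ Set.Icc 0 1 := Set.Icc_subset_Icc (by norm_num) le_rfl
    have := isArc_of_Icc (by norm_num) (h1.mono hsub) (h2.mono hsub)
    rw [h4] at this
    convert this using 1
    ext x
    constructor
    · rintro ⟨hx, hxN⟩
      obtain ⟨t, ht, rfl⟩ : x ∈ γ k '' Set.Ioo 0 1 := h5 ▸ hx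
      rw [Set.mem_union, γN k t ht.1.le ht.2.le, γM k t ht.1.le ht.2.le, ← le_iff_lt_or_eq,
        not_le] at hxN
      exact ⟨t, ⟨hxN, ht.2⟩, rfl⟩
    · rintro ⟨t, ht, rfl⟩
      have ht0 : 0 < t := by linarith [ht.1]
      refine ⟨γO k t ht0 ht.2, ?_⟩
      rw [Set.mem_union, γN k t ht0.le ht.2.le, γM k t ht0.le ht.2.le, ← le_iff_lt_or_eq, not_le]
      exact ht.1
  · intro k
    -- Within the cell, `M` is the segment `a + b = 1/2`, running from the real side (the edge to `n
    -- (k + 1)`) to the imaginary side (the edge to `n (k + 2)`).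
    have hm : Set.MapsTo (fun t : ℝ => (⟨1 / 2 - t, t⟩ : ℂ)) (Set.Icc 0 (1 / 2))
        {z | triangleFun z ≤ 0} := by
      intro t ht
      exact triangleFun_le.2 ⟨by linarith [ht.2], ht.1, by norm_num⟩
    have hcont : Continuous fun t : ℝ => (⟨1 / 2 - t, t⟩ : ℂ) := by
      have : (fun t : ℝ => (⟨1 / 2 - t, t⟩ : ℂ)) =
          fun t : ℝ => ((1 / 2 - t : ℝ) : ℂ) + (t : ℂ) * Complex.I := by
        funext t
        exact Complex.mk_eq_add_mul_I _ _
      rw [this]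
      fun_prop
    have := isArc_of_Icc (γ := fun t => Ψ k ⟨1 / 2 - t, t⟩) (by norm_num)
      ((Ψc k).comp hcont.continuousOn hm) ((Ψi k).comp (fun t _ s _ e => congrArg Complex.im e) hm)
    rw [sub_zero, sub_self, Ψre k _ (by norm_num) (by norm_num),
      Ψim k _ (by norm_num) (by norm_num)] at this
    convert this using 1
    ext x
    constructor
    · rintro ⟨hxM, hxU⟩
      obtain ⟨a, b, ha, hb, hab, rfl⟩ := UM k x hxU (Or.inr hxM)
      rw [ΨM k a b ha.le hb.le (by linarith)] at hxM
      exact ⟨b, ⟨hb, by linarith⟩, by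
        change Ψ k ⟨1 / 2 - b, b⟩ = _
        rw [← hxM, add_sub_cancel_right]⟩
    · rintro ⟨t, ht, rfl⟩
      have h1 := ht.1
      have h2 := ht.2
      exact ⟨(ΨM k _ _ (by linarith) h1.le (by linarith)).2 (by ring),
        ΨmU k _ _ (by linarith) h1 (by linarith)⟩
  -- A point of the star whose `k`-th ray coordinate vanishes is sent by the chart `Ψ k` to the
  -- point with the other two coordinates. If two coordinates vanish, the point lies on a ray, and
  -- both charts give the same point of an edge at `v`.
  · have compat : ∀ z k j, rayCoord z 0 + rayCoord z 1 + rayCoord z 2 ≤ 1 → rayCoord z k = 0 →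
        rayCoord z j = 0 → Ψ k ⟨rayCoord z (k + 1), rayCoord z (k + 2)⟩ =
          Ψ j ⟨rayCoord z (j + 1), rayCoord z (j + 2)⟩ := by
      intro z k j hz hk hj
      have hle : ∀ i, rayCoord z i ≤ 1 := by
        have := rayCoord_nonneg z
        intro i
        fin_cases i <;> simp <;> linarith [this 0, this 1, this 2]
      obtain ⟨h1, h2, h3, h4, -⟩ := fin3_add k
      rcases fin3_cases k j with rfl | rfl | rfl
      · rfl
      · rw [h1, h2, hk, hj, Ψim _ _ (rayCoord_nonneg _ _) (hle _),
          Ψre _ _ (rayCoord_nonneg _ _) (hle _), h1]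
      · rw [h3, h4, hk, hj, Ψim _ _ (rayCoord_nonneg _ _) (hle _),
          Ψre _ _ (rayCoord_nonneg _ _) (hle _), h4]
    choose κ hκ using exists_rayCoord_eq_zero
    let Θ : ℂ → S := fun z => Ψ (κ z) ⟨rayCoord z (κ z + 1), rayCoord z (κ z + 2)⟩
    have hΘ : ∀ z k, starFun z ≤ 0 → rayCoord z k = 0 →
        Θ z = Ψ k ⟨rayCoord z (k + 1), rayCoord z (k + 2)⟩ := by
      intro z k hz hk
      rw [starFun_eq] at hz
      exact compat z _ _ (by linarith) (hκ z) hk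
    have sum : ∀ z k, rayCoord z k = 0 →
        starFun z = rayCoord z (k + 1) + rayCoord z (k + 2) - 1 / 2 := by
      intro z k hk
      rw [starFun_eq]
      fin_cases k <;> simp at hk <;> simp [hk]
      ring
    have Θc : ContinuousOn Θ {z | starFun z ≤ 0} := by
      have : {z | starFun z ≤ 0} = ⋃ k : Fin 3, {z | starFun z ≤ 0 ∧ rayCoord z k = 0} := by
        ext z
        simp only [Set.mem_iUnion, Set.mem_ofPred_eq, exists_and_left]
        exact ⟨fun h => ⟨h, exists_rayCoord_eq_zero z⟩, fun h => h.1⟩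
      rw [this]
      refine (locallyFinite_of_finite _).continuousOn_iUnion (fun k => ?_) (fun k => ?_)
      · exact (isClosed_le isBodyFun_starFun.continuous continuous_const).inter
          (isClosed_eq (continuous_rayCoord k) continuous_const)
      · refine ContinuousOn.congr (f := fun z => Ψ k ⟨rayCoord z (k + 1), rayCoord z (k + 2)⟩) ?_
          fun z hz => hΘ z k hz.1 hz.2
        refine (Ψc k).comp (Continuous.continuousOn ?_) ?_
        · have : (fun z => (⟨rayCoord z (k + 1), rayCoord z (k + 2)⟩ : ℂ)) = fun z =>
              (rayCoord z (k + 1) : ℂ) + (rayCoord z (k + 2) : ℂ) * Complex.I := by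
            funext z
            exact Complex.mk_eq_add_mul_I _ _
          rw [this]
          have h1 := continuous_rayCoord (k + 1)
          have h2 := continuous_rayCoord (k + 2)
          fun_prop
        · intro z hz
          have h := hz.1
          rw [sum z k hz.2] at h
          exact triangleFun_le.2 ⟨rayCoord_nonneg z (k + 1), rayCoord_nonneg z (k + 2), by
            simp only
            linarith⟩
    have Θi : Set.InjOn Θ {z | starFun z ≤ 0} := by
      intro z hz w hw e
      have hk := hκ z
      have hj := hκ w
      rw [hΘ z _ hz hk, hΘ w _ hw hj] at e
      simp only [Set.mem_ofPred_eq] at hz hw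
      rw [sum z _ hk] at hz
      rw [sum w _ hj] at hw
      -- Since `starFun ≤ 0` bounds the coordinate sums by 1/2, both points lie in the range where
      -- `key` applies.
      have := key _ _ _ _ _ _ (rayCoord_nonneg _ _) (rayCoord_nonneg _ _) (by linarith)
        (rayCoord_nonneg _ _) (rayCoord_nonneg _ _) (by linarith) e
      generalize κ z = k at *
      generalize κ w = j at *
      obtain ⟨h1, h2, h3, h4, -⟩ := fin3_add k
      apply rayCoord_injective
      funext i
      rcases this with ⟨rfl, ha, hb⟩ | ⟨rfl, ha, hb, hc⟩ | ⟨rfl, ha, hb, hc⟩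
      · rcases fin3_cases j i with rfl | rfl | rfl
        · rw [hk, hj]
        · exact ha
        · exact hb
      · rw [h1] at hc
        rw [h2] at hb
        rcases fin3_cases k i with rfl | rfl | rfl
        · rw [hk, hb]
        · rw [ha, hj]
        · exact hc
      · rw [h3] at hb
        rw [h4] at hc
        rcases fin3_cases k i with rfl | rfl | rfl
        · rw [hk, hb]
        · exact hc
        · rw [ha, hj]
    have Θim : ∀ k a b, 0 ≤ a → 0 ≤ b → a + b ≤ 1 / 2 →
        ∃ z, starFun z = a + b - 1 / 2 ∧ Θ z = Ψ k ⟨a, b⟩ := by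
      intro k a b ha hb hab
      obtain ⟨-, -, -, -, h5, h6, h7⟩ := fin3_add k
      let e : Fin 3 → ℝ := fun i => if i = k then 0 else if i = k + 1 then a else b
      have e0 : e k = 0 := if_pos rfl
      have e1 : e (k + 1) = a := by simp [e]
      have e2 : e (k + 2) = b := by simp [e, h7.symm]
      obtain ⟨z, hz⟩ := exists_rayCoord_eq (e := e) (fun i => by
        rcases fin3_cases k i with rfl | rfl | rfl
        · rw [e0]
        · rwa [e1]
        · rwa [e2]) e0
      have hk : rayCoord z k = 0 := by rw [hz, e0]
      have hs := sum z k hk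
      rw [hz, e1, e2] at hs
      refine ⟨z, hs, ?_⟩
      rw [hΘ z k (by linarith) hk, hz, e1, e2]
    have := isBodyFun_starFun.isClosedDisc Θc Θi
    convert this using 1
    · ext x
      rw [hN]
      constructor
      · rintro ⟨k, a, b, ha, hb, hab, rfl⟩
        obtain ⟨z, hz, e⟩ := Θim k a b ha hb hab.le
        exact ⟨z, by simp only [Set.mem_ofPred_eq]; linarith, e⟩
      · rintro ⟨z, hz, rfl⟩
        simp only [Set.mem_ofPred_eq] at hz
        refine ⟨κ z, _, _, rayCoord_nonneg z _, rayCoord_nonneg z _, ?_, rfl⟩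
        rw [sum z _ (hκ z)] at hz
        linarith
    · ext x
      rw [hM]
      constructor
      · rintro ⟨k, a, b, ha, hb, hab, rfl⟩
        obtain ⟨z, hz, e⟩ := Θim k a b ha hb hab.le
        exact ⟨z, by simp only [Set.mem_ofPred_eq]; linarith, e⟩
      · rintro ⟨z, hz, rfl⟩
        simp only [Set.mem_ofPred_eq] at hz
        refine ⟨κ z, _, _, rayCoord_nonneg z _, rayCoord_nonneg z _, ?_, rfl⟩
        rw [sum z _ (hκ z)] at hz
        linarith
  · intro k
    have hsub : {z | trapezoidFun z ≤ 0} ⊆ {z | triangleFun z ≤ 0} := fun z hz =>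
      (trapezoidFun_le.1 hz).1
    have := isBodyFun_trapezoidFun.isClosedDisc ((Ψc k).mono hsub) ((Ψi k).mono hsub)
    convert this using 1
    · ext x
      constructor
      · rintro ⟨hx, hxN⟩
        obtain ⟨z, hz, rfl⟩ : x ∈ Ψ k '' {z | triangleFun z < 0} := ΨU k ▸ hx
        refine ⟨z, trapezoidFun_lt.2 ⟨hz, ?_⟩, rfl⟩
        obtain ⟨h1, h2, h3⟩ := triangleFun_lt.1 hz
        by_contra hle
        exact hxN ((hNM _).2 ⟨k, z.re, z.im, h1.le, h2.le, not_lt.1 hle, rfl⟩)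
      · rintro ⟨z, hz, rfl⟩
        obtain ⟨h0, h4⟩ := trapezoidFun_lt.1 hz
        refine ⟨ΨU k ▸ ⟨z, h0, rfl⟩, ?_⟩
        obtain ⟨h1, h2, h3⟩ := triangleFun_lt.1 h0
        have hn1 := ΨN k z.re z.im h1.le h2.le h3.le
        have hm1 := ΨM k z.re z.im h1.le h2.le h3.le
        rintro (h | h)
        · linarith [hn1.1 h]
        · linarith [hm1.1 h]
    · ext x
      constructor
      · rintro (⟨hx, hxN⟩ | ⟨hxM, hxU⟩)
        · obtain ⟨z, hz, rfl⟩ : x ∈ Ψ k '' {z | triangleFun z = 0} := ΨJ k ▸ hx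
          obtain ⟨⟨h1, h2, h3⟩, -⟩ := triangleFun_eq.1 hz
          have h4 : 1 / 2 ≤ z.re + z.im := by
            by_contra hlt
            exact hxN ((ΨN k z.re z.im h1 h2 h3).2 (not_le.1 hlt))
          refine ⟨z, ?_, rfl⟩
          have hz' : triangleFun z = 0 := hz
          simp only [Set.mem_ofPred_eq, trapezoidFun, hz']
          exact max_eq_left (by linarith)
        · obtain ⟨a, b, ha, hb, hab, rfl⟩ := UM k x hxU (Or.inr hxM)
          rw [ΨM k a b ha.le hb.le (by linarith)] at hxM
          refine ⟨_, ?_, rfl⟩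
          simp only [Set.mem_ofPred_eq, trapezoidFun, hxM, sub_self]
          exact max_eq_right (triangleFun_le.2 ⟨ha.le, hb.le, by simp only; linarith⟩)
      · rintro ⟨z, hz, rfl⟩
        have hz' : trapezoidFun z = 0 := hz
        obtain ⟨h0, h4⟩ := trapezoidFun_le.1 hz'.le
        obtain ⟨h1, h2, h3⟩ := triangleFun_le.1 h0
        rcases h0.lt_or_eq with h | h
        · right
          have h5 : z.re + z.im = 1 / 2 := by
            refine le_antisymm (not_lt.1 fun h6 => ?_) h4
            exact hz'.not_lt (trapezoidFun_lt.2 ⟨h, h6⟩)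
          exact ⟨(ΨM k z.re z.im h1 h2 h3).2 h5, ΨU k ▸ ⟨z, h, rfl⟩⟩
        · left
          refine ⟨ΨJ k ▸ ⟨z, h, rfl⟩, fun hN' => ?_⟩
          have := (ΨN k z.re z.im h1 h2 h3).1 hN'
          linarith

end StrongDrawing

/-! ### Truncation of a vertex -/

/-- The vertex `v` of `G`, with the neighbours `n 0`, `n 1`, `n 2`, is replaced by a triangle. -/
def truncate {W : Type*} (G : SimpleGraph W) (v : W) (n : Fin 3 → W) :
    SimpleGraph ({u // u ≠ v} ⊕ Fin 3) where
  Adj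
    | .inl u, .inl w => G.Adj u w
    | .inl u, .inr i => u = n i ∧ G.Adj v (n i)
    | .inr i, .inl u => u = n i ∧ G.Adj v (n i)
    | .inr i, .inr j => i ≠ j ∧ G.Adj v (n i) ∧ G.Adj v (n j)
  symm := ⟨by
    rintro (u | i) (w | j) h
    · exact h.symm
    · exact h
    · exact h
    · exact ⟨h.1.symm, h.2.2, h.2.1⟩⟩
  loopless := ⟨by
    rintro (u | i) h
    · exact G.irrefl h
    · exact h.1 rfl⟩

/-- The triangle that replaces a truncated vertex. -/
def cornerTriangle (A B : Type*) : SimpleGraph (A ⊕ B) where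
  Adj
    | .inr i, .inr j => i ≠ j
    | _, _ => False
  symm := ⟨by
    rintro (u | i) (w | j) h
    · exact h
    · exact h
    · exact h
    · exact Ne.symm h⟩
  loopless := ⟨by
    rintro (u | i) h
    · exact h
    · exact h rfl⟩

section

variable {W : Type*} {G C : SimpleGraph W} {v : W} {n : Fin 3 → W}

/-- Truncation does not affect the edges away from `v`, so a path that avoids `v` survives as a path
through old vertices. -/
theorem exists_lift_path {a b : W} (q : G.Walk a b) (hq : q.IsPath) (hv : v ∉ q.support)
    (ha : a ≠ v) (hb : b ≠ v) :
    ∃ q' : (truncate G v n).Walk (.inl ⟨a, ha⟩) (.inl ⟨b, hb⟩), q'.IsPath ∧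
      (∀ y, y ∈ q'.support → ∃ u, y = .inl u ∧ u.1 ∈ q.support) ∧
      (∀ u w : {u // u ≠ v}, s(.inl u, .inl w) ∈ q'.edges ↔ s(u.1, w.1) ∈ q.edges) := by
  induction q with
  | nil =>
    refine ⟨SimpleGraph.Walk.nil, SimpleGraph.Walk.IsPath.nil, ?_, by simp⟩
    intro y hy
    exact ⟨⟨_, ha⟩, by simpa using hy, by simp⟩
  | @cons a c b h p ih =>
    rw [SimpleGraph.Walk.cons_isPath_iff] at hq
    rw [SimpleGraph.Walk.support_cons, List.mem_cons, not_or] at hv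
    have hc : c ≠ v := fun e => hv.2 (e ▸ p.start_mem_support)
    obtain ⟨q', h1, h2, h3⟩ := ih hq.1 hv.2 hc hb
    have hadj : (truncate G v n).Adj (.inl ⟨a, ha⟩) (.inl ⟨c, hc⟩) := h
    refine ⟨SimpleGraph.Walk.cons hadj q', ?_, ?_, ?_⟩
    · rw [SimpleGraph.Walk.cons_isPath_iff]
      refine ⟨h1, fun hy => ?_⟩
      obtain ⟨u, hu, hu'⟩ := h2 _ hy
      obtain rfl := Sum.inl_injective hu
      exact hq.2 hu'
    · intro y hy
      rw [SimpleGraph.Walk.support_cons, List.mem_cons] at hy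
      rcases hy with rfl | hy
      · exact ⟨_, rfl, by simp⟩
      · obtain ⟨u, hu, hu'⟩ := h2 _ hy
        exact ⟨u, hu, by simp [hu']⟩
    · intro u w
      simp only [SimpleGraph.Walk.edges_cons, List.mem_cons, h3]
      refine or_congr ?_ Iff.rfl
      simp [Subtype.ext_iff]

theorem not_adj_of_le {C G : SimpleGraph W} {a b : W} (q : G.Walk a b) (hab : a ≠ b)
    (hq : ∀ x y, s(x, y) ∈ q.edges → C.Adj x y) {u : W} (hu : ∀ x, ¬ C.Adj u x) :
    u ∉ q.support := by
  intro h
  rw [SimpleGraph.Walk.mem_support_iff_exists_mem_edges_of_not_nil (fun hn => hab hn.eq)] at h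
  obtain ⟨e, he, x, rfl⟩ := h
  exact hu x (hq u x he)

theorem isCycleIn_cornerTriangle (h : ∀ i, G.Adj v (n i)) :
    IsCycleIn (truncate G v n) (cornerTriangle {u // u ≠ v} (Fin 3)) := by
  have hadj : ∀ i j, i ≠ j → (truncate G v n).Adj (.inr i) (.inr j) := fun i j hij =>
    ⟨hij, h i, h j⟩
  refine IsCycleIn.of_path (v := .inr 0) (a := .inr 1) (b := .inr 2)
    (hadj 1 2 (by decide)).toWalk ?_ ?_ ?_ (hadj 0 1 (by decide)) (hadj 0 2 (by decide)) ?_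
  · simp [SimpleGraph.Walk.cons_isPath_iff]
  · simp
  · simp
  · rintro (u | i) (w | j)
    · simp [cornerTriangle]
    · simp [cornerTriangle]
    · simp [cornerTriangle]
    · simp only [cornerTriangle, SimpleGraph.Walk.edges_cons, SimpleGraph.Walk.edges_nil,
        List.mem_singleton, Sym2.eq_iff, Sum.inr.injEq]
      revert i j
      decide

/-- The conditions `C.Adj v (n i)` in `truncate` fail for every `i`, so `truncate C v n` has no edge
at a new vertex and is a copy of `C`. -/
theorem IsCycleIn.truncate_of_forall_not_adj (hC : IsCycleIn G C) (hv : ∀ x, ¬ C.Adj v x) :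
    IsCycleIn (truncate G v n) (truncate C v n) := by
  obtain ⟨u, a, hua⟩ : ∃ u a, C.Adj u a := by
    obtain ⟨u, w, hw, h⟩ := hC
    cases w with
    | nil => exact (hw.not_nil (by simp)).elim
    | @cons _ a _ h' p => exact ⟨u, a, (h u a).1 (by simp)⟩
  obtain ⟨b, q, hq, huq, hab, hqC⟩ := hC.exists_path hua
  have hub : C.Adj u b := (hqC u b).2 (Or.inr (Or.inr rfl))
  have hu : u ≠ v := fun e => hv a (e ▸ hua)
  have ha : a ≠ v := fun e => hv u (e ▸ hua.symm)
  have hb : b ≠ v := fun e => hv u (e ▸ hub.symm)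
  have hvq : v ∉ q.support := not_adj_of_le q hab (fun x y h => (hqC x y).2 (Or.inl h)) hv
  obtain ⟨q', h1, h2, h3⟩ := exists_lift_path (n := n) q hq hvq ha hb
  have hno : ∀ y i, s(y, .inr i) ∉ q'.edges := by
    intro y i hy
    obtain ⟨u, hu, -⟩ := h2 _ (q'.snd_mem_support_of_mem_edges hy)
    cases hu
  refine IsCycleIn.of_path (v := .inl ⟨u, hu⟩) q' h1 ?_ ?_ (hC.le hua) (hC.le hub) ?_
  · intro h
    obtain ⟨y, hy, hy'⟩ := h2 _ h
    obtain rfl := Sum.inl_injective hy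
    exact huq hy'
  · simpa using hab
  · rintro (x | i) (y | j)
    · rw [h3]
      refine (hqC x y).trans ?_
      simp [Subtype.ext_iff]
    · refine iff_of_false (fun h => hv _ h.2) ?_
      rintro (h | h | h)
      · exact hno _ _ h
      · simp at h
      · simp at h
    · refine iff_of_false (fun h => hv _ h.2) ?_
      rintro (h | h | h)
      · exact hno _ _ (Sym2.eq_swap ▸ h)
      · simp at h
      · simp at h
    · refine iff_of_false (fun h => hv _ h.2.1) ?_
      rintro (h | h | h)
      · exact hno _ _ h
      · simp at h
      · simp at h

/-- The section `n (k + 2)`, `v`, `n (k + 1)` of the cycle is replaced by `n (k + 2)`, the corner `k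
+ 2`, the corner `k + 1`, `n (k + 1)`. In `truncate C v n`, the conditions `C.Adj v (n i)` leave
exactly these new edges, so one construction truncates both the graph and its facial cycles. -/
theorem IsCycleIn.truncate_of_adj (hn : Function.Injective n) (hC : IsCycleIn G C) {k : Fin 3}
    (h1 : C.Adj v (n (k + 1))) (h2 : C.Adj v (n (k + 2))) :
    IsCycleIn (truncate G v n) (truncate C v n) := by
  obtain ⟨-, -, -, -, h5, h6, h7⟩ := fin3_add k
  have h0 : ¬ C.Adj v (n k) := by
    intro h
    rcases hC.eq_or_eq h1 h2 (hn.ne h7) h with e | e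
    · exact h5 (hn e).symm
    · exact h6 (hn e).symm
  obtain ⟨q, hq, hvq, hqC⟩ := hC.exists_path_of_adj h1 h2 (hn.ne h7)
  obtain ⟨q', hq1, hq2, hq3⟩ := exists_lift_path (n := n) q hq hvq h1.ne' h2.ne'
  have hno : ∀ y i, s(y, .inr i) ∉ q'.edges := by
    intro y i hy
    obtain ⟨u, hu, -⟩ := hq2 _ (q'.snd_mem_support_of_mem_edges hy)
    cases hu
  have hno' : ∀ y i, s(.inr i, y) ∉ q'.edges := by
    intro y i
    rw [Sym2.eq_swap]
    exact hno y i
  have hnr : ∀ i, .inr i ∉ q'.support := by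
    intro i hi
    obtain ⟨u, hu, -⟩ := hq2 _ hi
    cases hu
  have hvq' : ∀ x, s(v, x) ∉ q.edges := fun x h => hvq (q.fst_mem_support_of_mem_edges h)
  have hadj : (truncate G v n).Adj (.inl ⟨n (k + 2), h2.ne'⟩) (.inr (k + 2)) := ⟨rfl, hC.le h2⟩
  -- The cycle is split at the corner `k + 1`: its neighbours are `n (k + 1)` and the corner `k +
  -- 2`, which is appended to the lifted path.
  refine IsCycleIn.of_path (v := .inr (k + 1)) (b := .inr (k + 2)) (q'.concat hadj)
    (hq1.concat (hnr _) hadj) ?_ (by simp) ⟨rfl, hC.le h1⟩ ⟨h7, hC.le h1, hC.le h2⟩ ?_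
  · rw [SimpleGraph.Walk.support_concat]
    simp [hnr, h7]
  · have hi : ∀ i, C.Adj v (n i) ↔ i = k + 1 ∨ i = k + 2 := by
      intro i
      rcases fin3_cases k i with rfl | rfl | rfl
      · simp [h0, h5.symm, h6.symm]
      · simp [h1]
      · simp [h2]
    have edge : ∀ (u : {u // u ≠ v}) i, (u.1 = n i ∧ (i = k + 1 ∨ i = k + 2)) ↔
        (u = ⟨n (k + 2), h2.ne'⟩ ∧ i = k + 2) ∨ (u = ⟨n (k + 1), h1.ne'⟩ ∧ i = k + 1) := by
      intro u i
      simp only [Subtype.ext_iff]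
      constructor
      · rintro ⟨h, rfl | rfl⟩
        · exact Or.inr ⟨h, rfl⟩
        · exact Or.inl ⟨h, rfl⟩
      · rintro (⟨h, rfl⟩ | ⟨h, rfl⟩)
        · exact ⟨h, Or.inr rfl⟩
        · exact ⟨h, Or.inl rfl⟩
    rintro (x | i) (y | j)
    · simp only [SimpleGraph.Walk.edges_concat, List.concat_eq_append, List.mem_append, hq3,
        List.mem_singleton]
      refine (hqC x y).trans ?_
      have hx := x.2
      have hy := y.2
      simp [hx, hy]
    · simp only [SimpleGraph.Walk.edges_concat, List.concat_eq_append, List.mem_append, hno,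
        List.mem_singleton]
      refine (and_congr Iff.rfl (hi j)).trans ((edge x j).trans ?_)
      simp
    · simp only [SimpleGraph.Walk.edges_concat, List.concat_eq_append, List.mem_append, hno',
        List.mem_singleton]
      refine (and_congr Iff.rfl (hi i)).trans ((edge y i).trans ?_)
      simp
      tauto
    · simp only [SimpleGraph.Walk.edges_concat, List.concat_eq_append, List.mem_append, hno,
        List.mem_singleton]
      refine (and_congr Iff.rfl (and_congr (hi i) (hi j))).trans ?_
      simp
      clear * -
      revert i j k
      decide

end

/-- As `0 + 1 + 2 = 0` in `Fin 3`, the third index is `-(i + j)`. In the truncation, `f (-(i + j))`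
is the cell between the edges to `n i` and `n j`; the formula is visibly symmetric in `i` and `j`.
-/
theorem fin3_third : ∀ i j : Fin 3, i ≠ j → -(i + j) ≠ i ∧ -(i + j) ≠ j ∧
    ∀ k, i ≠ k → j ≠ k → -(i + j) = k := by
  decide

theorem fin3_third_inj : ∀ i j i' j' : Fin 3, i ≠ j → i' ≠ j' → -(i + j) = -(i' + j') →
    (i = i' ∧ j = j') ∨ (i = j' ∧ j = i') := by
  decide

theorem fin3_exists_add : ∀ i j : Fin 3, i ≠ j →
    ∃ k, (i = k + 1 ∧ j = k + 2) ∨ (i = k + 2 ∧ j = k + 1) := by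
  decide

theorem fin3_third_add : ∀ k : Fin 3, -(k + 1 + (k + 2)) = k := by
  decide

/-! ### The drawing of the truncated graph -/

namespace StrongDrawing

variable {W : Type*} {G : SimpleGraph W} {S : Type*} [TopologicalSpace S] {ι : Type*}
  (D : StrongDrawing G S ι)

/-- The edges of the drawing of the truncated graph. -/
def truncateEdge {v : W} {n : Fin 3 → W} {f : Fin 3 → ι} (E : D.VertexDisc v n f) :
    {u // u ≠ v} ⊕ Fin 3 → {u // u ≠ v} ⊕ Fin 3 → Set S
  | .inl u, .inl w => D.O u w
  | .inl u, .inr i => {x | u = n i ∧ x ∈ D.O v (n i) \ (E.N ∪ E.M)}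
  | .inr i, .inl u => {x | u = n i ∧ x ∈ D.O v (n i) \ (E.N ∪ E.M)}
  | .inr i, .inr j => {x | i ≠ j ∧ x ∈ E.M ∩ D.U (f (-(i + j)))}

/-- The vertices of the drawing of the truncated graph. -/
def truncatePoint {v : W} {n : Fin 3 → W} {f : Fin 3 → ι} (E : D.VertexDisc v n f) :
    {u // u ≠ v} ⊕ Fin 3 → S
  | .inl u => D.pt u
  | .inr i => E.m i

/-- The cells of the drawing of the truncated graph. -/
def truncateCell {v : W} {n : Fin 3 → W} {f : Fin 3 → ι} (E : D.VertexDisc v n f) :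
    Option ι → Set S
  | none => E.N
  | some i => D.U i \ (E.N ∪ E.M)

/-- The boundaries of the cells of the drawing of the truncated graph. -/
def truncateBoundary (v : W) (n : Fin 3 → W) : Option ι → SimpleGraph ({u // u ≠ v} ⊕ Fin 3)
  | none => cornerTriangle _ _
  | some i => truncate (D.C i) v n

variable {D}

theorem adj_corner {v : W} {n : Fin 3 → W} {f : Fin 3 → ι}
    (hf1 : ∀ k, (D.C (f k)).Adj v (n (k + 1))) (hf2 : ∀ k, (D.C (f k)).Adj v (n (k + 2)))
    {k i : Fin 3} (h : i ≠ k) : (D.C (f k)).Adj v (n i) := by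
  rcases fin3_cases k i with rfl | rfl | rfl
  · exact (h rfl).elim
  · exact hf1 k
  · exact hf2 k

theorem not_adj_corner {v : W} {n : Fin 3 → W} {f : Fin 3 → ι} (hn : Function.Injective n)
    (hf1 : ∀ k, (D.C (f k)).Adj v (n (k + 1))) (hf2 : ∀ k, (D.C (f k)).Adj v (n (k + 2)))
    (k : Fin 3) : ¬ (D.C (f k)).Adj v (n k) := by
  intro h
  obtain ⟨-, -, -, -, h5, h6, h7⟩ := fin3_add k
  rcases (D.isCycle _).eq_or_eq (hf1 k) (hf2 k) (hn.ne h7) h with e | e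
  · exact h5 (hn e).symm
  · exact h6 (hn e).symm

/-- The uniqueness part of `corner`: both cells contain the same two edges at `v`. -/
theorem eq_corner {v : W} {n : Fin 3 → W} {f : Fin 3 → ι} (hn : Function.Injective n)
    (hf1 : ∀ k, (D.C (f k)).Adj v (n (k + 1))) (hf2 : ∀ k, (D.C (f k)).Adj v (n (k + 2)))
    {i : ι} {a b : Fin 3} (ha : (D.C i).Adj v (n a)) (hb : (D.C i).Adj v (n b)) (hab : a ≠ b) :
    i = f (-(a + b)) := by
  obtain ⟨h1, h2, -⟩ := fin3_third a b hab
  exact (D.corner ((D.isCycle i).le ha) ((D.isCycle i).le hb) (hn.ne hab)).unique ⟨ha, hb⟩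
    ⟨adj_corner hf1 hf2 h1.symm, adj_corner hf1 hf2 h2.symm⟩

/-- A facial cycle through `v` uses two of the only three edges at `v`, and `eq_corner` identifies
the cell. -/
theorem exists_eq_corner {v : W} {n : Fin 3 → W} {f : Fin 3 → ι} (hn : Function.Injective n)
    (hv : ∀ u, G.Adj v u ↔ ∃ i, u = n i)
    (hf1 : ∀ k, (D.C (f k)).Adj v (n (k + 1))) (hf2 : ∀ k, (D.C (f k)).Adj v (n (k + 2)))
    {i : ι} {u : W} (hu : (D.C i).Adj v u) : ∃ k, i = f k := by
  obtain ⟨b, q, -, -, hab, hC⟩ := (D.isCycle i).exists_path hu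
  have hb : (D.C i).Adj v b := (hC v b).2 (Or.inr (Or.inr rfl))
  obtain ⟨j, rfl⟩ := (hv u).1 ((D.isCycle i).le hu)
  obtain ⟨l, rfl⟩ := (hv b).1 ((D.isCycle i).le hb)
  exact ⟨_, eq_corner hn hf1 hf2 hu hb fun e => hab (by rw [e])⟩

theorem truncate_isCycle {v : W} {n : Fin 3 → W} {f : Fin 3 → ι} (hn : Function.Injective n)
    (hv : ∀ u, G.Adj v u ↔ ∃ i, u = n i)
    (hf1 : ∀ k, (D.C (f k)).Adj v (n (k + 1))) (hf2 : ∀ k, (D.C (f k)).Adj v (n (k + 2)))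
    (o : Option ι) : IsCycleIn (truncate G v n) (D.truncateBoundary v n o) := by
  rcases o with _ | i
  · exact isCycleIn_cornerTriangle fun i => (hv _).2 ⟨i, rfl⟩
  · by_cases h : ∃ u, (D.C i).Adj v u
    · obtain ⟨u, hu⟩ := h
      obtain ⟨k, rfl⟩ := exists_eq_corner hn hv hf1 hf2 hu
      exact (D.isCycle _).truncate_of_adj hn (hf1 k) (hf2 k)
    · exact (D.isCycle i).truncate_of_forall_not_adj fun u hu => h ⟨u, hu⟩

/-- A corner at an old vertex is an old corner. At a new vertex, an old neighbour and a new one lie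
together on one truncated cell, and two new neighbours lie together only on the new triangle. -/
theorem truncate_corner {v : W} {n : Fin 3 → W} {f : Fin 3 → ι} (hn : Function.Injective n)
    (hf1 : ∀ k, (D.C (f k)).Adj v (n (k + 1))) (hf2 : ∀ k, (D.C (f k)).Adj v (n (k + 2)))
    {x a b : {u // u ≠ v} ⊕ Fin 3} (ha : (truncate G v n).Adj x a)
    (hb : (truncate G v n).Adj x b) (hab : a ≠ b) :
    ∃! o, (D.truncateBoundary v n o).Adj x a ∧ (D.truncateBoundary v n o).Adj x b := by
  rcases x with x | i
  · -- an old vertex: `π` maps the new neighbours to the old ones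
    obtain ⟨π, hπl, hπr⟩ : ∃ π : {u // u ≠ v} ⊕ Fin 3 → W, (∀ u, π (.inl u) = u.1) ∧
        ∀ i, π (.inr i) = v := ⟨Sum.elim (fun u => u.1) fun _ => v, fun _ => rfl, fun _ => rfl⟩
    have hadj : ∀ {C : SimpleGraph W} {y}, (truncate G v n).Adj (.inl x) y →
        ((truncate C v n).Adj (.inl x) y ↔ C.Adj x (π y)) := by
      rintro C (y | j) h
      · rw [hπl]; exact Iff.rfl
      · rw [hπr]
        obtain ⟨h1, h2⟩ := h
        constructor
        · rintro ⟨-, h⟩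
          rw [h1]; exact h.symm
        · intro h
          exact ⟨h1, by rw [← h1]; exact h.symm⟩
    have hne : π a ≠ π b := by
      rcases a with a | a <;> rcases b with b | b <;> simp only [hπl, hπr]
      · exact fun e => hab (by rw [Subtype.ext e])
      · exact a.2
      · exact b.2.symm
      · exact fun _ => hab (by rw [hn (ha.1.symm.trans hb.1)])
    obtain ⟨i, ⟨h1, h2⟩, h3⟩ := D.corner ((hadj ha).1 ha) ((hadj hb).1 hb) hne
    refine ⟨some i, ⟨(hadj ha).2 h1, (hadj hb).2 h2⟩, ?_⟩
    rintro (_ | j) ⟨h4, h5⟩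
    · cases a <;> exact h4.elim
    · rw [h3 j ⟨(hadj ha).1 h4, (hadj hb).1 h5⟩]
  -- The edges from the new vertex `i` to the old vertex `n i` and to the new vertex `j` are what
  -- remains of the corner at `v` between `n i` and `n j`.
  · have mixed : ∀ {j}, i ≠ j → ∃! o, (D.truncateBoundary v n o).Adj (.inr i) (.inr j) ∧
        ∃ hi : n i ≠ v, (D.truncateBoundary v n o).Adj (.inr i) (.inl ⟨n i, hi⟩) := by
      intro j hij
      obtain ⟨h1, h2, -⟩ := fin3_third i j hij
      have hi := adj_corner hf1 hf2 h1.symm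
      have hj := adj_corner hf1 hf2 h2.symm
      refine ⟨some (f (-(i + j))), ⟨⟨hij, hi, hj⟩, hi.ne', rfl, hi⟩, ?_⟩
      rintro (_ | l) ⟨h3, hi, h4⟩
      · exact h4.elim
      · rw [eq_corner hn hf1 hf2 h3.2.1 h3.2.2 hij]
    rcases a with a | a <;> rcases b with b | b
    · exact (hab (by rw [Subtype.ext (ha.1.trans hb.1.symm)])).elim
    · obtain ⟨a, ha'⟩ := a
      obtain rfl : a = n i := ha.1
      obtain ⟨o, ⟨h1, hi, h2⟩, h3⟩ := mixed hb.1
      exact ⟨o, ⟨h2, h1⟩, fun o' ⟨h, h'⟩ => h3 o' ⟨h', ha', h⟩⟩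
    · obtain ⟨b, hb'⟩ := b
      obtain rfl : b = n i := hb.1
      obtain ⟨o, ⟨h1, hi, h2⟩, h3⟩ := mixed ha.1
      exact ⟨o, ⟨h1, h2⟩, fun o' ⟨h, h'⟩ => h3 o' ⟨h, hb', h'⟩⟩
    -- Here `i`, `a` and `b` are distinct. An old cell that contained both edges would contain all
    -- three edges at `v`, which `not_adj_corner` forbids.
    · refine ⟨none, ⟨ha.1, hb.1⟩, ?_⟩
      rintro (_ | l) ⟨h1, h2⟩
      · rfl
      · have hab' : a ≠ b := fun e => hab (by rw [e])
        have e1 := eq_corner hn hf1 hf2 h1.2.1 h1.2.2 h1.1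
        have := (fin3_third i a h1.1).2.2 b h2.1 hab'
        rw [this] at e1
        subst e1
        exact (not_adj_corner hn hf1 hf2 b h2.2.2).elim

/-- The new cell and the cells at `v` are handled by the two disc fields of `VertexDisc`, once the
drawn cycles are matched with the boundary sets there. A cell that is not at `v` does not meet `N ∪
M` and is unchanged. -/
theorem truncate_isDisc {v : W} {n : Fin 3 → W} {f : Fin 3 → ι} (E : D.VertexDisc v n f)
    (hn : Function.Injective n) (hv : ∀ u, G.Adj v u ↔ ∃ i, u = n i)
    (hf1 : ∀ k, (D.C (f k)).Adj v (n (k + 1))) (hf2 : ∀ k, (D.C (f k)).Adj v (n (k + 2)))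
    (o : Option ι) : IsClosedDisc (D.truncateCell E o)
      (drawnSet (D.truncatePoint E) (D.truncateEdge E) (D.truncateBoundary v n o)) := by
  have ptN : ∀ u : {u // u ≠ v}, D.pt u ∉ E.N ∪ E.M := fun u h => u.2 (E.eq_of_pt_mem h)
  rcases o with _ | i
  · change IsClosedDisc E.N _
    convert E.isDisc_N using 1
    ext x
    constructor
    · rintro ⟨u | i, w | j, h, hx⟩
      · exact h.elim
      · exact h.elim
      · exact h.elim
      · rcases hx with rfl | hx
        · exact E.m_mem_M i
        · exact hx.2.1
    · intro hx
      rcases E.M_cases hx with ⟨k, rfl⟩ | ⟨k, hk⟩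
      · exact ⟨.inr k, .inr (k + 1), (fin3_add k).2.2.2.2.1.symm, Or.inl rfl⟩
      · refine ⟨.inr (k + 1), .inr (k + 2), (fin3_add k).2.2.2.2.2.2,
          Or.inr ⟨(fin3_add k).2.2.2.2.2.2, hx, ?_⟩⟩
        rwa [fin3_third_add]
  · by_cases hi : ∃ u, (D.C i).Adj v u
    · obtain ⟨u, hu⟩ := hi
      obtain ⟨k, rfl⟩ := exists_eq_corner hn hv hf1 hf2 hu
      change IsClosedDisc (D.U (f k) \ (E.N ∪ E.M)) _
      convert E.isDisc_U k using 1
      have hm : ∀ {j}, (D.C (f k)).Adj v (n j) → E.m j ∈ D.J (f k) \ E.N := fun {j} h =>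
        ⟨⟨v, n j, h, Or.inr (E.m_mem_O j)⟩, fun hN => E.disjoint hN (E.m_mem_M j)⟩
      have hOe : ∀ {j x}, (D.C (f k)).Adj v (n j) → x ∈ D.O v (n j) \ (E.N ∪ E.M) →
          x ∈ D.J (f k) \ E.N := fun {j x} h hx =>
        ⟨⟨v, n j, h, Or.inr hx.1⟩, fun hN => hx.2 (Or.inl hN)⟩
      have hpt : ∀ {u : {u // u ≠ v}} {w}, (D.C (f k)).Adj u w → D.pt u ∈ D.J (f k) \ E.N :=
        fun {u w} h => ⟨⟨u, w, h, Or.inl rfl⟩, fun hN => ptN u (Or.inl hN)⟩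
      ext x
      constructor
      · rintro ⟨u | i, w | j, h, hx⟩
        · left
          rcases hx with rfl | hx
          · exact hpt h
          · refine ⟨⟨u, w, h, Or.inr hx⟩, fun hN => ?_⟩
            rcases E.eq_of_O_mem hx (Or.inl hN) with e | e
            · exact u.2 e
            · exact w.2 e
        · left
          obtain ⟨h1, h2⟩ := h
          rcases hx with rfl | hx
          · exact hpt (w := v) (h1 ▸ h2.symm)
          · exact hOe h2 hx.2
        · left
          obtain ⟨h1, h2⟩ := h
          rcases hx with rfl | hx
          · exact hm h2
          · exact hOe h2 hx.2
        · obtain ⟨h1, h2, h3⟩ := h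
          rcases hx with rfl | ⟨-, hxM, hxU⟩
          · exact Or.inl (hm h2)
          · right
            rw [← eq_corner hn hf1 hf2 h2 h3 h1] at hxU
            exact ⟨hxM, hxU⟩
      · have half : ∀ {w x}, (D.C (f k)).Adj v w → x ∈ D.O v w → x ∉ E.N →
            x ∈ drawnSet (D.truncatePoint E) (D.truncateEdge E)
              (D.truncateBoundary v n (some (f k))) := by
          intro w x h hx hN
          obtain ⟨i, rfl⟩ := (hv w).1 ((D.isCycle _).le h)
          by_cases hM : x ∈ E.M
          · exact ⟨.inr i, .inl ⟨n i, h.ne'⟩, ⟨rfl, h⟩, Or.inl (E.eq_m hx hM)⟩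
          · exact ⟨.inr i, .inl ⟨n i, h.ne'⟩, ⟨rfl, h⟩,
              Or.inr ⟨rfl, hx, fun h => h.elim hN hM⟩⟩
        rintro (⟨⟨u, w, h, hx⟩, hN⟩ | ⟨hM, hU⟩)
        · by_cases hu : u = v
          · subst hu
            rcases hx with rfl | hx
            · exact (hN E.pt_mem).elim
            · exact half h hx hN
          · by_cases hw : w = v
            · subst hw
              rcases hx with rfl | hx
              · obtain ⟨i, rfl⟩ := (hv u).1 ((D.isCycle _).le h.symm)
                exact ⟨.inl ⟨n i, hu⟩, .inr i, ⟨rfl, h.symm⟩, Or.inl rfl⟩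
              · rw [D.O_symm] at hx
                exact half h.symm hx hN
            · exact ⟨.inl ⟨u, hu⟩, .inl ⟨w, hw⟩, h, hx⟩
        · refine ⟨.inr (k + 1), .inr (k + 2), ⟨(fin3_add k).2.2.2.2.2.2, hf1 k, hf2 k⟩,
            Or.inr ⟨(fin3_add k).2.2.2.2.2.2, hM, ?_⟩⟩
          rwa [fin3_third_add]
    · have hi' : ∀ u, ¬ (D.C i).Adj v u := fun u hu => hi ⟨u, hu⟩
      convert D.isDisc i using 1
      · refine sdiff_eq_left.2 ?_
        rw [Set.disjoint_left]
        intro x hx hxN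
        obtain ⟨k, rfl⟩ := E.eq_of_U_mem hx hxN
        exact hi' _ (hf1 k)
      · ext x
        constructor
        · rintro ⟨u | i, w | j, h, hx⟩
          · exact ⟨u, w, h, hx⟩
          · exact (hi' _ h.2).elim
          · exact (hi' _ h.2).elim
          · exact (hi' _ h.2.1).elim
        · rintro ⟨u, w, h, hx⟩
          have hu : u ≠ v := fun e => hi' w (e ▸ h)
          have hw : w ≠ v := fun e => hi' u (e ▸ h.symm)
          exact ⟨.inl ⟨u, hu⟩, .inl ⟨w, hw⟩, h, hx⟩

/-- A strong drawing of a graph yields a strong drawing of the graph obtained by truncating a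
vertex of degree three. -/
theorem nonempty_truncate [T2Space S] (D : StrongDrawing G S ι) {v : W} {n : Fin 3 → W}
    (hn : Function.Injective n) (hv : ∀ u, G.Adj v u ↔ ∃ i, u = n i) :
    Nonempty (StrongDrawing (truncate G v n) S (Option ι)) := by
  have hvn : ∀ i, G.Adj v (n i) := fun i => (hv _).2 ⟨i, rfl⟩
  have hcor : ∀ k : Fin 3, ∃ i, (D.C i).Adj v (n (k + 1)) ∧ (D.C i).Adj v (n (k + 2)) := fun k =>
    (D.corner (hvn _) (hvn _) (hn.ne (fin3_add k).2.2.2.2.2.2)).exists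
  choose f hf using hcor
  have hf1 := fun k => (hf k).1
  have hf2 := fun k => (hf k).2
  obtain ⟨E⟩ := D.exists_vertexDisc hn hf1 hf2
  have ptN : ∀ u : {u // u ≠ v}, D.pt u ∉ E.N ∪ E.M := fun u h => u.2 (E.eq_of_pt_mem h)
  have ON : ∀ {u w : {u // u ≠ v}} {x}, x ∈ D.O u w → x ∉ E.N ∪ E.M := fun {u w x} h h' =>
    (E.eq_of_O_mem h h').elim u.2 w.2
  have half : ∀ {x w}, x ∈ D.O v w → x ∉ E.N ∪ E.M → ∃ a b, (truncate G v n).Adj a b ∧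
      x ∈ D.truncateEdge E a b := by
    intro x w hx hN
    obtain ⟨i, rfl⟩ := (hv w).1 (D.adj_of_mem hx)
    exact ⟨.inr i, .inl ⟨n i, (hvn i).ne'⟩, ⟨rfl, hvn i⟩, rfl, hx, hN⟩
  have mO : ∀ i, E.m i ∈ D.O v (n i) := E.m_mem_O
  have mM : ∀ i, E.m i ∈ E.N ∪ E.M := fun i => Or.inr (E.m_mem_M i)
  refine ⟨⟨D.truncatePoint E, D.truncateEdge E, D.truncateCell E, D.truncateBoundary v n,
    ?_, ?_, ?_, ?_, ?_, ?_, ?_, ?_, ?_, ?_, truncate_isDisc E hn hv hf1 hf2,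
    truncate_isCycle hn hv hf1 hf2, truncate_corner hn hf1 hf2⟩⟩
  · rintro (u | i) (w | j)
    · exact D.O_symm _ _
    · rfl
    · rfl
    · ext x
      simp only [truncateEdge, Set.mem_ofPred_eq, add_comm i j, ne_comm (a := i)]
  · intro x
    by_cases hN : x ∈ E.N
    · exact Or.inr (Or.inr ⟨none, hN⟩)
    by_cases hM : x ∈ E.M
    · rcases E.M_cases hM with ⟨k, rfl⟩ | ⟨k, hk⟩
      · exact Or.inl ⟨.inr k, rfl⟩
      · refine Or.inr (Or.inl ⟨.inr (k + 1), .inr (k + 2), ⟨(fin3_add k).2.2.2.2.2.2, hvn _, hvn _⟩,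
          (fin3_add k).2.2.2.2.2.2, hM, ?_⟩)
        rwa [fin3_third_add]
    have hNM : x ∉ E.N ∪ E.M := fun h => h.elim hN hM
    rcases D.cover x with ⟨u, rfl⟩ | ⟨u, w, h, hx⟩ | ⟨i, hi⟩
    · have hu : u ≠ v := fun e => hN (e ▸ E.pt_mem)
      exact Or.inl ⟨.inl ⟨u, hu⟩, rfl⟩
    · by_cases hu : u = v
      · subst hu
        exact Or.inr (Or.inl (half hx hNM))
      · by_cases hw : w = v
        · subst hw
          rw [D.O_symm] at hx
          exact Or.inr (Or.inl (half hx hNM))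
        · exact Or.inr (Or.inl ⟨.inl ⟨u, hu⟩, .inl ⟨w, hw⟩, h, hx⟩)
    · exact Or.inr (Or.inr ⟨some i, hi, hNM⟩)
  · rintro (u | i) (w | j) h
    · rw [Subtype.ext (D.pt_inj h)]
    · exact (ptN u (by rw [show D.pt u = E.m j from h]; exact mM j)).elim
    · exact (ptN w (by rw [show D.pt w = E.m i from h.symm]; exact mM i)).elim
    · have h' : E.m i = E.m j := h
      have := D.O_inj (mO i) (h' ▸ mO j)
      rw [hn (Sym2.congr_right.1 this)]
  · rintro x (u | i) (w | j) h
    · exact D.adj_of_mem h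
    · exact ⟨h.1, hvn j⟩
    · exact ⟨h.1, hvn i⟩
    · exact ⟨h.1, hvn i, hvn j⟩
  · rintro (u | k) (w | i) (y | j) h
    · exact D.pt_notMem_O _ _ _ h
    · exact D.pt_notMem_O _ _ _ h.2.1
    · exact D.pt_notMem_O _ _ _ h.2.1
    · exact D.pt_notMem_U _ _ h.2.2
    · exact ON h (mM k)
    · exact h.2.2 (mM k)
    · exact h.2.2 (mM k)
    · exact D.O_notMem_U _ (mO k) h.2.2
  · rintro (u | k) (_ | i) h
    · exact ptN u (Or.inl h)
    · exact D.pt_notMem_U _ _ h.1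
    · exact E.disjoint h (E.m_mem_M k)
    · exact D.O_notMem_U _ (mO k) h.1
  · rintro x (w | i) (y | j) (_ | l) h h'
    · exact ON h (Or.inl h')
    · exact D.O_notMem_U _ h h'.1
    · exact h.2.2 (Or.inl h')
    · exact D.O_notMem_U _ h.2.1 h'.1
    · exact h.2.2 (Or.inl h')
    · exact D.O_notMem_U _ h.2.1 h'.1
    · exact E.disjoint h' h.2.1
    · exact h'.2 (Or.inr h.2.1)
  · rintro x (_ | i) (_ | j) h h'
    · rfl
    · exact (h'.2 (Or.inl h)).elim
    · exact (h.2 (Or.inl h')).elim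
    · rw [D.U_inj h.1 h'.1]
  · have hll : ∀ {x} {u w : {u // u ≠ v}} {i}, x ∈ D.O u w → x ∉ D.O v (n i) := by
      intro x u w i h h'
      rcases Sym2.eq_iff.1 (D.O_inj h h') with ⟨e, -⟩ | ⟨-, e⟩
      · exact u.2 e
      · exact w.2 e
    have hlr : ∀ {x} {u w : {u // u ≠ v}} {i j}, u = n i → x ∈ D.O v (n i) → w = n j →
        x ∈ D.O v (n j) → u = w ∧ i = j := by
      intro x u w i j hu h hw h'
      have e := Sym2.congr_right.1 (D.O_inj h h')
      exact ⟨Subtype.ext (by rw [hu, hw, e]), hn e⟩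
    rintro x (u | i) (w | j) (u' | i') (w' | j') h h'
    · have := D.O_inj h h'
      simpa [Sym2.eq_iff, Subtype.ext_iff] using this
    · exact (hll h h'.2.1).elim
    · exact (hll h h'.2.1).elim
    · exact (D.O_notMem_U _ h h'.2.2).elim
    · exact (hll h' h.2.1).elim
    · obtain ⟨rfl, rfl⟩ := hlr h.1 h.2.1 h'.1 h'.2.1
      rfl
    · obtain ⟨rfl, rfl⟩ := hlr h.1 h.2.1 h'.1 h'.2.1
      exact Sym2.eq_swap
    · exact (D.O_notMem_U _ h.2.1 h'.2.2).elim
    · exact (hll h' h.2.1).elim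
    · obtain ⟨rfl, rfl⟩ := hlr h.1 h.2.1 h'.1 h'.2.1
      exact Sym2.eq_swap
    · obtain ⟨rfl, rfl⟩ := hlr h.1 h.2.1 h'.1 h'.2.1
      rfl
    · exact (D.O_notMem_U _ h.2.1 h'.2.2).elim
    · exact (D.O_notMem_U _ h' h.2.2).elim
    · exact (D.O_notMem_U _ h'.2.1 h.2.2).elim
    · exact (D.O_notMem_U _ h'.2.1 h.2.2).elim
    -- Two new edges with a common point lie in the same cell `f k`. The cells are distinct for
    -- distinct indices, and `k` determines the pair of corners.
    · have e := D.U_inj h.2.2 h'.2.2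
      have e' : -(i + j) = -(i' + j') := by
        by_contra hne
        have := adj_corner hf1 hf2 (Ne.symm hne)
        rw [e] at this
        exact not_adj_corner hn hf1 hf2 _ this
      rcases fin3_third_inj i j i' j' h.1 h'.1 e' with ⟨rfl, rfl⟩ | ⟨rfl, rfl⟩
      · rfl
      · exact Sym2.eq_swap
  · rintro (u | i) (w | j) h
    · exact D.isArc h
    · obtain ⟨h1, h2⟩ := h
      have := (E.isArc_O j).symm
      simp only [truncatePoint, truncateEdge, h1, true_and]
      exact this
    · obtain ⟨h1, h2⟩ := h
      have := E.isArc_O i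
      simp only [truncatePoint, truncateEdge, h1, true_and]
      exact this
    · have key : ∀ k, IsArc (D.truncateEdge E (.inr (k + 1)) (.inr (k + 2)))
          (E.m (k + 1)) (E.m (k + 2)) := by
        intro k
        convert E.isArc_U k using 1
        ext x
        simp only [truncateEdge, Set.mem_ofPred_eq, fin3_third_add]
        exact and_iff_right (fin3_add k).2.2.2.2.2.2
      have hsymm : ∀ a b, D.truncateEdge E (.inr a) (.inr b) =
          D.truncateEdge E (.inr b) (.inr a) := by
        intro a b
        ext x
        simp only [truncateEdge, Set.mem_ofPred_eq, add_comm a b, ne_comm (a := a)]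
      obtain ⟨k, ⟨rfl, rfl⟩ | ⟨rfl, rfl⟩⟩ := fin3_exists_add i j h.1
      · exact key k
      · rw [hsymm]
        exact (key k).symm

end StrongDrawing

/-! ### From strong drawings to strong embeddings -/

theorem vertexPoint_apply {W : Type*} [DecidableEq W] (v x : W) :
    vertexPoint v x = if x = v then 1 else 0 := by
  simp [vertexPoint, Pi.single_apply]

theorem vertexPoint_injective {W : Type*} : Function.Injective (vertexPoint (W := W)) := by
  classical
  intro u v h
  have := congrFun h u
  by_contra hne
  simp [vertexPoint_apply, hne] at this

theorem lineMap_vertexPoint_apply {W : Type*} [DecidableEq W] (u w x : W) (t : ℝ) :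
    AffineMap.lineMap (vertexPoint u) (vertexPoint w) t x =
      (1 - t) * (if x = u then 1 else 0) + t * (if x = w then 1 else 0) := by
  rw [AffineMap.lineMap_apply_module]
  simp [vertexPoint_apply]

theorem lineMap_vertexPoint_ne {W : Type*} {u w v : W} (huw : u ≠ w) {t : ℝ}
    (ht : t ∈ Set.Ioo (0 : ℝ) 1) :
    AffineMap.lineMap (vertexPoint u) (vertexPoint w) t ≠ vertexPoint v := by
  classical
  intro h
  have h1 := congrFun h u
  have h2 := congrFun h w
  obtain ⟨h3, h4⟩ := ht
  rw [lineMap_vertexPoint_apply, vertexPoint_apply] at h1 h2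
  simp only [huw, huw.symm, if_true, if_false] at h1 h2
  split_ifs at h1 <;> split_ifs at h2 <;> linarith

/-- An inner point of a segment has exactly two nonzero coordinates, at the end points, and their
values give the parameter. -/
theorem lineMap_vertexPoint_eq {W : Type*} {u w u' w' : W} (huw : u ≠ w) (huw' : u' ≠ w')
    {t t' : ℝ} (ht : t ∈ Set.Ioo (0 : ℝ) 1) (ht' : t' ∈ Set.Ioo (0 : ℝ) 1)
    (h : AffineMap.lineMap (vertexPoint u) (vertexPoint w) t =
      AffineMap.lineMap (vertexPoint u') (vertexPoint w') t') :
    (u = u' ∧ w = w' ∧ t = t') ∨ (u = w' ∧ w = u' ∧ t = 1 - t') := by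
  classical
  have h1 := congrFun h u
  have h2 := congrFun h w
  obtain ⟨h3, h4⟩ := ht
  obtain ⟨h5, h6⟩ := ht'
  rw [lineMap_vertexPoint_apply, lineMap_vertexPoint_apply] at h1 h2
  simp only [huw, huw.symm, if_true, if_false] at h1 h2
  by_cases e1 : u = u'
  · subst e1
    left
    simp only [huw', if_true, if_false, huw.symm] at h1 h2
    by_cases e2 : w = w'
    · exact ⟨rfl, e2, by linarith⟩
    · simp only [e2, if_false] at h2
      linarith
  · simp only [e1, if_false] at h1
    by_cases e2 : u = w'
    · subst e2
      right
      simp only [huw.symm, if_true, if_false] at h1 h2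
      by_cases e3 : w = u'
      · exact ⟨rfl, e3, by linarith⟩
      · simp only [e3, if_false] at h2
        linarith
    · simp only [e2, if_false] at h1
      linarith

theorem exists_circle_eq (z : ℂ) (hz : z ∈ Metric.sphere (0 : ℂ) 1) :
    ∃ θ ∈ Set.Ico (0 : ℝ) 1, Complex.exp (2 * Real.pi * θ * Complex.I) = z := by
  have hpi := Real.pi_pos
  have h1 : ‖z‖ = 1 := by simpa using hz
  have h2 : Complex.exp (Complex.arg z * Complex.I) = z := by
    have := Complex.norm_mul_exp_arg_mul_I z
    rwa [h1, Complex.ofReal_one, one_mul] at this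
  refine ⟨Int.fract (Complex.arg z / (2 * Real.pi)), ⟨Int.fract_nonneg _, Int.fract_lt_one _⟩, ?_⟩
  rw [← h2, Complex.exp_eq_exp_iff_exists_int]
  refine ⟨-⌊Complex.arg z / (2 * Real.pi)⌋, ?_⟩
  rw [h2, ← Int.self_sub_floor]
  have : (Real.pi : ℂ) ≠ 0 := by exact_mod_cast hpi.ne'
  push_cast
  field_simp
  ring

theorem circle_eq {θ θ' : ℝ} (hθ : θ ∈ Set.Icc (0 : ℝ) 1) (hθ' : θ' ∈ Set.Icc (0 : ℝ) 1)
    (h : Complex.exp (2 * Real.pi * θ * Complex.I) = Complex.exp (2 * Real.pi * θ' * Complex.I)) :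
    θ = θ' ∨ (θ = 0 ∧ θ' = 1) ∨ (θ = 1 ∧ θ' = 0) := by
  have hpi : (Real.pi : ℂ) ≠ 0 := by exact_mod_cast Real.pi_pos.ne'
  obtain ⟨n, hn⟩ := Complex.exp_eq_exp_iff_exists_int.1 h
  have h1 : (θ : ℂ) = θ' + n := by
    have h2 : (2 * Real.pi * Complex.I) * (θ : ℂ) = (2 * Real.pi * Complex.I) * (θ' + n) := by
      linear_combination hn
    exact mul_left_cancel₀ (by simp [hpi, Complex.I_ne_zero]) h2
  have h2 : θ = θ' + n := by exact_mod_cast h1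
  obtain ⟨h3, h4⟩ := hθ
  obtain ⟨h5, h6⟩ := hθ'
  have h7 : (-1 : ℝ) ≤ n := by linarith
  have h8 : (n : ℝ) ≤ 1 := by linarith
  have h9 : -1 ≤ n := by exact_mod_cast h7
  have h10 : n ≤ 1 := by exact_mod_cast h8
  obtain rfl | rfl | rfl : n = -1 ∨ n = 0 ∨ n = 1 := by omega
  · right; left
    push_cast at h2
    exact ⟨by linarith, by linarith⟩
  · left
    simpa using h2
  · right; right
    push_cast at h2
    exact ⟨by linarith, by linarith⟩

/-- The circle is the quotient of `[0, 1]` that identifies the end points, so a loop factors through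
it by `exists_factor`. -/
theorem exists_circle_map {S : Type*} [TopologicalSpace S] {F : ℝ → S}
    (hF : ContinuousOn F (Set.Icc 0 1)) (h01 : F 0 = F 1) (hi : Set.InjOn F (Set.Ico 0 1)) :
    ∃ h : ℂ → S, ContinuousOn h (Metric.sphere 0 1) ∧ Set.InjOn h (Metric.sphere 0 1) ∧
      h '' Metric.sphere 0 1 = F '' Set.Icc 0 1 ∧
      ∀ θ ∈ Set.Icc (0 : ℝ) 1, h (Complex.exp (2 * Real.pi * θ * Complex.I)) = F θ := by
  have : Nonempty S := ⟨F 0⟩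
  obtain ⟨h, hc, hh⟩ := exists_factor isCompact_Icc
    (π := fun θ : ℝ => Complex.exp (2 * Real.pi * θ * Complex.I)) (by fun_prop) hF (by
      intro θ hθ θ' hθ' e
      rcases circle_eq hθ hθ' e with rfl | ⟨rfl, rfl⟩ | ⟨rfl, rfl⟩
      · rfl
      · exact h01
      · exact h01.symm)
  have him : (fun θ : ℝ => Complex.exp (2 * Real.pi * θ * Complex.I)) '' Set.Icc 0 1 =
      Metric.sphere 0 1 := by
    ext z
    constructor
    · rintro ⟨θ, -, rfl⟩
      have := Complex.norm_exp_ofReal_mul_I (2 * Real.pi * θ)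
      push_cast at this
      simpa using this
    · intro hz
      obtain ⟨θ, hθ, e⟩ := exists_circle_eq z hz
      exact ⟨θ, ⟨hθ.1, hθ.2.le⟩, e⟩
  refine ⟨h, him ▸ hc, ?_, ?_, hh⟩
  · intro z hz w hw e
    obtain ⟨θ, hθ, rfl⟩ := exists_circle_eq z hz
    obtain ⟨θ', hθ', rfl⟩ := exists_circle_eq w hw
    rw [hh θ ⟨hθ.1, hθ.2.le⟩, hh θ' ⟨hθ'.1, hθ'.2.le⟩] at e
    rw [hi hθ hθ' e]
  · rw [← him, Set.image_image]
    exact Set.image_congr hh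

/-! ### Walks as unit-speed curves in the realization -/

section WalkPoint

variable {W : Type*} {G : SimpleGraph W} {u v : W}

/-- At `t = 1` the floor in `walkPoint` has already moved on to the next edge; both formulas give
the same vertex there. -/
theorem walkPoint_eq (w : G.Walk u v) {k : ℕ} {t : ℝ} (ht : t ∈ Set.Icc (0 : ℝ) 1) :
    (walkPoint w (k + t) : W → ℝ) =
      AffineMap.lineMap (vertexPoint (w.getVert k)) (vertexPoint (w.getVert (k + 1))) t := by
  rcases ht.2.lt_or_eq with h | rfl
  · have hf : ⌊(k : ℝ) + t⌋₊ = k := by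
      rw [Nat.floor_eq_iff (by linarith [ht.1, (Nat.cast_nonneg k : (0 : ℝ) ≤ k)])]
      constructor <;> linarith [ht.1]
    have hfr : Int.fract ((k : ℝ) + t) = t := by
      rw [Int.fract_natCast_add]
      exact Int.fract_eq_self.2 ⟨ht.1, h⟩
    simp only [walkPoint, hf, hfr]
  · have hf : ⌊(k : ℝ) + 1⌋₊ = k + 1 := by
      exact_mod_cast Nat.floor_natCast (R := ℝ) (k + 1)
    have hfr : Int.fract ((k : ℝ) + 1) = 0 := by
      exact_mod_cast Int.fract_natCast (R := ℝ) (k + 1)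
    simp only [walkPoint, hf, hfr, AffineMap.lineMap_apply_zero, AffineMap.lineMap_apply_one]

theorem walkPoint_natCast (w : G.Walk u v) (k : ℕ) :
    (walkPoint w k : W → ℝ) = vertexPoint (w.getVert k) := by
  have := walkPoint_eq w (k := k) (t := 0) (by simp)
  simpa using this

theorem continuousOn_walkPoint (w : G.Walk u v) (n : ℕ) :
    ContinuousOn (fun s => (walkPoint w s : W → ℝ)) (Set.Icc 0 n) := by
  induction n with
  | zero => simp
  | succ n ih =>
    rw [← Set.Icc_union_Icc_eq_Icc (Nat.cast_nonneg n) (by push_cast; linarith)]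
    refine ih.union_of_isClosed ?_ isClosed_Icc isClosed_Icc
    refine ContinuousOn.congr (f := fun s : ℝ => AffineMap.lineMap (vertexPoint (w.getVert n))
      (vertexPoint (w.getVert (n + 1))) (s - n)) ?_ ?_
    · refine Continuous.continuousOn ?_
      exact (AffineMap.lineMap_continuous).comp (by fun_prop)
    · intro s hs
      have := walkPoint_eq w (k := n) (t := s - n)
        ⟨by linarith [hs.1], by have := hs.2; push_cast at this; linarith⟩
      rw [add_sub_cancel] at this
      exact this

theorem exists_nat_add {n : ℕ} {s : ℝ} (hs : s ∈ Set.Ico (0 : ℝ) n) :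
    ∃ k < n, ∃ t ∈ Set.Ico (0 : ℝ) 1, s = k + t := by
  refine ⟨⌊s⌋₊, (Nat.floor_lt hs.1).2 hs.2, s - ⌊s⌋₊, ⟨?_, ?_⟩, by ring⟩
  · linarith [Nat.floor_le hs.1]
  · linarith [Nat.lt_floor_add_one s]

theorem injOn_walkPoint {w : G.Walk v v} (hw : w.IsCycle) :
    Set.InjOn (fun s => (walkPoint w s : W → ℝ)) (Set.Ico 0 w.length) := by
  have hn := hw.three_le_length
  have inj : ∀ {i j}, i < w.length → j < w.length → w.getVert i = w.getVert j → i = j :=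
    fun {i j} hi hj e => hw.getVert_injOn' (by simp only [Set.mem_ofPred_eq]; omega)
      (by simp only [Set.mem_ofPred_eq]; omega) e
  have hlast : w.getVert w.length = w.getVert 0 := by simp
  intro s hs s' hs' e
  obtain ⟨k, hk, t, ht, rfl⟩ := exists_nat_add hs
  obtain ⟨k', hk', t', ht', rfl⟩ := exists_nat_add hs'
  have adj := fun {k} (hk : k < w.length) => (w.adj_getVert_succ hk).ne
  simp only [walkPoint_eq w ⟨ht.1, ht.2.le⟩, walkPoint_eq w ⟨ht'.1, ht'.2.le⟩] at e
  rcases ht.1.eq_or_lt with rfl | h0 <;> rcases ht'.1.eq_or_lt with rfl | h0'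
  · rw [AffineMap.lineMap_apply_zero, AffineMap.lineMap_apply_zero] at e
    rw [inj hk hk' (vertexPoint_injective e)]
  · rw [AffineMap.lineMap_apply_zero] at e
    exact (lineMap_vertexPoint_ne (adj hk') ⟨h0', ht'.2⟩ e.symm).elim
  · rw [AffineMap.lineMap_apply_zero] at e
    exact (lineMap_vertexPoint_ne (adj hk) ⟨h0, ht.2⟩ e).elim
  · rcases lineMap_vertexPoint_eq (adj hk) (adj hk') ⟨h0, ht.2⟩ ⟨h0', ht'.2⟩ e with
      ⟨e1, -, rfl⟩ | ⟨e1, e2, -⟩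
    · rw [inj hk hk' e1]
    -- If the two steps traverse one edge in opposite directions, then `k = k' + 1` and `k' = k + 1`
    -- modulo the length, which would make the length a divisor of 2; a cycle has length at least 3.
    · exfalso
      rcases Nat.lt_or_ge (k' + 1) w.length with h | h
      · obtain rfl := inj hk h e1
        rcases Nat.lt_or_ge (k' + 1 + 1) w.length with h' | h'
        · have := inj h' hk' e2
          omega
        · have h2 : k' + 1 + 1 = w.length := by omega
          rw [h2, hlast] at e2
          have := inj (by omega) hk' e2
          omega
      · have h2 : k' + 1 = w.length := by omega
        rw [h2, hlast] at e1
        obtain rfl := inj hk (by omega) e1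
        have := inj (by omega) hk' e2
        omega

end WalkPoint

/-! ### The map from the realization given by a drawing -/

namespace StrongDrawing

variable {W : Type*} {G : SimpleGraph W} {S : Type*} [TopologicalSpace S] {ι : Type*}
  (D : StrongDrawing G S ι)

/-- The drawing of the graph as a map on its realization. -/
theorem exists_map [Finite W] [Nonempty S] : ∃ g : (W → ℝ) → S, ContinuousOn g (realization G) ∧
    Set.InjOn g (realization G) ∧ (∀ u, g (vertexPoint u) = D.pt u) ∧
    ∀ u w, G.Adj u w → (fun t : ℝ => g (AffineMap.lineMap (vertexPoint u) (vertexPoint w) t)) ''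
      Set.Ioo 0 1 = D.O u w := by
  classical
  -- An arbitrary order selects one orientation, and so one parametrization, for each edge. The
  -- diagonal pairs in `A` supply the vertices, including any isolated ones.
  let _ : LinearOrder W := LinearOrder.lift' (Finite.equivFin W) (Finite.equivFin W).injective
  let A := {p : W × W // p.1 = p.2 ∨ (G.Adj p.1 p.2 ∧ p.1 < p.2)}
  have hA : ∀ a : A, ∃ γ : ℝ → S, ContinuousOn γ (Set.Icc 0 1) ∧ γ 0 = D.pt a.1.1 ∧
      γ 1 = D.pt a.1.2 ∧ (a.1.1 = a.1.2 → ∀ t, γ t = D.pt a.1.1) ∧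
      (a.1.1 ≠ a.1.2 → Set.InjOn γ (Set.Icc 0 1) ∧ γ '' Set.Ioo 0 1 = D.O a.1.1 a.1.2) := by
    rintro ⟨⟨u, w⟩, h⟩
    by_cases huw : u = w
    · subst huw
      exact ⟨fun _ => D.pt u, continuousOn_const, rfl, rfl, fun _ _ => rfl, fun h => (h rfl).elim⟩
    · obtain ⟨γ, h1, h2, h3, h4, h5⟩ := D.isArc (h.resolve_left huw).1
      exact ⟨γ, h1, h3, h4, fun h => (huw h).elim, fun _ => ⟨h2, h5⟩⟩
  choose γ γc γ0 γ1 γe γn using hA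
  let π : (Σ _ : A, unitInterval) → W → ℝ := fun p =>
    AffineMap.lineMap (vertexPoint p.1.1.1) (vertexPoint p.1.1.2) (p.2 : ℝ)
  let F : (Σ _ : A, unitInterval) → S := fun p => γ p.1 p.2
  have πc : Continuous π := by
    refine continuous_sigma fun a => ?_
    have h : Continuous fun t : ℝ =>
        AffineMap.lineMap (k := ℝ) (vertexPoint a.1.1) (vertexPoint a.1.2) t :=
      AffineMap.lineMap_continuous
    exact h.comp continuous_subtype_val
  have Fc : Continuous F := by
    refine continuous_sigma fun a => ?_
    exact continuousOn_iff_continuous_domRestrict.1 (γc a)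
  have cases : ∀ p, (∃ u, π p = vertexPoint u ∧ F p = D.pt u) ∨
      (p.1.1.1 ≠ p.1.1.2 ∧ (p.2 : ℝ) ∈ Set.Ioo (0 : ℝ) 1 ∧ F p ∈ D.O p.1.1.1 p.1.1.2) := by
    rintro ⟨a, t, ht⟩
    by_cases h : a.1.1 = a.1.2
    · left
      refine ⟨a.1.1, ?_, γe a h t⟩
      simp only [π, ← h, AffineMap.lineMap_same, AffineMap.const_apply]
    · rcases ht.1.eq_or_lt with rfl | h0
      · exact Or.inl ⟨a.1.1, by simp [π], γ0 a⟩
      · rcases ht.2.eq_or_lt with rfl | h1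
        · exact Or.inl ⟨a.1.2, by simp [π], γ1 a⟩
        · refine Or.inr ⟨h, ⟨h0, h1⟩, ?_⟩
          rw [← (γn a h).2]
          exact ⟨t, ⟨h0, h1⟩, rfl⟩
  have ord : ∀ a b : A, a.1.1 ≠ a.1.2 → b.1.1 ≠ b.1.2 → s(a.1.1, a.1.2) = s(b.1.1, b.1.2) →
      a = b := by
    intro a b ha hb e
    have h1 := (a.2.resolve_left ha).2
    have h2 := (b.2.resolve_left hb).2
    rcases Sym2.eq_iff.1 e with ⟨h3, h4⟩ | ⟨h3, h4⟩
    · exact Subtype.ext (Prod.ext h3 h4)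
    · rw [h3, h4] at h1
      exact (lt_asymm h1 h2).elim
  -- The vertices and parametrized edges are mapped to the realization by `π` and to the surface by
  -- `F`. Both maps make the same identifications: one direction lets `F` factor through `π`, the
  -- other makes the resulting map injective.
  have iff : ∀ p q, π p = π q ↔ F p = F q := by
    intro p q
    rcases cases p with ⟨u, h1, h2⟩ | ⟨h1, h2, h3⟩ <;>
      rcases cases q with ⟨u', h1', h2'⟩ | ⟨h1', h2', h3'⟩
    · rw [h1, h2, h1', h2', vertexPoint_injective.eq_iff, D.pt_inj.eq_iff]
    · refine iff_of_false (fun e => lineMap_vertexPoint_ne h1' h2' (e.symm.trans h1)) fun e => ?_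
      rw [← e, h2] at h3'
      exact D.pt_notMem_O _ _ _ h3'
    · refine iff_of_false (fun e => lineMap_vertexPoint_ne h1 h2 (e.trans h1')) fun e => ?_
      rw [e, h2'] at h3
      exact D.pt_notMem_O _ _ _ h3
    · obtain ⟨a, t⟩ := p
      obtain ⟨b, t'⟩ := q
      constructor
      · intro e
        have hs := lineMap_vertexPoint_eq h1 h1' h2 h2' e
        have : a = b := ord a b h1 h1' (by
          rcases hs with ⟨h, h', -⟩ | ⟨h, h', -⟩
          · simp only at h h'
            rw [h, h']
          · simp only at h h'
            rw [h, h', Sym2.eq_swap])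
        subst this
        rcases hs with ⟨-, -, h⟩ | ⟨h, -, -⟩
        · obtain rfl : t = t' := Subtype.ext h
          rfl
        · exact (h1 h).elim
      · intro e
        rw [← e] at h3'
        have := ord a b h1 h1' (D.O_inj h3 h3')
        subst this
        have := (γn a h1).1 t.2 t'.2 e
        obtain rfl : t = t' := Subtype.ext this
        rfl
  obtain ⟨g, gc, hg⟩ := exists_factor (isCompact_univ (X := Σ _ : A, unitInterval))
    πc.continuousOn Fc.continuousOn fun p _ q _ => (iff p q).1
  have hg' : ∀ p, g (π p) = F p := fun p => hg p trivial
  have him : π '' Set.univ = realization G := by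
    ext x
    constructor
    · rintro ⟨⟨a, t⟩, -, rfl⟩
      refine ⟨a.1.1, a.1.2, a.2.imp id fun h => h.1, ?_⟩
      rw [segment_eq_image_lineMap]
      exact ⟨t, t.2, rfl⟩
    · rintro ⟨u, w, h, hx⟩
      have main : ∀ u w, (u = w ∨ G.Adj u w ∧ u < w) →
          x ∈ segment ℝ (vertexPoint u) (vertexPoint w) → x ∈ π '' Set.univ := by
        intro u w h hx
        rw [segment_eq_image_lineMap] at hx
        obtain ⟨t, ht, rfl⟩ := hx
        exact ⟨⟨⟨(u, w), h⟩, ⟨t, ht⟩⟩, trivial, rfl⟩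
      rcases lt_trichotomy u w with h' | h' | h'
      · exact main u w (h.imp id fun h => ⟨h, h'⟩) hx
      · exact main u w (Or.inl h') hx
      · rw [segment_symm] at hx
        exact main w u (Or.inr ⟨(h.resolve_left h'.ne').symm, h'⟩) hx
  refine ⟨g, him ▸ gc, ?_, ?_, ?_⟩
  · rw [← him]
    rintro _ ⟨p, -, rfl⟩ _ ⟨q, -, rfl⟩ e
    rw [hg', hg'] at e
    exact (iff p q).2 e
  · intro u
    have h1 := hg' ⟨⟨(u, u), Or.inl rfl⟩, 0⟩
    have h2 : F ⟨⟨(u, u), Or.inl rfl⟩, 0⟩ = D.pt u := γ0 _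
    rw [h2] at h1
    simpa [π] using h1
  · have main : ∀ u w (h : G.Adj u w ∧ u < w),
        (fun t : ℝ => g (AffineMap.lineMap (vertexPoint u) (vertexPoint w) t)) '' Set.Ioo 0 1 =
          D.O u w := by
      intro u w h
      rw [← (γn ⟨(u, w), Or.inr h⟩ h.1.ne).2]
      refine Set.image_congr fun t ht => ?_
      exact hg' ⟨⟨(u, w), Or.inr h⟩, ⟨t, ht.1.le, ht.2.le⟩⟩
    intro u w h
    rcases lt_trichotomy u w with h' | h' | h'
    · exact main u w ⟨h, h'⟩
    · exact (h.ne h').elim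
    · rw [D.O_symm, ← main w u ⟨h.symm, h'⟩]
      ext x
      constructor
      · rintro ⟨t, ht, rfl⟩
        refine ⟨1 - t, ⟨by linarith [ht.2], by linarith [ht.1]⟩, ?_⟩
        simp only [AffineMap.lineMap_apply_one_sub]
      · rintro ⟨t, ht, rfl⟩
        refine ⟨1 - t, ⟨by linarith [ht.2], by linarith [ht.1]⟩, ?_⟩
        simp only [AffineMap.lineMap_apply_one_sub]

end StrongDrawing

namespace StrongDrawing

variable {W : Type*} {G : SimpleGraph W} {S : Type*} [TopologicalSpace S] {ι : Type*}
  (D : StrongDrawing G S ι)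

/-- The boundary of a cell is parametrized by a cycle with constant speed. -/
theorem exists_boundary_map {g : (W → ℝ) → S} (gc : ContinuousOn g (realization G))
    (gi : Set.InjOn g (realization G)) (gpt : ∀ u, g (vertexPoint u) = D.pt u)
    (gO : ∀ u w, G.Adj u w →
      (fun t : ℝ => g (AffineMap.lineMap (vertexPoint u) (vertexPoint w) t)) ''
      Set.Ioo 0 1 = D.O u w) (i : ι) :
    ∃ (v : W) (w : G.Walk v v) (h : ℂ → S), w.IsCycle ∧
      ContinuousOn h (Metric.sphere 0 1) ∧ Set.InjOn h (Metric.sphere 0 1) ∧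
      h '' Metric.sphere 0 1 = D.J i ∧ ∀ θ ∈ Set.Icc (0 : ℝ) 1,
        h (Complex.exp (2 * Real.pi * θ * Complex.I)) = g (walkPoint w (θ * w.length)) := by
  obtain ⟨v, w, hw, hC⟩ := D.isCycle i
  have hlen : (0 : ℝ) < w.length := by
    have := hw.three_le_length
    exact_mod_cast (by omega : 0 < w.length)
  have hm : Set.MapsTo (fun θ : ℝ => θ * w.length) (Set.Icc 0 1) (Set.Icc 0 w.length) := by
    intro θ hθ
    exact ⟨mul_nonneg hθ.1 hlen.le, by nlinarith [hθ.2]⟩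
  have hm' : Set.MapsTo (fun θ : ℝ => θ * w.length) (Set.Ico 0 1) (Set.Ico 0 w.length) := by
    intro θ hθ
    exact ⟨mul_nonneg hθ.1 hlen.le, by nlinarith [hθ.2]⟩
  obtain ⟨h, hc, hi, him, hh⟩ := exists_circle_map
    (F := fun θ : ℝ => g (walkPoint w (θ * w.length)))
    (gc.comp ((continuousOn_walkPoint w w.length).comp (by fun_prop) hm)
      fun θ _ => (walkPoint w _).2)
    (by
      have h0 := walkPoint_natCast w 0
      have h1 := walkPoint_natCast w w.length
      simp only [Nat.cast_zero, SimpleGraph.Walk.getVert_zero,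
        SimpleGraph.Walk.getVert_length] at h0 h1
      simp only [zero_mul, one_mul, h0, h1])
    (by
      intro θ hθ θ' hθ' e
      have := injOn_walkPoint hw (hm' hθ) (hm' hθ')
        (gi (walkPoint w _).2 (walkPoint w _).2 e)
      exact mul_right_cancel₀ hlen.ne' this)
  refine ⟨v, w, h, hw, hc, hi, him.trans ?_, hh⟩
  have step : ∀ x, x ∈ (fun θ : ℝ => g (walkPoint w (θ * w.length))) '' Set.Icc 0 1 ↔
      ∃ k < w.length, ∃ t ∈ Set.Icc (0 : ℝ) 1, x = g (AffineMap.lineMap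
        (vertexPoint (w.getVert k)) (vertexPoint (w.getVert (k + 1))) t) := by
    intro x
    constructor
    · rintro ⟨θ, hθ, rfl⟩
      rcases hθ.2.lt_or_eq with h1 | rfl
      · obtain ⟨k, hk, t, ht, e⟩ := exists_nat_add (hm' ⟨hθ.1, h1⟩)
        refine ⟨k, hk, t, ⟨ht.1, ht.2.le⟩, ?_⟩
        simp only at e ⊢
        rw [e, walkPoint_eq w ⟨ht.1, ht.2.le⟩]
      · have hpos : 0 < w.length := by exact_mod_cast hlen
        -- The end of the traversal is taken as the end of the last edge, since the walk has no edge
        -- with index `w.length`.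
        refine ⟨w.length - 1, by omega, 1, by simp, ?_⟩
        have : w.length - 1 + 1 = w.length := by omega
        simp only [one_mul, walkPoint_natCast, this, AffineMap.lineMap_apply_one]
    · rintro ⟨k, hk, t, ht, rfl⟩
      have hk' : (k : ℝ) + 1 ≤ w.length := by exact_mod_cast hk
      refine ⟨(k + t) / w.length, ⟨div_nonneg (add_nonneg (Nat.cast_nonneg k) ht.1) hlen.le,
        (div_le_one hlen).2 (by linarith [ht.2])⟩, ?_⟩
      simp only
      rw [div_mul_cancel₀ _ hlen.ne', walkPoint_eq w ht]
  ext x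
  rw [step]
  constructor
  · rintro ⟨k, hk, t, ht, rfl⟩
    have hadj := w.adj_getVert_succ hk
    have hCadj : (D.C i).Adj (w.getVert k) (w.getVert (k + 1)) :=
      (hC _ _).1 (w.mk_mem_edges_iff_exists.2 ⟨k, hk, rfl⟩)
    rcases ht.1.eq_or_lt with rfl | h0
    · rw [AffineMap.lineMap_apply_zero, gpt]
      exact ⟨_, _, hCadj, Or.inl rfl⟩
    · rcases ht.2.eq_or_lt with rfl | h1
      · rw [AffineMap.lineMap_apply_one, gpt]
        exact ⟨_, _, hCadj.symm, Or.inl rfl⟩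
      · exact ⟨_, _, hCadj, Or.inr (gO _ _ hadj ▸ ⟨t, ⟨h0, h1⟩, rfl⟩)⟩
  · have main : ∀ k < w.length, x = D.pt (w.getVert k) ∨ x = D.pt (w.getVert (k + 1)) ∨
        x ∈ D.O (w.getVert k) (w.getVert (k + 1)) → ∃ k < w.length, ∃ t ∈ Set.Icc (0 : ℝ) 1,
        x = g (AffineMap.lineMap (vertexPoint (w.getVert k))
          (vertexPoint (w.getVert (k + 1))) t) := by
      rintro k hk (rfl | rfl | hx)
      · exact ⟨k, hk, 0, by simp, by rw [AffineMap.lineMap_apply_zero, gpt]⟩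
      · exact ⟨k, hk, 1, by simp, by rw [AffineMap.lineMap_apply_one, gpt]⟩
      · rw [← gO _ _ (w.adj_getVert_succ hk)] at hx
        obtain ⟨t, ht, rfl⟩ := hx
        exact ⟨k, hk, t, ⟨ht.1.le, ht.2.le⟩, rfl⟩
    rintro ⟨a, b, hab, hx⟩
    obtain ⟨k, hk, e⟩ := w.mk_mem_edges_iff_exists.1 ((hC a b).2 hab)
    rcases Sym2.eq_iff.1 e with ⟨e1, e2⟩ | ⟨e1, e2⟩
    · refine main k hk ?_
      rw [e1, e2]
      rcases hx with hx | hx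
      · exact Or.inl hx
      · exact Or.inr (Or.inr hx)
    · refine main k hk ?_
      rw [e1, e2]
      rcases hx with hx | hx
      · exact Or.inr (Or.inl hx)
      · exact Or.inr (Or.inr (D.O_symm _ _ ▸ hx))

/-- The cells of a drawing are the connected components of the complement of the graph. -/
theorem connectedComponentIn_eq [T2Space S] [Finite ι] {i : ι} {x : S} (hx : x ∈ D.U i) :
    connectedComponentIn (⋃ j, D.U j) x = D.U i := by
  have hJ : ∀ {y}, y ∈ ⋃ j, D.U j → ∀ j, y ∉ D.J j := by
    intro y hy j
    obtain ⟨l, hl⟩ := Set.mem_iUnion.1 hy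
    exact D.notMem_J hl j
  have hcl : ∀ j, IsClosed (D.U j ∪ D.J j) := fun j => (D.isDisc j).isCompact.isClosed
  apply Set.Subset.antisymm
  · intro y hy
    have hsub := connectedComponentIn_subset (⋃ j, D.U j) x
    by_contra hyi
    have hpre := isPreconnected_connectedComponentIn (F := ⋃ j, D.U j) (x := x)
    rw [isPreconnected_closed_iff] at hpre
    have hxc : x ∈ connectedComponentIn (⋃ j, D.U j) x :=
      mem_connectedComponentIn (Set.mem_iUnion.2 ⟨i, hx⟩)
    obtain ⟨l, hl⟩ := Set.mem_iUnion.1 (hsub hy)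
    have hli : l ≠ i := fun e => hyi (e ▸ hl)
    -- The closed cell `i` and the finite union of the other closed cells are closed sets covering
    -- the component. They could meet only on boundary circles, which lie outside the union of the
    -- open cells.
    obtain ⟨z, hz, hz1, hz2⟩ := hpre (D.U i ∪ D.J i) (⋃ j : {j // j ≠ i}, (D.U j ∪ D.J j)) (hcl i)
      (isClosed_iUnion_of_finite fun j => hcl j) (by
        intro z hz
        obtain ⟨l, hl⟩ := Set.mem_iUnion.1 (hsub hz)
        by_cases h : l = i
        · exact Or.inl (Or.inl (h ▸ hl))
        · exact Or.inr (Set.mem_iUnion.2 ⟨⟨l, h⟩, Or.inl hl⟩))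
      ⟨x, hxc, Or.inl hx⟩ ⟨y, hy, Set.mem_iUnion.2 ⟨⟨l, hli⟩, Or.inl hl⟩⟩
    obtain ⟨⟨j, hj⟩, hzj⟩ := Set.mem_iUnion.1 hz2
    have h1 := hz1.resolve_right (hJ (hsub hz) i)
    have h2 := hzj.resolve_right (hJ (hsub hz) j)
    exact hj (D.U_inj h2 h1)
  · refine IsPreconnected.subset_connectedComponentIn ?_ hx (Set.subset_iUnion _ i)
    obtain ⟨ψ, ψc, -, ψU, -⟩ := D.isDisc i
    rw [← ψU]
    exact ((convex_ball (0 : ℂ) 1).isPreconnected).image _ (ψc.mono Metric.ball_subset_closedBall)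

theorem _root_.IsClosedDisc.nonempty_homeomorph [T2Space S] {U J : Set S} (h : IsClosedDisc U J) :
    Nonempty (U ≃ₜ Metric.ball (0 : ℂ) 1) := by
  obtain ⟨ψ, ψc, ψi, rfl, -⟩ := h
  obtain ⟨χ, χc, hχ⟩ := exists_continuousOn_leftInverse (isCompact_closedBall 0 1) ψc ψi
  have hb : Metric.ball (0 : ℂ) 1 ⊆ Metric.closedBall 0 1 := Metric.ball_subset_closedBall
  refine ⟨⟨⟨fun x => ⟨χ x, ?_⟩, fun z => ⟨ψ z, Set.mem_image_of_mem _ z.2⟩, ?_, ?_⟩, ?_, ?_⟩⟩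
  · obtain ⟨_, z, hz, rfl⟩ := x
    rw [hχ z (hb hz)]
    exact hz
  · rintro ⟨_, z, hz, rfl⟩
    simp only [hχ z (hb hz)]
  · rintro ⟨z, hz⟩
    simp only [hχ z (hb hz)]
  · refine Continuous.subtype_mk ?_ _
    exact continuousOn_iff_continuous_domRestrict.1 (χc.mono (Set.image_mono hb))
  · refine Continuous.subtype_mk ?_ _
    exact continuousOn_iff_continuous_domRestrict.1 (ψc.mono hb)

/-- A strong drawing yields a strong embedding. -/
theorem exists_isStrongEmbedding [Finite W] [Finite ι] [T2Space S] [Nonempty S]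
    (D : StrongDrawing G S ι) :
    ∃ β : C(realization G, S), IsStrongEmbedding β := by
  obtain ⟨g, gc, gi, gpt, gO⟩ := D.exists_map
  let β : C(realization G, S) := ⟨fun x => g x, continuousOn_iff_continuous_domRestrict.1 gc⟩
  have hpt : ∀ u, vertexPoint u ∈ realization G := fun u =>
    ⟨u, u, Or.inl rfl, left_mem_segment ℝ _ _⟩
  have hseg : ∀ {u w}, G.Adj u w → ∀ t ∈ Set.Icc (0 : ℝ) 1,
      AffineMap.lineMap (vertexPoint u) (vertexPoint w) t ∈ realization G := by
    intro u w h t ht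
    refine ⟨u, w, Or.inr h, ?_⟩
    rw [segment_eq_image_lineMap]
    exact ⟨t, ht, rfl⟩
  have hcompl : (Set.range β)ᶜ = ⋃ i, D.U i := by
    ext x
    rw [Set.mem_compl_iff, Set.mem_iUnion]
    constructor
    · intro hx
      rcases D.cover x with ⟨u, rfl⟩ | ⟨u, w, h, hxO⟩ | h
      · exact (hx ⟨⟨_, hpt u⟩, gpt u⟩).elim
      · rw [← gO u w h] at hxO
        obtain ⟨t, ht, rfl⟩ := hxO
        exact (hx ⟨⟨_, hseg h t ⟨ht.1.le, ht.2.le⟩⟩, rfl⟩).elim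
      · exact h
    · rintro ⟨i, hi⟩ ⟨⟨y, hy⟩, rfl⟩
      change g y ∈ D.U i at hi
      obtain ⟨u, w, h, hseg⟩ := hy
      rcases h with rfl | h
      · rw [segment_same, Set.mem_singleton_iff] at hseg
        rw [hseg, gpt] at hi
        exact D.pt_notMem_U _ _ hi
      · rw [segment_eq_image_lineMap] at hseg
        obtain ⟨t, ht, rfl⟩ := hseg
        rcases ht.1.eq_or_lt with rfl | h0
        · rw [AffineMap.lineMap_apply_zero, gpt] at hi
          exact D.pt_notMem_U _ _ hi
        · rcases ht.2.eq_or_lt with rfl | h1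
          · rw [AffineMap.lineMap_apply_one, gpt] at hi
            exact D.pt_notMem_U _ _ hi
          · refine D.O_notMem_U (u := u) (w := w) i ?_ hi
            rw [← gO u w h]
            exact ⟨t, ⟨h0, h1⟩, rfl⟩
  have hcells : ∀ c ∈ cells β, ∃ i, c = D.U i := by
    rintro c ⟨x, hx, rfl⟩
    rw [hcompl] at hx ⊢
    obtain ⟨i, hi⟩ := Set.mem_iUnion.1 hx
    exact ⟨i, D.connectedComponentIn_eq hi⟩
  refine ⟨β, ⟨?_, ?_⟩, ?_⟩
  · rintro ⟨x, hx⟩ ⟨y, hy⟩ e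
    exact Subtype.ext (gi hx hy e)
  · intro c hc
    obtain ⟨i, rfl⟩ := hcells c hc
    exact (D.isDisc i).nonempty_homeomorph
  · intro c hc
    obtain ⟨i, rfl⟩ := hcells c hc
    obtain ⟨v, w, h, hw, hc, hi, hJ, hh⟩ := D.exists_boundary_map gc gi gpt gO i
    -- Extending the constant-speed traversal of the bounding cycle over the disc gives the map
    -- required by `IsFacialWalk`.
    obtain ⟨Ψ, Ψc, Ψi, Ψe, ΨU⟩ := (D.isDisc i).exists_extension_ball hc hi hJ
    refine ⟨v, w, ⟨Ψ, Ψc, ?_, fun θ hθ => ?_⟩, hw⟩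
    · rw [← ΨU]
      exact (Ψi.mono Metric.ball_subset_closedBall).bijOn_image
    · rw [Ψe ?_, hh θ hθ]
      · rfl
      · have := Complex.norm_exp_ofReal_mul_I (2 * Real.pi * θ)
        push_cast at this
        simpa using this

end StrongDrawing

/-! ### The Klein bottle -/

/-- The projection of the plane onto the Klein bottle by way of the unit square. -/
noncomputable def kleinMk (x y : ℝ) : KleinBottle :=
  Quot.mk _ (Set.projIcc 0 1 zero_le_one x, Set.projIcc 0 1 zero_le_one y)

theorem continuous_kleinMk : Continuous fun p : ℝ × ℝ => kleinMk p.1 p.2 := by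
  refine continuous_quot_mk.comp ?_
  exact ((continuous_projIcc).comp continuous_fst).prodMk (continuous_projIcc.comp continuous_snd)

theorem kleinMk_eq {x y : ℝ} (hx : x ∈ Set.Icc (0 : ℝ) 1) (hy : y ∈ Set.Icc (0 : ℝ) 1) :
    kleinMk x y = Quot.mk _ (⟨x, hx⟩, ⟨y, hy⟩) := by
  rw [kleinMk, Set.projIcc_of_mem _ hx, Set.projIcc_of_mem _ hy]

theorem exists_kleinMk_eq (s : KleinBottle) :
    ∃ x ∈ Set.Icc (0 : ℝ) 1, ∃ y ∈ Set.Icc (0 : ℝ) 1, kleinMk x y = s := by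
  obtain ⟨⟨x, y⟩, rfl⟩ := Quot.exists_rep s
  exact ⟨x, x.2, y, y.2, kleinMk_eq x.2 y.2⟩

theorem kleinMk_glue {x : ℝ} (hx : x ∈ Set.Icc (0 : ℝ) 1) : kleinMk x 0 = kleinMk x 1 := by
  rw [kleinMk_eq hx ⟨le_rfl, zero_le_one⟩, kleinMk_eq hx ⟨zero_le_one, le_rfl⟩]
  exact Quot.sound (KleinRel.glue ⟨x, hx⟩)

theorem kleinMk_flip {y : ℝ} (hy : y ∈ Set.Icc (0 : ℝ) 1) : kleinMk 0 y = kleinMk 1 (1 - y) := by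
  rw [kleinMk_eq ⟨le_rfl, zero_le_one⟩ hy,
    kleinMk_eq ⟨zero_le_one, le_rfl⟩ ⟨by linarith [hy.2], by linarith [hy.1]⟩]
  exact Quot.sound (KleinRel.flip ⟨y, hy⟩)

/-- The coordinates in `[0, 1) × [0, 1)` of a point of the Klein bottle. -/
noncomputable def kleinCoord : KleinBottle → ℝ × ℝ :=
  Quot.lift (fun p => if (p.1 : ℝ) = 1 then (0, if (p.2 : ℝ) = 0 then 0 else 1 - (p.2 : ℝ)) else
    ((p.1 : ℝ), if (p.2 : ℝ) = 1 then 0 else (p.2 : ℝ))) (by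
    rintro _ _ (x | y)
    · simp
    · by_cases h : (y : ℝ) = 1
      · simp [h]
      · have h' : 1 - (y : ℝ) ≠ 0 := fun e => h (by linarith)
        simp [h, h'])

theorem kleinCoord_kleinMk {x y : ℝ} (hx : x ∈ Set.Icc (0 : ℝ) 1) (hy : y ∈ Set.Icc (0 : ℝ) 1) :
    kleinCoord (kleinMk x y) = if x = 1 then (0, if y = 0 then 0 else 1 - y) else
      (x, if y = 1 then 0 else y) := by
  rw [kleinMk_eq hx hy]
  rfl

theorem kleinCoord_mem (s : KleinBottle) : (kleinCoord s).1 ∈ Set.Ico (0 : ℝ) 1 ∧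
    (kleinCoord s).2 ∈ Set.Ico (0 : ℝ) 1 := by
  obtain ⟨x, ⟨hx0, hx1⟩, y, ⟨hy0, hy1⟩, rfl⟩ := exists_kleinMk_eq s
  rw [kleinCoord_kleinMk ⟨hx0, hx1⟩ ⟨hy0, hy1⟩]
  simp only [Set.mem_Ico]
  split_ifs with h1 h2 h2
  · simp
  · have := lt_of_le_of_ne hy0 (Ne.symm h2)
    refine ⟨⟨le_rfl, zero_lt_one⟩, ?_, ?_⟩ <;> simp only <;> linarith
  · exact ⟨⟨hx0, lt_of_le_of_ne hx1 h1⟩, le_rfl, zero_lt_one⟩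
  · exact ⟨⟨hx0, lt_of_le_of_ne hx1 h1⟩, hy0, lt_of_le_of_ne hy1 h2⟩

theorem kleinMk_kleinCoord (s : KleinBottle) :
    kleinMk (kleinCoord s).1 (kleinCoord s).2 = s := by
  obtain ⟨x, hx, y, hy, rfl⟩ := exists_kleinMk_eq s
  have h01 : (0 : ℝ) ∈ Set.Icc (0 : ℝ) 1 := ⟨le_rfl, zero_le_one⟩
  rw [kleinCoord_kleinMk hx hy]
  split_ifs with h1 h2 h2
  · subst h1 h2
    rw [kleinMk_glue h01, kleinMk_flip ⟨zero_le_one, le_rfl⟩, sub_self]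
  · subst h1
    simp only
    rw [kleinMk_flip ⟨by linarith [hy.2], by linarith [hy.1]⟩, sub_sub_cancel]
  · subst h2
    exact kleinMk_glue hx
  · rfl

theorem kleinCoord_injective : Function.Injective kleinCoord := by
  intro s t h
  rw [← kleinMk_kleinCoord s, h, kleinMk_kleinCoord]

instance : Nonempty KleinBottle := ⟨kleinMk 0 0⟩

/-- An embedding of the Klein bottle in a Euclidean space. -/
noncomputable def kleinEmbedding : KleinBottle → ℝ × ℝ × ℝ × ℝ × ℝ :=
  Quot.lift (fun p => ((p.1 : ℝ) * (1 - p.1), (p.1 : ℝ) * (1 - p.1) * (1 - 2 * p.1),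
    (p.2 : ℝ) * (1 - p.2), (1 - 2 * (p.1 : ℝ)) * ((p.2 : ℝ) * (1 - p.2) * (1 - 2 * p.2)),
    (p.1 : ℝ) * (1 - p.1) * ((p.2 : ℝ) * (1 - p.2) * (1 - 2 * p.2)))) (by
    rintro _ _ (x | y)
    · simp
    · simp
      constructor <;> ring)

theorem continuous_kleinEmbedding : Continuous kleinEmbedding := by
  refine continuous_quot_lift _ ?_
  fun_prop

theorem kleinEmbedding_kleinMk {x y : ℝ} (hx : x ∈ Set.Icc (0 : ℝ) 1)
    (hy : y ∈ Set.Icc (0 : ℝ) 1) : kleinEmbedding (kleinMk x y) =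
      (x * (1 - x), x * (1 - x) * (1 - 2 * x), y * (1 - y),
        (1 - 2 * x) * (y * (1 - y) * (1 - 2 * y)),
        x * (1 - x) * (y * (1 - y) * (1 - 2 * y))) := by
  rw [kleinMk_eq hx hy]
  rfl

/-- On `[0, 1)`, the first two components determine `x`. The third determines `y` up to `y ↦ 1 - y`,
and the last two contain `y * (1 - y) * (1 - 2 * y)`, which changes sign under this reflection, with
the factors `1 - 2 * x` and `x * (1 - x)`; these never vanish together. The embedding shows that the
Klein bottle is Hausdorff. -/
theorem kleinEmbedding_injective : Function.Injective kleinEmbedding := by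
  intro s t h
  apply kleinCoord_injective
  obtain ⟨⟨hx0, hx1⟩, hy0, hy1⟩ := kleinCoord_mem s
  obtain ⟨⟨hx0', hx1'⟩, hy0', hy1'⟩ := kleinCoord_mem t
  rw [← kleinMk_kleinCoord s, ← kleinMk_kleinCoord t, kleinEmbedding_kleinMk ⟨hx0, hx1.le⟩
    ⟨hy0, hy1.le⟩, kleinEmbedding_kleinMk ⟨hx0', hx1'.le⟩ ⟨hy0', hy1'.le⟩] at h
  generalize kleinCoord s = p at *
  generalize kleinCoord t = q at *
  obtain ⟨x, y⟩ := p
  obtain ⟨x', y'⟩ := q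
  simp only [Prod.mk.injEq] at *
  obtain ⟨hA, hB, hC, hD, hE⟩ := h
  have hx : x = x' := by
    by_contra hne
    have h1 : x + x' = 1 := by
      have : (x - x') * (1 - x - x') = 0 := by linear_combination hA
      rcases mul_eq_zero.1 this with h | h
      · exact (hne (by linarith)).elim
      · linarith
    have h2 : (x * (1 - x)) * (x' - x) = 0 := by
      linear_combination (1 / 2) * hB - (1 / 2) * (1 - 2 * x') * hA
    have hx : 0 < x := by linarith
    have : 0 < x * (1 - x) := mul_pos hx (by linarith)
    rcases mul_eq_zero.1 h2 with h | h
    · exact this.ne' h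
    · exact hne (by linarith)
  subst hx
  refine ⟨rfl, ?_⟩
  by_contra hne
  have h1 : y' = 1 - y := by
    have : (y - y') * (1 - y - y') = 0 := by linear_combination hC
    rcases mul_eq_zero.1 this with h | h
    · exact (hne (by linarith)).elim
    · linarith
  subst h1
  have hs : y * (1 - y) * (1 - 2 * y) ≠ 0 := by
    have : 0 < y := by linarith
    refine mul_ne_zero (mul_pos this (by linarith)).ne' fun h => hne (by linarith)
  have h3 : (1 - 2 * x) * (y * (1 - y) * (1 - 2 * y)) = 0 := by linear_combination (1 / 2) * hD
  have h4 : x * (1 - x) * (y * (1 - y) * (1 - 2 * y)) = 0 := by linear_combination (1 / 2) * hE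
  have h5 : x = 1 / 2 := by
    have := (mul_eq_zero.1 h3).resolve_right hs
    linarith
  have h6 := (mul_eq_zero.1 h4).resolve_right hs
  rw [h5] at h6
  norm_num at h6

instance : T2Space KleinBottle :=
  T2Space.of_injective_continuous kleinEmbedding_injective continuous_kleinEmbedding

/-- The unit square, continued by a second copy across the edge `x = 1`. -/
noncomputable def kleinChart (z : ℂ) : KleinBottle :=
  if z.re ≤ 1 then kleinMk z.re z.im else kleinMk (z.re - 1) (1 - z.im)

/-- On the seam `z.re = 1` the two formulas agree by `kleinMk_flip`, so the closed halves can be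
glued. -/
theorem continuousOn_kleinChart : ContinuousOn kleinChart {z | 0 ≤ z.im ∧ z.im ≤ 1} := by
  have h1 : IsClosed {z : ℂ | z.re ≤ 1 ∧ 0 ≤ z.im ∧ z.im ≤ 1} :=
    (isClosed_le Complex.continuous_re continuous_const).inter
      ((isClosed_le continuous_const Complex.continuous_im).inter
        (isClosed_le Complex.continuous_im continuous_const))
  have h2 : IsClosed {z : ℂ | 1 ≤ z.re ∧ 0 ≤ z.im ∧ z.im ≤ 1} :=
    (isClosed_le continuous_const Complex.continuous_re).inter
      ((isClosed_le continuous_const Complex.continuous_im).inter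
        (isClosed_le Complex.continuous_im continuous_const))
  have c1 : Continuous fun z : ℂ => kleinMk z.re z.im :=
    continuous_kleinMk.comp (Complex.continuous_re.prodMk Complex.continuous_im)
  have c2 : Continuous fun z : ℂ => kleinMk (z.re - 1) (1 - z.im) :=
    continuous_kleinMk.comp ((Complex.continuous_re.sub continuous_const).prodMk
      (continuous_const.sub Complex.continuous_im))
  refine ((c1.continuousOn.congr ?_).union_of_isClosed (c2.continuousOn.congr ?_) h1 h2).mono ?_
  · intro z hz
    exact if_pos hz.1
  · intro z hz
    rcases hz.1.eq_or_lt with h | h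
    · change kleinChart z = kleinMk (z.re - 1) (1 - z.im)
      rw [kleinChart, if_pos h.ge, ← h, sub_self, kleinMk_flip ⟨by linarith [hz.2.2], by
        linarith [hz.2.1]⟩, sub_sub_cancel]
    · exact if_neg (not_le.2 h)
  · intro z hz
    rcases le_total z.re 1 with h | h
    · exact Or.inl ⟨h, hz⟩
    · exact Or.inr ⟨h, hz⟩

/-- The coordinates of `kleinChart z`. -/
noncomputable def chartCoord (z : ℂ) : ℝ × ℝ :=
  if z.re < 1 then (z.re, if z.im = 1 then 0 else z.im) else
    (z.re - 1, if z.im = 0 then 0 else 1 - z.im)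

theorem kleinCoord_kleinChart {z : ℂ} (h0 : 0 ≤ z.re) (h1 : z.re < 2) (h2 : 0 ≤ z.im)
    (h3 : z.im ≤ 1) : kleinCoord (kleinChart z) = chartCoord z := by
  rcases lt_trichotomy z.re 1 with h | h | h
  · rw [kleinChart, if_pos h.le, kleinCoord_kleinMk ⟨h0, h.le⟩ ⟨h2, h3⟩, if_neg h.ne, chartCoord,
      if_pos h]
  · rw [kleinChart, if_pos h.le, kleinCoord_kleinMk ⟨h0, h.le⟩ ⟨h2, h3⟩, if_pos h, chartCoord,
      if_neg h.not_lt, h, sub_self]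
  · rw [kleinChart, if_neg h.not_ge, kleinCoord_kleinMk ⟨by linarith, by linarith⟩
      ⟨by linarith, by linarith⟩, if_neg (by linarith), chartCoord, if_neg h.not_gt]
    simp

/-! ### The strong drawing of the prism on the Klein bottle -/

/-- The triangular prism. -/
def prism : SimpleGraph (Fin 3 ⊕ Fin 3) where
  Adj
    | .inl i, .inl j => i ≠ j
    | .inr i, .inr j => i ≠ j
    | .inl i, .inr j => i = j
    | .inr i, .inl j => i = j
  symm := ⟨by rintro (i | i) (j | j) h <;> exact h.symm⟩
  loopless := ⟨by rintro (i | i) h <;> exact h rfl⟩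

instance : DecidableRel prism.Adj
  | .inl i, .inl j => inferInstanceAs (Decidable (i ≠ j))
  | .inr i, .inr j => inferInstanceAs (Decidable (i ≠ j))
  | .inl i, .inr j => inferInstanceAs (Decidable (i = j))
  | .inr i, .inl j => inferInstanceAs (Decidable (i = j))

/-- The Hamiltonian cycle of the prism that avoids the edge joining the two copies of `m`. -/
def prismCycle (m : Fin 3) : SimpleGraph (Fin 3 ⊕ Fin 3) where
  Adj
    | .inl i, .inl j => i ≠ j ∧ (i = m ∨ j = m)
    | .inr i, .inr j => i ≠ j ∧ (i = m ∨ j = m)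
    | .inl i, .inr j => i = j ∧ i ≠ m
    | .inr i, .inl j => i = j ∧ i ≠ m
  symm := ⟨by
    rintro (i | i) (j | j) h
    · exact ⟨h.1.symm, h.2.symm⟩
    · exact ⟨h.1.symm, h.1 ▸ h.2⟩
    · exact ⟨h.1.symm, h.1 ▸ h.2⟩
    · exact ⟨h.1.symm, h.2.symm⟩⟩
  loopless := ⟨by rintro (i | i) h <;> exact h.1 rfl⟩

instance (m : Fin 3) : DecidableRel (prismCycle m).Adj
  | .inl i, .inl j => inferInstanceAs (Decidable (i ≠ j ∧ (i = m ∨ j = m)))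
  | .inr i, .inr j => inferInstanceAs (Decidable (i ≠ j ∧ (i = m ∨ j = m)))
  | .inl i, .inr j => inferInstanceAs (Decidable (i = j ∧ i ≠ m))
  | .inr i, .inl j => inferInstanceAs (Decidable (i = j ∧ i ≠ m))

/-- The cycle visits, after the first copy of `m`, the first copy of `m + 1`, the second copies of
`m + 1`, `m` and `m + 2`, and the first copy of `m + 2`. -/
theorem isCycleIn_prismCycle (m : Fin 3) : IsCycleIn prism (prismCycle m) := by
  have h1 : prism.Adj (.inl (m + 1)) (.inr (m + 1)) := rfl
  have h2 : prism.Adj (.inr (m + 1)) (.inr m) := (fin3_add m).2.2.2.2.1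
  have h3 : prism.Adj (.inr m) (.inr (m + 2)) := (fin3_add m).2.2.2.2.2.1.symm
  have h4 : prism.Adj (.inr (m + 2)) (.inl (m + 2)) := rfl
  refine IsCycleIn.of_path (v := .inl m) (.cons h1 (.cons h2 (.cons h3 (.cons h4 .nil)))) ?_ ?_ ?_
    (show m ≠ m + 1 from (fin3_add m).2.2.2.2.1.symm)
    (show m ≠ m + 2 from (fin3_add m).2.2.2.2.2.1.symm) ?_
  · simp only [SimpleGraph.Walk.cons_isPath_iff, SimpleGraph.Walk.support_cons,
      SimpleGraph.Walk.support_nil, SimpleGraph.Walk.IsPath.nil, List.mem_cons, List.not_mem_nil,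
      Sum.inr.injEq, Sum.inl.injEq, reduceCtorEq]
    clear h1 h2 h3 h4
    revert m
    decide
  · simp only [SimpleGraph.Walk.support_cons, SimpleGraph.Walk.support_nil, List.mem_cons,
      List.not_mem_nil, Sum.inl.injEq, reduceCtorEq]
    clear h1 h2 h3 h4
    revert m
    decide
  · simp
  · simp only [SimpleGraph.Walk.edges_cons, SimpleGraph.Walk.edges_nil]
    clear h1 h2 h3 h4
    revert m
    decide

/-- At a copy of `i`, the two triangle edges lie together only on cycle `i`, and the rung together
with the triangle edge to `j` only on cycle `j`. -/
theorem prism_corner : ∀ v a b, prism.Adj v a → prism.Adj v b → a ≠ b →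
    ∃ m, ((prismCycle m).Adj v a ∧ (prismCycle m).Adj v b) ∧
      ∀ m', (prismCycle m').Adj v a ∧ (prismCycle m').Adj v b → m' = m := by
  decide

/-- The first coordinate of the vertices of the prism. -/
noncomputable def prismX : Fin 3 → ℝ := ![0, 1 / 3, 2 / 3]

@[simp] theorem prismX_zero : prismX 0 = 0 := rfl
@[simp] theorem prismX_one : prismX 1 = 1 / 3 := rfl
@[simp] theorem prismX_two : prismX 2 = 2 / 3 := rfl

/-- The horizontal sides of the prism above the `k`-th interval. -/
def prismSide (k : Fin 3) : Set ℝ := Set.Ioo (prismX k) (prismX k + 1 / 3)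

theorem prismSide_unique {x : ℝ} {k l : Fin 3} (hk : x ∈ prismSide k) (hl : x ∈ prismSide l) :
    k = l := by
  obtain ⟨h1, h2⟩ := hk
  obtain ⟨h3, h4⟩ := hl
  fin_cases k <;> fin_cases l <;> simp at * <;> linarith

theorem prismX_notMem_prismSide (i k : Fin 3) : prismX i ∉ prismSide k := by
  rintro ⟨h1, h2⟩
  rcases fin3_cases 0 k with rfl | rfl | rfl <;> rcases fin3_cases 0 i with rfl | rfl | rfl <;>
    simp at h1 h2 <;> linarith

theorem prismX_injective : Function.Injective prismX := by
  intro i j h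
  rcases fin3_cases 0 i with rfl | rfl | rfl <;> rcases fin3_cases 0 j with rfl | rfl | rfl <;>
    first | rfl | norm_num at h

theorem prismX_or_prismSide {x : ℝ} (h0 : 0 ≤ x) (h1 : x < 1) :
    (∃ i, x = prismX i) ∨ ∃ k, x ∈ prismSide k := by
  by_cases h2 : x = 0
  · exact Or.inl ⟨0, h2⟩
  by_cases h3 : x = 1 / 3
  · exact Or.inl ⟨1, h3⟩
  by_cases h4 : x = 2 / 3
  · exact Or.inl ⟨2, h4⟩
  right
  rcases lt_or_gt_of_ne h3 with h3 | h3
  · exact ⟨0, lt_of_le_of_ne h0 (Ne.symm h2), by simpa using h3⟩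
  · rcases lt_or_gt_of_ne h4 with h4 | h4
    · exact ⟨1, h3, by rw [prismX_one]; linarith⟩
    · exact ⟨2, h4, by rw [prismX_two]; linarith⟩

/-- The points of the edges that join the two triangles of the prism. -/
def prismRung (i : Fin 3) : Set (ℝ × ℝ) :=
  {p | p.1 = prismX i ∧ ((i ≠ 1 ∧ 0 < p.2 ∧ p.2 < 1 / 2) ∨ (i = 1 ∧ 1 / 2 < p.2 ∧ p.2 < 1))}

/-- The coordinates of the vertices of the prism. -/
noncomputable def prismPoint : Fin 3 ⊕ Fin 3 → ℝ × ℝ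
  | .inl i => (prismX i, 0)
  | .inr i => (prismX i, 1 / 2)

/-- The coordinates of the points of the edges of the prism. -/
def prismEdge : Fin 3 ⊕ Fin 3 → Fin 3 ⊕ Fin 3 → Set (ℝ × ℝ)
  | .inl i, .inl j => {p | p.2 = 0 ∧ ∃ k, s(i, j) = s(k, k + 1) ∧ p.1 ∈ prismSide k}
  | .inr i, .inr j => {p | p.2 = 1 / 2 ∧ ∃ k, s(i, j) = s(k, k + 1) ∧ p.1 ∈ prismSide k}
  | .inl i, .inr j => {p | i = j ∧ p ∈ prismRung i}
  | .inr j, .inl i => {p | i = j ∧ p ∈ prismRung i}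

/-- The coordinates of the points of the cells. -/
def prismCell (m : Fin 3) : Set (ℝ × ℝ) :=
  {p | (m = 0 ∧ (2 / 3 < p.1 ∧ 0 < p.2 ∧ p.2 < 1 / 2 ∨ p.1 < 1 / 3 ∧ 1 / 2 < p.2)) ∨
    (m = 1 ∧ 0 < p.1 ∧ p.1 < 2 / 3 ∧ 0 < p.2 ∧ p.2 < 1 / 2) ∨
    (m = 2 ∧ 1 / 3 < p.1 ∧ 1 / 2 < p.2)}

/-- The coordinates of the boundaries of the cells. -/
def prismLoop (m : Fin 3) : Set (ℝ × ℝ) :=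
  {p | (p.2 = 0 ∨ p.2 = 1 / 2) ∧ p.1 ∉ prismSide (m + 1) ∨ ∃ i, i ≠ m ∧ p ∈ prismRung i}

theorem prismRung_snd {p : ℝ × ℝ} {i : Fin 3} (h : p ∈ prismRung i) : p.2 ≠ 0 ∧ p.2 ≠ 1 / 2 := by
  obtain ⟨-, ⟨-, h1, h2⟩ | ⟨-, h1, h2⟩⟩ := h
  · exact ⟨h1.ne', h2.ne⟩
  · exact ⟨by linarith, h1.ne'⟩

theorem prismCell_snd {p : ℝ × ℝ} {m : Fin 3} (h : p ∈ prismCell m) : p.2 ≠ 0 ∧ p.2 ≠ 1 / 2 := by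
  simp only [prismCell, Set.mem_ofPred_eq] at h
  constructor <;> intro e <;> rw [e] at h <;> norm_num at h

theorem prismRung_notMem_prismCell {p : ℝ × ℝ} {m i : Fin 3} (h : p ∈ prismRung i) :
    p ∉ prismCell m := by
  intro h'
  simp only [prismCell, prismRung, Set.mem_ofPred_eq] at h h'
  fin_cases i <;> simp at h <;> grind

theorem prismCell_unique {p : ℝ × ℝ} {m m' : Fin 3} (h : p ∈ prismCell m)
    (h' : p ∈ prismCell m') : m = m' := by
  simp only [prismCell, Set.mem_ofPred_eq] at h h'
  grind

theorem prism_cover {p : ℝ × ℝ} (h1 : p.1 ∈ Set.Ico (0 : ℝ) 1) (h2 : p.2 ∈ Set.Ico (0 : ℝ) 1) :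
    (p.2 = 0 ∨ p.2 = 1 / 2) ∨ (∃ i, p ∈ prismRung i) ∨ ∃ m, p ∈ prismCell m := by
  obtain ⟨x, y⟩ := p
  obtain ⟨hx0, hx1⟩ := h1
  obtain ⟨hy0, hy1⟩ := h2
  simp only [prismRung, prismCell, Set.mem_ofPred_eq, Fin.exists_fin_succ] at *
  simp
  grind

/-- In each triangle, the cycle `m` omits the side from `m + 1` to `m + 2`, which is drawn above the
interval with index `m + 1`; it also omits the rung `m`. -/
theorem mem_drawnSet_prism {m : Fin 3} {p : ℝ × ℝ} (h1 : p.1 ∈ Set.Ico (0 : ℝ) 1) :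
    p ∈ drawnSet prismPoint prismEdge (prismCycle m) ↔ p ∈ prismLoop m := by
  constructor
  · have side : ∀ {i j k : Fin 3}, i ≠ j ∧ (i = m ∨ j = m) → s(i, j) = s(k, k + 1) → k ≠ m + 1 := by
      revert m; decide
    rintro ⟨i | i, j | j, h, rfl | hp⟩
    · exact Or.inl ⟨Or.inl rfl, prismX_notMem_prismSide _ _⟩
    · obtain ⟨h1, k, h2, h3⟩ := hp
      exact Or.inl ⟨Or.inl h1, fun h4 => side h h2 (prismSide_unique h3 h4)⟩
    · exact Or.inl ⟨Or.inl rfl, prismX_notMem_prismSide _ _⟩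
    · exact Or.inr ⟨i, h.2, hp.2⟩
    · exact Or.inl ⟨Or.inr rfl, prismX_notMem_prismSide _ _⟩
    · exact Or.inr ⟨j, h.1 ▸ h.2, hp.2⟩
    · exact Or.inl ⟨Or.inr rfl, prismX_notMem_prismSide _ _⟩
    · obtain ⟨h1, k, h2, h3⟩ := hp
      exact Or.inl ⟨Or.inr h1, fun h4 => side h h2 (prismSide_unique h3 h4)⟩
  · have nbr : ∀ i : Fin 3, ∃ j, i ≠ j ∧ (i = m ∨ j = m) := by
      revert m; decide
    have side : ∀ k : Fin 3, k ≠ m + 1 → k ≠ k + 1 ∧ (k = m ∨ k + 1 = m) := by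
      revert m; decide
    rintro (⟨h2, h3⟩ | ⟨i, him, hi⟩)
    · rcases prismX_or_prismSide h1.1 h1.2 with ⟨i, hi⟩ | ⟨k, hk⟩
      · obtain ⟨j, hj⟩ := nbr i
        rcases h2 with h2 | h2
        · exact ⟨.inl i, .inl j, hj, Or.inl (Prod.ext hi h2)⟩
        · exact ⟨.inr i, .inr j, hj, Or.inl (Prod.ext hi h2)⟩
      · have hkm : k ≠ m + 1 := fun e => h3 (e ▸ hk)
        rcases h2 with h2 | h2
        · exact ⟨.inl k, .inl (k + 1), side k hkm, Or.inr ⟨h2, k, rfl, hk⟩⟩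
        · exact ⟨.inr k, .inr (k + 1), side k hkm, Or.inr ⟨h2, k, rfl, hk⟩⟩
    · exact ⟨.inl i, .inr i, ⟨rfl, him⟩, Or.inr ⟨rfl, hi⟩⟩

/-! ### The cells of the prism as rectangles -/

/-- The sublevel set is the rectangle `[a, b] × [c, d]`. -/
noncomputable def rectFun (a b c d : ℝ) (z : ℂ) : ℝ :=
  max (max ((-1) * z.re + 0 * z.im + a) (1 * z.re + 0 * z.im + -b))
    (max (0 * z.re + (-1) * z.im + c) (0 * z.re + 1 * z.im + -d))

theorem rectFun_le {a b c d : ℝ} {z : ℂ} :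
    rectFun a b c d z ≤ 0 ↔ a ≤ z.re ∧ z.re ≤ b ∧ c ≤ z.im ∧ z.im ≤ d := by
  simp only [rectFun, max_le_iff]
  grind

theorem rectFun_lt {a b c d : ℝ} {z : ℂ} :
    rectFun a b c d z < 0 ↔ a < z.re ∧ z.re < b ∧ c < z.im ∧ z.im < d := by
  simp only [rectFun, max_lt_iff]
  grind

theorem rectFun_eq {a b c d : ℝ} {z : ℂ} :
    rectFun a b c d z = 0 ↔ (a ≤ z.re ∧ z.re ≤ b ∧ c ≤ z.im ∧ z.im ≤ d) ∧
      (z.re = a ∨ z.re = b ∨ z.im = c ∨ z.im = d) := by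
  rw [le_antisymm_iff, rectFun_le, ← not_lt (a := rectFun a b c d z), rectFun_lt]
  grind

theorem isBodyFun_rectFun {a b c d : ℝ} (hab : a < b) (hcd : c < d) :
    IsBodyFun (rectFun a b c d) where
  convexOn := ((convexOn_affine _ _ _).max (convexOn_affine _ _ _)).max
    ((convexOn_affine _ _ _).max (convexOn_affine _ _ _))
  continuous := by unfold rectFun; fun_prop
  exists_neg := ⟨⟨(a + b) / 2, (c + d) / 2⟩, by
    rw [rectFun_lt]; refine ⟨?_, ?_, ?_, ?_⟩ <;> simp only <;> linarith⟩
  bounded := isBounded_of_abs_le (|a| + |b| + |c| + |d|) fun z hz => by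
    obtain ⟨h1, h2, h3, h4⟩ := rectFun_le.1 hz
    have := neg_abs_le a
    have := le_abs_self b
    have := neg_abs_le c
    have := le_abs_self d
    have := abs_nonneg a
    have := abs_nonneg b
    have := abs_nonneg c
    have := abs_nonneg d
    constructor <;> rw [abs_le] <;> constructor <;> linarith

/-- As `kleinCoord` is injective, subsets of the Klein bottle can be described by coordinates, and
statements about cells and boundaries become case distinctions on inequalities. -/
theorem image_kleinChart {A : Set ℂ}
    (hA : ∀ z ∈ A, (0 ≤ z.re ∧ z.re < 2) ∧ 0 ≤ z.im ∧ z.im ≤ 1) :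
    kleinChart '' A = kleinCoord ⁻¹' (chartCoord '' A) := by
  ext s
  constructor
  · rintro ⟨z, hz, rfl⟩
    obtain ⟨⟨h1, h2⟩, h3, h4⟩ := hA z hz
    exact ⟨z, hz, (kleinCoord_kleinChart h1 h2 h3 h4).symm⟩
  · rintro ⟨z, hz, e⟩
    obtain ⟨⟨h1, h2⟩, h3, h4⟩ := hA z hz
    exact ⟨z, hz, kleinCoord_injective ((kleinCoord_kleinChart h1 h2 h3 h4).trans e)⟩

theorem injOn_kleinChart {A : Set ℂ}
    (hA : ∀ z ∈ A, (0 ≤ z.re ∧ z.re < 2) ∧ 0 ≤ z.im ∧ z.im ≤ 1) (hi : Set.InjOn chartCoord A) :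
    Set.InjOn kleinChart A := by
  intro z hz w hw e
  obtain ⟨⟨h1, h2⟩, h3, h4⟩ := hA z hz
  obtain ⟨⟨h1', h2'⟩, h3', h4'⟩ := hA w hw
  apply hi hz hw
  rw [← kleinCoord_kleinChart h1 h2 h3 h4, e, kleinCoord_kleinChart h1' h2' h3' h4']

theorem isClosedDisc_rect {a b c d : ℝ} (ha : 0 ≤ a) (hab : a < b) (hb : b < 2) (hc : 0 ≤ c)
    (hcd : c < d) (hd : d ≤ 1) (hi : Set.InjOn chartCoord {z | rectFun a b c d z ≤ 0}) :
    IsClosedDisc (kleinCoord ⁻¹' (chartCoord '' {z | rectFun a b c d z < 0}))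
      (kleinCoord ⁻¹' (chartCoord '' {z | rectFun a b c d z = 0})) := by
  have hA : ∀ z ∈ {z | rectFun a b c d z ≤ 0}, (0 ≤ z.re ∧ z.re < 2) ∧ 0 ≤ z.im ∧ z.im ≤ 1 := by
    intro z hz
    obtain ⟨h1, h2, h3, h4⟩ := rectFun_le.1 hz
    exact ⟨⟨by linarith, by linarith⟩, by linarith, by linarith⟩
  have hlt : ∀ z ∈ {z | rectFun a b c d z < 0}, (0 ≤ z.re ∧ z.re < 2) ∧ 0 ≤ z.im ∧ z.im ≤ 1 :=
    fun z hz => hA z (le_of_lt (Set.mem_ofPred_eq ▸ hz))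
  have heq : ∀ z ∈ {z | rectFun a b c d z = 0}, (0 ≤ z.re ∧ z.re < 2) ∧ 0 ≤ z.im ∧ z.im ≤ 1 :=
    fun z hz => hA z (le_of_eq (Set.mem_ofPred_eq ▸ hz))
  rw [← image_kleinChart hlt, ← image_kleinChart heq]
  exact (isBodyFun_rectFun hab hcd).isClosedDisc
    (continuousOn_kleinChart.mono fun z hz => (hA z hz).2) (injOn_kleinChart hA hi)

theorem mem_prismLoop_zero {p : ℝ × ℝ} : p ∈ prismLoop 0 ↔
    (p.2 = 0 ∨ p.2 = 1 / 2) ∧ (p.1 ≤ 1 / 3 ∨ 2 / 3 ≤ p.1) ∨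
      (p.1 = 2 / 3 ∧ 0 < p.2 ∧ p.2 < 1 / 2 ∨ p.1 = 1 / 3 ∧ 1 / 2 < p.2 ∧ p.2 < 1) := by
  simp [prismLoop, prismSide, prismRung, Fin.exists_fin_succ]
  grind

theorem mem_prismLoop_one {p : ℝ × ℝ} : p ∈ prismLoop 1 ↔
    (p.2 = 0 ∨ p.2 = 1 / 2) ∧ (p.1 ≤ 2 / 3 ∨ 1 ≤ p.1) ∨
      (p.1 = 0 ∨ p.1 = 2 / 3) ∧ 0 < p.2 ∧ p.2 < 1 / 2 := by
  simp [prismLoop, prismSide, prismRung, Fin.exists_fin_succ]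
  grind

theorem mem_prismLoop_two {p : ℝ × ℝ} : p ∈ prismLoop 2 ↔
    (p.2 = 0 ∨ p.2 = 1 / 2) ∧ (p.1 ≤ 0 ∨ 1 / 3 ≤ p.1) ∨
      (p.1 = 0 ∧ 0 < p.2 ∧ p.2 < 1 / 2 ∨ p.1 = 1 / 3 ∧ 1 / 2 < p.2 ∧ p.2 < 1) := by
  simp [prismLoop, prismSide, prismRung, Fin.exists_fin_succ]
  grind

theorem isClosedDisc_of_rect {m : Fin 3} {a b c d : ℝ} (ha : 0 ≤ a) (hab : a < b) (hb : b < 2)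
    (hc : 0 ≤ c) (hcd : c < d) (hd : d ≤ 1)
    (hi : Set.InjOn chartCoord {z | rectFun a b c d z ≤ 0})
    (h1 : ∀ z, rectFun a b c d z < 0 → chartCoord z ∈ prismCell m)
    (h2 : ∀ z, rectFun a b c d z = 0 → chartCoord z ∈ prismLoop m)
    (h3 : ∀ x y, x ∈ Set.Ico (0 : ℝ) 1 → y ∈ Set.Ico (0 : ℝ) 1 → (x, y) ∈ prismCell m →
      ∃ z, rectFun a b c d z < 0 ∧ chartCoord z = (x, y))
    (h4 : ∀ x y, x ∈ Set.Ico (0 : ℝ) 1 → y ∈ Set.Ico (0 : ℝ) 1 → (x, y) ∈ prismLoop m →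
      ∃ z, rectFun a b c d z = 0 ∧ chartCoord z = (x, y)) :
    IsClosedDisc (kleinCoord ⁻¹' prismCell m) (kleinCoord ⁻¹' prismLoop m) := by
  convert isClosedDisc_rect ha hab hb hc hcd hd hi using 1
  · ext s
    exact ⟨fun h => h3 _ _ (kleinCoord_mem s).1 (kleinCoord_mem s).2 h,
      fun ⟨z, hz, e⟩ => (Set.mem_preimage.2 (e ▸ h1 z hz))⟩
  · ext s
    exact ⟨fun h => h4 _ _ (kleinCoord_mem s).1 (kleinCoord_mem s).2 h,
      fun ⟨z, hz, e⟩ => (Set.mem_preimage.2 (e ▸ h2 z hz))⟩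

/-- This rectangle straddles the seam `x = 1`, from the rung at `2/3` in the lower strip to the rung
at `1/3` in the upper strip, which the second copy of the square places at `4/3`. -/
theorem isClosedDisc_prism_zero :
    IsClosedDisc (kleinCoord ⁻¹' prismCell 0) (kleinCoord ⁻¹' prismLoop 0) := by
  refine isClosedDisc_of_rect (a := 2 / 3) (b := 4 / 3) (c := 0) (d := 1 / 2) (by norm_num)
    (by norm_num) (by norm_num) le_rfl (by norm_num) (by norm_num) ?_ ?_ ?_ ?_ ?_
  · intro z hz w hw h
    have hz := rectFun_le.1 hz
    have hw := rectFun_le.1 hw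
    simp only [chartCoord] at h
    apply Complex.ext <;> grind
  · intro z hz
    rw [rectFun_lt] at hz
    simp only [chartCoord, prismCell, Set.mem_ofPred_eq]
    grind
  · intro z hz
    rw [rectFun_eq] at hz
    rw [mem_prismLoop_zero]
    simp only [chartCoord]
    grind
  · rintro x y ⟨hx0, hx1⟩ ⟨hy0, hy1⟩ h
    simp only [prismCell, Set.mem_ofPred_eq] at h
    by_cases hx : x < 1 / 3
    · refine ⟨⟨x + 1, 1 - y⟩, ?_, ?_⟩
      · rw [rectFun_lt]; grind
      · simp only [chartCoord]; grind
    · refine ⟨⟨x, y⟩, ?_, ?_⟩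
      · rw [rectFun_lt]; grind
      · simp only [chartCoord]; grind
  · rintro x y ⟨hx0, hx1⟩ ⟨hy0, hy1⟩ h
    rw [mem_prismLoop_zero] at h
    simp only at h
    by_cases hx : x ≤ 1 / 3
    -- Beyond the seam the flip would put `y = 0` at height 1, outside the rectangle; since heights
    -- 0 and 1 are identified, 0 is used instead.
    · refine ⟨⟨x + 1, if y = 0 then 0 else 1 - y⟩, ?_, ?_⟩
      · rw [rectFun_eq]; grind
      · simp only [chartCoord]; grind
    · refine ⟨⟨x, y⟩, ?_, ?_⟩
      · rw [rectFun_eq]; grind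
      · simp only [chartCoord]; grind

theorem isClosedDisc_prism_one :
    IsClosedDisc (kleinCoord ⁻¹' prismCell 1) (kleinCoord ⁻¹' prismLoop 1) := by
  refine isClosedDisc_of_rect (a := 0) (b := 2 / 3) (c := 0) (d := 1 / 2) (by norm_num)
    (by norm_num) (by norm_num) le_rfl (by norm_num) (by norm_num) ?_ ?_ ?_ ?_ ?_
  · intro z hz w hw h
    have hz := rectFun_le.1 hz
    have hw := rectFun_le.1 hw
    simp only [chartCoord] at h
    apply Complex.ext <;> grind
  · intro z hz
    rw [rectFun_lt] at hz
    simp only [chartCoord, prismCell, Set.mem_ofPred_eq]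
    grind
  · intro z hz
    rw [rectFun_eq] at hz
    rw [mem_prismLoop_one]
    simp only [chartCoord]
    grind
  · rintro x y ⟨hx0, hx1⟩ ⟨hy0, hy1⟩ h
    simp only [prismCell, Set.mem_ofPred_eq] at h
    refine ⟨⟨x, y⟩, ?_, ?_⟩
    · rw [rectFun_lt]; grind
    · simp only [chartCoord]; grind
  · rintro x y ⟨hx0, hx1⟩ ⟨hy0, hy1⟩ h
    rw [mem_prismLoop_one] at h
    simp only at h
    refine ⟨⟨x, y⟩, ?_, ?_⟩
    · rw [rectFun_eq]; grind
    · simp only [chartCoord]; grind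

/-- The rectangle fills the upper strip from the rung at `1/3` to the seam; its right side is the
rung at `0` with the orientation reversed. -/
theorem isClosedDisc_prism_two :
    IsClosedDisc (kleinCoord ⁻¹' prismCell 2) (kleinCoord ⁻¹' prismLoop 2) := by
  refine isClosedDisc_of_rect (a := 1 / 3) (b := 1) (c := 1 / 2) (d := 1) (by norm_num)
    (by norm_num) (by norm_num) (by norm_num) (by norm_num) le_rfl ?_ ?_ ?_ ?_ ?_
  · intro z hz w hw h
    have hz := rectFun_le.1 hz
    have hw := rectFun_le.1 hw
    simp only [chartCoord] at h
    apply Complex.ext <;> grind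
  · intro z hz
    rw [rectFun_lt] at hz
    simp only [chartCoord, prismCell, Set.mem_ofPred_eq]
    grind
  · intro z hz
    rw [rectFun_eq] at hz
    rw [mem_prismLoop_two]
    simp only [chartCoord]
    grind
  · rintro x y ⟨hx0, hx1⟩ ⟨hy0, hy1⟩ h
    simp only [prismCell, Set.mem_ofPred_eq] at h
    refine ⟨⟨x, y⟩, ?_, ?_⟩
    · rw [rectFun_lt]; grind
    · simp only [chartCoord]; grind
  · rintro x y ⟨hx0, hx1⟩ ⟨hy0, hy1⟩ h
    rw [mem_prismLoop_two] at h
    simp only at h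
    by_cases hx : x = 0
    -- The flip takes the side `x = 0` to `x = 1`; below, points with `y = 0` are found on the top
    -- side `y = 1`.
    · refine ⟨⟨1, 1 - y⟩, ?_, ?_⟩
      · rw [rectFun_eq]; grind
      · simp only [chartCoord]; grind
    · refine ⟨⟨x, if y = 0 then 1 else y⟩, ?_, ?_⟩
      · rw [rectFun_eq]; grind
      · simp only [chartCoord]; grind

theorem isClosedDisc_prism (m : Fin 3) :
    IsClosedDisc (kleinCoord ⁻¹' prismCell m) (kleinCoord ⁻¹' prismLoop m) := by
  rcases fin3_cases 0 m with rfl | rfl | rfl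
  · exact isClosedDisc_prism_zero
  · exact isClosedDisc_prism_one
  · exact isClosedDisc_prism_two

theorem isArc_kleinChart {γ : ℝ → ℂ} (hγ : Continuous γ) {a b : ℝ} (hab : a < b)
    (hA : ∀ t ∈ Set.Icc a b, (0 ≤ (γ t).re ∧ (γ t).re < 2) ∧ 0 ≤ (γ t).im ∧ (γ t).im ≤ 1)
    {δ : ℝ → ℝ × ℝ} (hδ : ∀ t ∈ Set.Icc a b, chartCoord (γ t) = δ t)
    (hi : Set.InjOn δ (Set.Icc a b)) {O : Set (ℝ × ℝ)}
    (hO : ∀ p : ℝ × ℝ, p ∈ O ↔ ∃ t ∈ Set.Ioo a b, δ t = p) {s t : KleinBottle}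
    (hs : kleinCoord s = δ a) (ht : kleinCoord t = δ b) : IsArc (kleinCoord ⁻¹' O) s t := by
  have key : ∀ t ∈ Set.Icc a b, kleinCoord (kleinChart (γ t)) = δ t := fun t ht =>
    (kleinCoord_kleinChart (hA t ht).1.1 (hA t ht).1.2 (hA t ht).2.1 (hA t ht).2.2).trans (hδ t ht)
  have h := isArc_of_Icc (γ := fun t => kleinChart (γ t)) hab
    (continuousOn_kleinChart.comp hγ.continuousOn fun t ht => (hA t ht).2)
    (fun u hu v hv e => hi hu hv (by
      rw [← key u hu, ← key v hv]
      exact congrArg kleinCoord e))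
  have ea : s = kleinChart (γ a) :=
    kleinCoord_injective (hs.trans (key a (Set.left_mem_Icc.2 hab.le)).symm)
  have eb : t = kleinChart (γ b) :=
    kleinCoord_injective (ht.trans (key b (Set.right_mem_Icc.2 hab.le)).symm)
  rw [ea, eb]
  convert h using 1
  ext s
  constructor
  · intro hs
    obtain ⟨t, ht, e⟩ := (hO _).1 hs
    exact ⟨t, ht, kleinCoord_injective ((key t (Set.Ioo_subset_Icc_self ht)).trans e)⟩
  · rintro ⟨t, ht, rfl⟩
    exact (hO _).2 ⟨t, ht, (key t (Set.Ioo_subset_Icc_self ht)).symm⟩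

theorem prismX_mem (i : Fin 3) : prismX i ∈ Set.Ico (0 : ℝ) 1 := by
  rcases fin3_cases 0 i with rfl | rfl | rfl <;> constructor <;> norm_num

theorem isArc_prismSide {c : ℝ} (hc : c = 0 ∨ c = 1 / 2) (k : Fin 3) {s t : KleinBottle}
    (hs : kleinCoord s = (prismX k, c)) (ht : kleinCoord t = (prismX (k + 1), c)) :
    IsArc (kleinCoord ⁻¹' {p | p.2 = c ∧ p.1 ∈ prismSide k}) s t := by
  obtain ⟨h0, h1⟩ := prismX_mem k
  have h2 : prismX k ≤ 2 / 3 := by rcases fin3_cases 0 k with rfl | rfl | rfl <;> norm_num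
  have h3 : prismX (k + 1) = if prismX k + 1 / 3 < 1 then prismX k + 1 / 3 else
      prismX k + 1 / 3 - 1 := by
    rcases fin3_cases 0 k with rfl | rfl | rfl <;> norm_num <;> rfl
  -- Only the heights `0` and `1/2` are preserved by the flip `c ↦ 1 - c`, with 0 and 1 identified.
  -- This is why the last side, which reaches `x = 1`, closes up at the vertex at `x = 0`.
  have hc' : 0 ≤ c ∧ c < 1 ∧ (c = 0 ∨ 1 - c = c) := by rcases hc with rfl | rfl <;> norm_num
  refine isArc_kleinChart (γ := fun t => ⟨t, c⟩)
    (by simp only [Complex.mk_eq_add_mul_I]; fun_prop)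
    (a := prismX k) (b := prismX k + 1 / 3) (by linarith) ?_
    (δ := fun t => (if t < 1 then t else t - 1, c)) ?_ ?_ ?_ ?_ ?_
  · rintro t ⟨ht0, ht1⟩
    simp only
    grind
  · rintro t ⟨ht0, ht1⟩
    simp only [chartCoord]
    grind
  · rintro t ⟨ht0, ht1⟩ u ⟨hu0, hu1⟩ h
    simp only at h
    grind
  · rintro ⟨x, y⟩
    simp only [prismSide, Set.mem_ofPred_eq, Set.mem_Ioo, Prod.mk.injEq]
    constructor
    · rintro ⟨rfl, h⟩
      exact ⟨x, h, by grind, rfl⟩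
    · rintro ⟨t, h, h4, h5⟩
      grind
  · rw [hs, if_pos h1]
  · rw [ht, h3]

theorem isArc_prismRung (i : Fin 3) {s t : KleinBottle}
    (hs : kleinCoord s = (prismX i, 0)) (ht : kleinCoord t = (prismX i, 1 / 2)) :
    IsArc (kleinCoord ⁻¹' prismRung i) s t := by
  obtain ⟨h0, h1⟩ := prismX_mem i
  have hγ : Continuous fun t : ℝ => (⟨prismX i, t⟩ : ℂ) := by
    simp only [Complex.mk_eq_add_mul_I]; fun_prop
  by_cases hi : i = 1
  -- The middle rung runs upwards from height `1/2` to height `1`, that is, from the second triangle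
  -- to the first.
  · refine IsArc.symm (isArc_kleinChart hγ (a := 1 / 2) (b := 1) (by norm_num) ?_
      (δ := fun t => (prismX i, if t = 1 then 0 else t)) ?_ ?_ ?_ ?_ ?_)
    · rintro t ⟨ht0, ht1⟩
      simp only
      grind
    · rintro t ⟨ht0, ht1⟩
      simp only [chartCoord]
      grind
    · rintro t ⟨ht0, ht1⟩ u ⟨hu0, hu1⟩ h
      simp only at h
      grind
    · rintro ⟨x, y⟩
      simp only [prismRung, Set.mem_ofPred_eq, Set.mem_Ioo, Prod.mk.injEq]
      constructor
      · rintro ⟨rfl, h⟩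
        exact ⟨y, by grind, rfl, by grind⟩
      · rintro ⟨t, h, h4, h5⟩
        grind
    · rw [ht]; norm_num
    · rw [hs]; norm_num
  · refine isArc_kleinChart hγ (a := 0) (b := 1 / 2) (by norm_num) ?_
      (δ := fun t => (prismX i, t)) ?_ ?_ ?_ ?_ ?_
    · rintro t ⟨ht0, ht1⟩
      simp only
      grind
    · rintro t ⟨ht0, ht1⟩
      simp only [chartCoord]
      grind
    · rintro t ⟨ht0, ht1⟩ u ⟨hu0, hu1⟩ h
      simp only at h
      grind
    · rintro ⟨x, y⟩
      simp only [prismRung, Set.mem_ofPred_eq, Set.mem_Ioo, Prod.mk.injEq]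
      constructor
      · rintro ⟨rfl, h⟩
        exact ⟨y, by grind, rfl, by grind⟩
      · rintro ⟨t, h, h4, h5⟩
        grind
    · rw [hs]
    · rw [ht]

theorem exists_prismSide_eq {i j : Fin 3} (h : i ≠ j) (c : ℝ) : ∃ k, s(i, j) = s(k, k + 1) ∧
    {p : ℝ × ℝ | p.2 = c ∧ ∃ k, s(i, j) = s(k, k + 1) ∧ p.1 ∈ prismSide k} =
      {p | p.2 = c ∧ p.1 ∈ prismSide k} := by
  obtain ⟨k, hk, hu⟩ : ∃ k : Fin 3, s(i, j) = s(k, k + 1) ∧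
      ∀ l : Fin 3, s(i, j) = s(l, l + 1) → l = k := by
    revert i j; decide
  refine ⟨k, hk, Set.ext fun p => ⟨?_, ?_⟩⟩
  · rintro ⟨h1, l, h2, h3⟩
    exact ⟨h1, hu l h2 ▸ h3⟩
  · rintro ⟨h1, h2⟩
    exact ⟨h1, k, hk, h2⟩

theorem isArc_prismEdge_horizontal {c : ℝ} (hc : c = 0 ∨ c = 1 / 2) {i j : Fin 3} (h : i ≠ j)
    {s t : KleinBottle} (hs : kleinCoord s = (prismX i, c)) (ht : kleinCoord t = (prismX j, c)) :
    IsArc (kleinCoord ⁻¹' {p | p.2 = c ∧ ∃ k, s(i, j) = s(k, k + 1) ∧ p.1 ∈ prismSide k}) s t := by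
  obtain ⟨k, hk, e⟩ := exists_prismSide_eq h c
  rw [e]
  rcases Sym2.eq_iff.1 hk with ⟨rfl, rfl⟩ | ⟨rfl, rfl⟩
  · exact isArc_prismSide hc _ hs ht
  · exact (isArc_prismSide hc _ ht hs).symm

theorem prismPoint_mem (u : Fin 3 ⊕ Fin 3) : (prismPoint u).1 ∈ Set.Ico (0 : ℝ) 1 ∧
    (prismPoint u).2 ∈ Set.Ico (0 : ℝ) 1 := by
  rcases u with i | i <;> refine ⟨prismX_mem i, ?_, ?_⟩ <;> simp only [prismPoint] <;> norm_num

theorem prismPoint_snd (u : Fin 3 ⊕ Fin 3) : (prismPoint u).2 = 0 ∨ (prismPoint u).2 = 1 / 2 := by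
  rcases u with i | i
  · exact Or.inl rfl
  · exact Or.inr rfl

theorem prismPoint_injective : Function.Injective prismPoint := by
  rintro (i | i) (j | j) h
  · exact congrArg _ (prismX_injective (Prod.ext_iff.1 h).1)
  · have := (Prod.ext_iff.1 h).2
    norm_num [prismPoint] at this
  · have := (Prod.ext_iff.1 h).2
    norm_num [prismPoint] at this
  · exact congrArg _ (prismX_injective (Prod.ext_iff.1 h).1)

theorem prismEdge_symm (u w : Fin 3 ⊕ Fin 3) : prismEdge u w = prismEdge w u := by
  rcases u with i | i <;> rcases w with j | j
  · simp only [prismEdge, Sym2.eq_swap]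
  · rfl
  · rfl
  · simp only [prismEdge, Sym2.eq_swap]

theorem adj_of_mem_prismEdge {u w : Fin 3 ⊕ Fin 3} {p : ℝ × ℝ} (h : p ∈ prismEdge u w) :
    prism.Adj u w := by
  have ne : ∀ {i j k : Fin 3}, s(i, j) = s(k, k + 1) → i ≠ j := by decide
  rcases u with i | i <;> rcases w with j | j
  · obtain ⟨-, k, hk, -⟩ := h
    exact ne hk
  · exact h.1
  · exact h.1.symm
  · obtain ⟨-, k, hk, -⟩ := h
    exact ne hk

theorem prismPoint_notMem_prismEdge (v u w : Fin 3 ⊕ Fin 3) : prismPoint v ∉ prismEdge u w := by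
  intro h
  have hX : ∀ k, (prismPoint v).1 ∉ prismSide k := by
    rcases v with i | i <;> exact prismX_notMem_prismSide i
  rcases u with i | i <;> rcases w with j | j
  · obtain ⟨-, k, -, hk⟩ := h
    exact hX k hk
  · obtain ⟨h1, h2⟩ := prismRung_snd h.2
    exact (prismPoint_snd v).elim h1 h2
  · obtain ⟨h1, h2⟩ := prismRung_snd h.2
    exact (prismPoint_snd v).elim h1 h2
  · obtain ⟨-, k, -, hk⟩ := h
    exact hX k hk

theorem prismEdge_notMem_prismCell {u w : Fin 3 ⊕ Fin 3} {p : ℝ × ℝ} (h : p ∈ prismEdge u w)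
    (m : Fin 3) : p ∉ prismCell m := by
  rcases u with i | i <;> rcases w with j | j
  · exact fun h' => (prismCell_snd h').1 h.1
  · exact prismRung_notMem_prismCell h.2
  · exact prismRung_notMem_prismCell h.2
  · exact fun h' => (prismCell_snd h').2 h.1

theorem prismEdge_unique {u w u' w' : Fin 3 ⊕ Fin 3} {p : ℝ × ℝ} (h : p ∈ prismEdge u w)
    (h' : p ∈ prismEdge u' w') : s(u, w) = s(u', w') := by
  have rung : ∀ {i j}, p ∈ prismRung i → p ∈ prismRung j → i = j := fun h1 h2 =>
    prismX_injective (h1.1.symm.trans h2.1)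
  have side : ∀ {i j i' j' : Fin 3}, (∃ k, s(i, j) = s(k, k + 1) ∧ p.1 ∈ prismSide k) →
      (∃ k, s(i', j') = s(k, k + 1) ∧ p.1 ∈ prismSide k) → s(i, j) = s(i', j') := by
    rintro i j i' j' ⟨k, h1, h2⟩ ⟨l, h3, h4⟩
    rw [h1, h3, prismSide_unique h2 h4]
  have half : p.2 = 0 → p.2 ≠ 1 / 2 := fun h => by rw [h]; norm_num
  rcases u with i | i <;> rcases w with j | j <;> rcases u' with i' | i' <;>
    rcases w' with j' | j' <;> simp only [prismEdge, Set.mem_ofPred_eq] at h h'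
  · exact congrArg (Sym2.map Sum.inl) (side h.2 h'.2)
  · exact ((prismRung_snd h'.2).1 h.1).elim
  · exact ((prismRung_snd h'.2).1 h.1).elim
  · exact (half h.1 h'.1).elim
  · exact ((prismRung_snd h.2).1 h'.1).elim
  · rw [← h.1, ← h'.1, rung h.2 h'.2]
  · rw [← h.1, ← h'.1, rung h.2 h'.2, Sym2.eq_swap]
  · exact ((prismRung_snd h.2).2 h'.1).elim
  · exact ((prismRung_snd h.2).1 h'.1).elim
  · rw [← h.1, ← h'.1, rung h.2 h'.2, Sym2.eq_swap]
  · rw [← h.1, ← h'.1, rung h.2 h'.2]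
  · exact ((prismRung_snd h.2).2 h'.1).elim
  · exact (half h'.1 h.1).elim
  · exact ((prismRung_snd h'.2).2 h.1).elim
  · exact ((prismRung_snd h'.2).2 h.1).elim
  · exact congrArg (Sym2.map Sum.inr) (side h.2 h'.2)

theorem prism_cover_drawn {p : ℝ × ℝ} (h1 : p.1 ∈ Set.Ico (0 : ℝ) 1)
    (h2 : p.2 ∈ Set.Ico (0 : ℝ) 1) :
    (∃ u, p = prismPoint u) ∨ (∃ u w, p ∈ prismEdge u w) ∨ ∃ m, p ∈ prismCell m := by
  rcases prism_cover h1 h2 with h | ⟨i, hi⟩ | h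
  · rcases prismX_or_prismSide h1.1 h1.2 with ⟨i, hi⟩ | ⟨k, hk⟩
    · rcases h with h | h
      · exact Or.inl ⟨.inl i, Prod.ext hi h⟩
      · exact Or.inl ⟨.inr i, Prod.ext hi h⟩
    · rcases h with h | h
      · exact Or.inr (Or.inl ⟨.inl k, .inl (k + 1), h, k, rfl, hk⟩)
      · exact Or.inr (Or.inl ⟨.inr k, .inr (k + 1), h, k, rfl, hk⟩)
  · exact Or.inr (Or.inl ⟨.inl i, .inr i, rfl, hi⟩)
  · exact Or.inr (Or.inr h)

theorem kleinCoord_kleinMk_of_lt {x y : ℝ} (hx : x ∈ Set.Ico (0 : ℝ) 1)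
    (hy : y ∈ Set.Ico (0 : ℝ) 1) : kleinCoord (kleinMk x y) = (x, y) := by
  rw [kleinCoord_kleinMk ⟨hx.1, hx.2.le⟩ ⟨hy.1, hy.2.le⟩, if_neg hx.2.ne, if_neg hy.2.ne]

theorem kleinCoord_prismPoint (u : Fin 3 ⊕ Fin 3) :
    kleinCoord (kleinMk (prismPoint u).1 (prismPoint u).2) = prismPoint u :=
  kleinCoord_kleinMk_of_lt (prismPoint_mem u).1 (prismPoint_mem u).2

theorem drawnSet_prism (m : Fin 3) :
    drawnSet (fun u => kleinMk (prismPoint u).1 (prismPoint u).2)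
      (fun u w => kleinCoord ⁻¹' prismEdge u w) (prismCycle m) = kleinCoord ⁻¹' prismLoop m := by
  ext s
  rw [Set.mem_preimage, ← mem_drawnSet_prism (kleinCoord_mem s).1]
  refine exists₂_congr fun u w => and_congr_right fun _ => or_congr ?_ Iff.rfl
  constructor
  · rintro rfl
    exact kleinCoord_prismPoint u
  · exact fun h => kleinCoord_injective (h.trans (kleinCoord_prismPoint u).symm)

/-- The strong drawing of the prism on the Klein bottle. -/
noncomputable def prismDrawing : StrongDrawing prism KleinBottle (Fin 3) where
  pt u := kleinMk (prismPoint u).1 (prismPoint u).2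
  O u w := kleinCoord ⁻¹' prismEdge u w
  U m := kleinCoord ⁻¹' prismCell m
  C := prismCycle
  O_symm u w := by rw [prismEdge_symm]
  cover s := by
    rcases prism_cover_drawn (kleinCoord_mem s).1 (kleinCoord_mem s).2 with ⟨u, h⟩ | ⟨u, w, h⟩ | h
    · exact Or.inl ⟨u, kleinCoord_injective (h.trans (kleinCoord_prismPoint u).symm)⟩
    · exact Or.inr (Or.inl ⟨u, w, adj_of_mem_prismEdge h, h⟩)
    · exact Or.inr (Or.inr h)
  pt_inj u w h := prismPoint_injective (by
    rw [← kleinCoord_prismPoint u, ← kleinCoord_prismPoint w]; exact congrArg kleinCoord h)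
  adj_of_mem h := adj_of_mem_prismEdge h
  pt_notMem_O v u w h := prismPoint_notMem_prismEdge v u w (by
    rwa [Set.mem_preimage, kleinCoord_prismPoint] at h)
  pt_notMem_U v m h := by
    rw [Set.mem_preimage, kleinCoord_prismPoint] at h
    exact (prismPoint_snd v).elim (prismCell_snd h).1 (prismCell_snd h).2
  O_notMem_U m h := prismEdge_notMem_prismCell h m
  U_inj h h' := prismCell_unique h h'
  O_inj h h' := prismEdge_unique h h'
  isArc {u w} h := by
    have hu := kleinCoord_prismPoint u
    have hw := kleinCoord_prismPoint w
    rcases u with i | i <;> rcases w with j | j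
    · exact isArc_prismEdge_horizontal (Or.inl rfl) h hu hw
    · obtain rfl : i = j := h
      convert isArc_prismRung i hu hw using 2
      simp [prismEdge]
    · obtain rfl : i = j := h
      convert (isArc_prismRung i hw hu).symm using 2
      simp [prismEdge]
    · exact isArc_prismEdge_horizontal (Or.inr rfl) h hu hw
  isDisc m := by
    rw [drawnSet_prism]
    exact isClosedDisc_prism m
  isCycle := isCycleIn_prismCycle
  corner {v a b} ha hb hab := by
    obtain ⟨m, h1, h2⟩ := prism_corner v a b ha hb hab
    exact ⟨m, h1, h2⟩

/-! ### Subdivision and truncation -/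

/-- The faces of a triangulated closed surface: triangles of the graph `T` such that each edge of
a face belongs to exactly one other face. -/
structure IsTriangulation {V : Type*} (T : SimpleGraph V) (F : Set (Set V)) : Prop where
  ncard : ∀ f ∈ F, f.ncard = 3
  adj : ∀ f ∈ F, ∀ u ∈ f, ∀ v ∈ f, u ≠ v → T.Adj u v
  existsUnique : ∀ f ∈ F, ∀ u ∈ f, ∀ v ∈ f, u ≠ v → ∃! g, (g ∈ F ∧ g ≠ f) ∧ u ∈ g ∧ v ∈ g

theorem Set.ncard_eq_three_iff_exists_injective {V : Type*} {t : Set V} :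
    t.ncard = 3 ↔ ∃ x : Fin 3 → V, Function.Injective x ∧ t = Set.range x := by
  constructor
  · intro h
    have hf : t.Finite := Set.finite_of_ncard_ne_zero (by omega)
    have : Finite t := hf
    have e : t ≃ Fin 3 := Finite.equivFinOfCardEq (by rwa [Nat.card_coe_set_eq])
    refine ⟨fun i => e.symm i, Subtype.val_injective.comp e.symm.injective, Set.ext fun y => ?_⟩
    constructor
    · intro hy
      exact ⟨e ⟨y, hy⟩, by simp⟩
    · rintro ⟨i, rfl⟩
      exact (e.symm i).2
  · rintro ⟨x, hx, rfl⟩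
    rw [Set.ncard_range_of_injective hx]
    simp

/-- The face of the subdivision of the triangle `x` that is opposite to `x i`. -/
def newFace {V : Type} (x : Fin 3 → V) (i : Fin 3) : Set (Option V) :=
  insert none (some '' (Set.range x \ {x i}))

theorem none_mem_newFace {V : Type} (x : Fin 3 → V) (i : Fin 3) : none ∈ newFace x i :=
  Set.mem_insert _ _

theorem some_mem_newFace {V : Type} {x : Fin 3 → V} (hx : Function.Injective x) {i : Fin 3}
    {u : V} : some u ∈ newFace x i ↔ ∃ a, a ≠ i ∧ u = x a := by
  simp only [newFace, Set.mem_insert_iff, reduceCtorEq, false_or,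
    (Option.some_injective V).mem_set_image, Set.mem_sdiff, Set.mem_singleton_iff]
  constructor
  · rintro ⟨⟨a, rfl⟩, h⟩
    exact ⟨a, fun e => h (congrArg x e), rfl⟩
  · rintro ⟨a, h, rfl⟩
    exact ⟨⟨a, rfl⟩, fun e => h (hx e)⟩

theorem some_apply_mem_newFace {V : Type} {x : Fin 3 → V} (hx : Function.Injective x)
    {i a : Fin 3} : some (x a) ∈ newFace x i ↔ a ≠ i := by
  rw [some_mem_newFace hx]
  exact ⟨fun ⟨b, h, e⟩ => hx e ▸ h, fun h => ⟨a, h, rfl⟩⟩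

theorem none_notMem_image {V : Type} (f : Set V) : none ∉ some '' f := by
  rintro ⟨y, -, h⟩
  cases h

theorem newFace_injective {V : Type} {x : Fin 3 → V} (hx : Function.Injective x) :
    Function.Injective (newFace x) := by
  intro i j h
  by_contra hij
  have := (some_apply_mem_newFace hx (i := j)).2 hij
  rw [← h, some_apply_mem_newFace hx] at this
  exact this rfl

theorem ncard_newFace {V : Type} {x : Fin 3 → V} (hx : Function.Injective x) (i : Fin 3) :
    (newFace x i).ncard = 3 := by
  rw [newFace, Set.ncard_insert_of_notMem (none_notMem_image _)
    (((Set.finite_range x).sdiff).image _),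
    Set.ncard_image_of_injective _ (Option.some_injective V),
    Set.ncard_sdiff_singleton_of_mem (Set.mem_range_self i), Set.ncard_range_of_injective hx]
  simp

theorem mem_subdivideFaces {V : Type} {F : Set (Set V)} {x : Fin 3 → V} {s : Set (Option V)} :
    s ∈ subdivideFaces F (Set.range x) ↔ (∃ f ∈ F, f ≠ Set.range x ∧ s = some '' f) ∨
      ∃ i, s = newFace x i := by
  refine or_congr Iff.rfl ⟨?_, ?_⟩
  · rintro ⟨_, ⟨i, rfl⟩, h⟩
    exact ⟨i, h⟩
  · rintro ⟨i, h⟩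
    exact ⟨x i, ⟨i, rfl⟩, h⟩

theorem IsTriangulation.eq_of_mem {V : Type*} {T : SimpleGraph V} {F : Set (Set V)}
    (h : IsTriangulation T F) {f g g' : Set V} (hf : f ∈ F) (hg : g ∈ F) (hg' : g' ∈ F)
    (hgf : g ≠ f) (hgf' : g' ≠ f) {u v : V} (huv : u ≠ v) (hu : u ∈ f) (hv : v ∈ f)
    (hug : u ∈ g) (hvg : v ∈ g) (hug' : u ∈ g') (hvg' : v ∈ g') : g = g' :=
  (h.existsUnique f hf u hu v hv huv).unique ⟨⟨hg, hgf⟩, hug, hvg⟩ ⟨⟨hg', hgf'⟩, hug', hvg'⟩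

/-- An edge at the new vertex lies on two of the three new faces. On an edge of the subdivided face,
the new face containing that edge takes the place of the old face; other edges keep their faces. -/
theorem IsTriangulation.subdivide {V : Type} {T : SimpleGraph V} {F : Set (Set V)} {x : Fin 3 → V}
    (hx : Function.Injective x) (h : IsTriangulation T F) (ht : Set.range x ∈ F) :
    IsTriangulation (subdivideGraph T (Set.range x)) (subdivideFaces F (Set.range x)) := by
  have hxt : ∀ i, x i ∈ Set.range x := fun i => ⟨i, rfl⟩
  have some_mem : ∀ {y : V} {f : Set V}, some y ∈ some '' f ↔ y ∈ f :=
    (Option.some_injective V).mem_set_image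
  have image_inj : ∀ {f g : Set V}, some '' f = some '' g → f = g := fun h =>
    (Option.some_injective V).image_injective h
  constructor
  · intro s hs
    rcases mem_subdivideFaces.1 hs with ⟨f, hf, -, rfl⟩ | ⟨i, rfl⟩
    · rw [Set.ncard_image_of_injective _ (Option.some_injective V), h.ncard f hf]
    · exact ncard_newFace hx i
  · intro s hs
    rcases mem_subdivideFaces.1 hs with ⟨f, hf, -, rfl⟩ | ⟨i, rfl⟩
    · rintro (_ | u) hu (_ | v) hv huv
      · exact (none_notMem_image f hu).elim
      · exact (none_notMem_image f hu).elim
      · exact (none_notMem_image f hv).elim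
      · exact h.adj f hf u (some_mem.1 hu) v (some_mem.1 hv) fun e => huv (congrArg some e)
    · rintro (_ | u) hu (_ | v) hv huv
      · exact (huv rfl).elim
      · obtain ⟨a, -, rfl⟩ := (some_mem_newFace hx).1 hv
        exact hxt a
      · obtain ⟨a, -, rfl⟩ := (some_mem_newFace hx).1 hu
        exact hxt a
      · obtain ⟨a, -, rfl⟩ := (some_mem_newFace hx).1 hu
        obtain ⟨b, -, rfl⟩ := (some_mem_newFace hx).1 hv
        exact h.adj _ ht _ (hxt a) _ (hxt b) fun e => huv (congrArg some e)
  · have hnew : ∀ i, newFace x i ∈ subdivideFaces F (Set.range x) := fun i =>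
      mem_subdivideFaces.2 (Or.inr ⟨i, rfl⟩)
    have third : ∀ {a b : Fin 3}, a ≠ b → ∃ i, a ≠ i ∧ b ≠ i ∧ ∀ j, a ≠ j → b ≠ j → j = i := by
      decide
    intro s hs
    rcases mem_subdivideFaces.1 hs with ⟨f, hf, hft, rfl⟩ | ⟨i, rfl⟩
    · rintro (_ | u) hu (_ | v) hv huv
      · exact (none_notMem_image f hu).elim
      · exact (none_notMem_image f hu).elim
      · exact (none_notMem_image f hv).elim
      rw [some_mem] at hu hv
      have huv : u ≠ v := fun e => huv (congrArg some e)
      obtain ⟨g, ⟨⟨hg, hgf⟩, hug, hvg⟩, -⟩ := h.existsUnique f hf u hu v hv huv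
      -- If the face across the edge was the subdivided one, its replacement is the new face that
      -- omits the third vertex `x i`.
      by_cases hgt : g = Set.range x
      · subst hgt
        obtain ⟨a, rfl⟩ := hug
        obtain ⟨b, rfl⟩ := hvg
        obtain ⟨i, hai, hbi, hi⟩ := third fun e => huv (congrArg x e)
        refine ⟨newFace x i, ⟨⟨hnew i, fun h => none_notMem_image f (h ▸ none_mem_newFace x i)⟩,
          (some_apply_mem_newFace hx).2 hai, (some_apply_mem_newFace hx).2 hbi⟩, ?_⟩
        rintro s ⟨⟨hs, hsf⟩, hus, hvs⟩
        rcases mem_subdivideFaces.1 hs with ⟨k, hk, hkt, rfl⟩ | ⟨j, rfl⟩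
        · exact (hkt (h.eq_of_mem hf hk hg (fun e => hsf (congrArg _ e)) hgf huv hu hv
            (some_mem.1 hus) (some_mem.1 hvs) (hxt a) (hxt b))).elim
        · rw [hi j ((some_apply_mem_newFace hx).1 hus) ((some_apply_mem_newFace hx).1 hvs)]
      · refine ⟨some '' g, ⟨⟨mem_subdivideFaces.2 (Or.inl ⟨g, hg, hgt, rfl⟩),
          fun h => hgf (image_inj h)⟩, some_mem.2 hug, some_mem.2 hvg⟩, ?_⟩
        rintro s ⟨⟨hs, hsf⟩, hus, hvs⟩
        rcases mem_subdivideFaces.1 hs with ⟨k, hk, hkt, rfl⟩ | ⟨j, rfl⟩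
        · rw [h.eq_of_mem hf hk hg (fun e => hsf (congrArg _ e)) hgf huv hu hv
            (some_mem.1 hus) (some_mem.1 hvs) hug hvg]
        · obtain ⟨a, -, rfl⟩ := (some_mem_newFace hx).1 hus
          obtain ⟨b, -, rfl⟩ := (some_mem_newFace hx).1 hvs
          exact (hgt (h.eq_of_mem hf hg ht hgf hft.symm huv hu hv hug hvg (hxt a) (hxt b))).elim
    · have hnone : ∀ {a}, a ≠ i → ∃! g, (g ∈ subdivideFaces F (Set.range x) ∧ g ≠ newFace x i) ∧
          none ∈ g ∧ some (x a) ∈ g := by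
        intro a ha
        obtain ⟨c, hac, hic, hc⟩ := third ha
        refine ⟨newFace x c, ⟨⟨hnew c, fun e => hic (newFace_injective hx e).symm⟩,
          none_mem_newFace x c, (some_apply_mem_newFace hx).2 hac⟩, ?_⟩
        rintro s ⟨⟨hs, hsf⟩, hus, hvs⟩
        rcases mem_subdivideFaces.1 hs with ⟨k, hk, hkt, rfl⟩ | ⟨j, rfl⟩
        · exact (none_notMem_image k hus).elim
        · rw [hc j ((some_apply_mem_newFace hx).1 hvs) fun e => hsf (e ▸ rfl)]
      rintro (_ | u) hu (_ | v) hv huv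
      · exact (huv rfl).elim
      · obtain ⟨a, ha, rfl⟩ := (some_mem_newFace hx).1 hv
        exact hnone ha
      · obtain ⟨a, ha, rfl⟩ := (some_mem_newFace hx).1 hu
        simpa only [and_comm (a := some (x a) ∈ _)] using hnone ha
      · obtain ⟨a, ha, rfl⟩ := (some_mem_newFace hx).1 hu
        obtain ⟨b, hb, rfl⟩ := (some_mem_newFace hx).1 hv
        have huv : x a ≠ x b := fun e => huv (congrArg some e)
        obtain ⟨g, ⟨⟨hg, hgt⟩, hug, hvg⟩, -⟩ :=
          h.existsUnique _ ht _ (hxt a) _ (hxt b) huv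
        refine ⟨some '' g, ⟨⟨mem_subdivideFaces.2 (Or.inl ⟨g, hg, hgt, rfl⟩),
          fun h => none_notMem_image g (h ▸ none_mem_newFace x i)⟩,
          some_mem.2 hug, some_mem.2 hvg⟩, ?_⟩
        rintro s ⟨⟨hs, hsf⟩, hus, hvs⟩
        rcases mem_subdivideFaces.1 hs with ⟨k, hk, hkt, rfl⟩ | ⟨j, rfl⟩
        · rw [h.eq_of_mem ht hk hg hkt hgt huv (hxt a) (hxt b) (some_mem.1 hus)
            (some_mem.1 hvs) hug hvg]
        · obtain ⟨c, -, -, hc⟩ := third fun e => huv (congrArg x e)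
          have := (hc j ((some_apply_mem_newFace hx).1 hus)
            ((some_apply_mem_newFace hx).1 hvs)).trans (hc i ha hb).symm
          exact (hsf (this ▸ rfl)).elim

/-- Any two vertices of a face are adjacent in `T`, so two common vertices already give a common
edge, and the edge set drops out of the description. -/
theorem IsTriangulation.dualGraph_adj {V : Type} {T : SimpleGraph V} {F : Set (Set V)}
    (h : IsTriangulation T F) {f g : F} : (dualGraph T F).Adj f g ↔
      f ≠ g ∧ ∃ u v, u ≠ v ∧ (u ∈ f.1 ∧ v ∈ f.1) ∧ u ∈ g.1 ∧ v ∈ g.1 := by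
  refine and_congr_right fun _ => ⟨?_, ?_⟩
  · rintro ⟨e, he, hf, hg⟩
    induction e with | _ u v
    exact ⟨u, v, T.ne_of_adj he, ⟨hf u (Sym2.mem_mk_left u v), hf v (Sym2.mem_mk_right u v)⟩,
      hg u (Sym2.mem_mk_left u v), hg v (Sym2.mem_mk_right u v)⟩
  · rintro ⟨u, v, huv, ⟨hu, hv⟩, hu', hv'⟩
    refine ⟨s(u, v), h.adj f f.2 u hu v hv huv, ?_, ?_⟩ <;> simpa using ⟨‹_›, ‹_›⟩

/-! ### The duals of `K₄` and of a subdivision -/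

theorem ncard_eq_three_iff {f : Set (Fin 4)} : f.ncard = 3 ↔ ∃ i, f = {i}ᶜ := by
  have h4 : f.ncard + fᶜ.ncard = 4 := by simpa using Set.ncard_add_ncard_compl f
  constructor
  · intro h
    obtain ⟨i, hi⟩ := Set.ncard_eq_one.1 (show fᶜ.ncard = 1 by omega)
    exact ⟨i, by rw [← hi, compl_compl]⟩
  · rintro ⟨i, rfl⟩
    rw [compl_compl, Set.ncard_singleton] at h4
    omega

theorem isTriangulation_top :
    IsTriangulation (⊤ : SimpleGraph (Fin 4)) {s | s.ncard = 3} := by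
  refine ⟨fun f hf => hf, fun f _ u _ v _ huv => huv, fun f hf u hu v hv huv => ?_⟩
  obtain ⟨i, rfl⟩ := ncard_eq_three_iff.1 hf
  obtain ⟨j, h1, h2, h3, h4⟩ : ∃ j, j ≠ i ∧ u ≠ j ∧ v ≠ j ∧
      ∀ k, k ≠ i → u ≠ k → v ≠ k → k = j := by
    replace hu : u ≠ i := hu
    replace hv : v ≠ i := hv
    clear hf
    revert i u v
    decide
  refine ⟨{j}ᶜ, ⟨⟨ncard_eq_three_iff.2 ⟨j, rfl⟩, by simpa using h1⟩, h2, h3⟩, ?_⟩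
  rintro g ⟨⟨hg, hgi⟩, hug, hvg⟩
  obtain ⟨k, rfl⟩ := ncard_eq_three_iff.1 hg
  rw [h4 k (fun e => hgi (e ▸ rfl)) hug hvg]

theorem nonempty_dualGraph_top_iso :
    Nonempty (dualGraph (⊤ : SimpleGraph (Fin 4)) {s | s.ncard = 3} ≃g
      (⊤ : SimpleGraph (Fin 4))) := by
  have hb : Function.Bijective fun i : Fin 4 =>
      (⟨{i}ᶜ, ncard_eq_three_iff.2 ⟨i, rfl⟩⟩ : {s : Set (Fin 4) | s.ncard = 3}) := by
    constructor
    · intro i j h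
      simpa using congrArg Subtype.val h
    · rintro ⟨f, hf⟩
      obtain ⟨i, rfl⟩ := ncard_eq_three_iff.1 hf
      exact ⟨i, rfl⟩
  refine ⟨RelIso.symm ⟨Equiv.ofBijective _ hb, ?_⟩⟩
  intro i j
  rw [isTriangulation_top.dualGraph_adj, SimpleGraph.top_adj]
  refine ⟨fun h e => h.1 (e ▸ rfl), fun h => ⟨fun e => h (hb.1 e), ?_⟩⟩
  obtain ⟨u, v, h1, h2, h3⟩ : ∃ u v, u ≠ v ∧ (u ≠ i ∧ v ≠ i) ∧ u ≠ j ∧ v ≠ j := by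
    revert i j; decide
  exact ⟨u, v, h1, h2, h3⟩

theorem nonempty_prism_iso_truncate {W : Type*} {G : SimpleGraph W} (hG : ∀ u w, G.Adj u w ↔ u ≠ w)
    {v : W} {n : Fin 3 → W} (hn : Function.Injective n)
    (hv : ∀ u, G.Adj v u ↔ ∃ i, u = n i) : Nonempty (truncate G v n ≃g prism) := by
  have hvn : ∀ i, G.Adj v (n i) := fun i => (hv _).2 ⟨i, rfl⟩
  have hb : Function.Bijective (Sum.map (fun i => (⟨n i, (hvn i).ne'⟩ : {u // u ≠ v})) id :
      Fin 3 ⊕ Fin 3 → {u // u ≠ v} ⊕ Fin 3) := by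
    refine Function.Bijective.sumMap ⟨fun i j h => hn (congrArg Subtype.val h), ?_⟩
      Function.bijective_id
    rintro ⟨u, hu⟩
    obtain ⟨i, rfl⟩ := (hv u).1 ((hG v u).2 hu.symm)
    exact ⟨i, rfl⟩
  refine ⟨RelIso.symm ⟨Equiv.ofBijective _ hb, ?_⟩⟩
  rintro (i | i) (j | j)
  · exact (hG _ _).trans hn.ne_iff
  · exact ⟨fun h => hn h.1, fun h => ⟨congrArg n h, hvn j⟩⟩
  · exact ⟨fun h => (hn h.1).symm, fun h => ⟨congrArg n (show i = j from h).symm, hvn i⟩⟩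
  · exact ⟨fun h => h.1, fun h => ⟨h, hvn i, hvn j⟩⟩

/-- The neighbour `n i` is the face across the edge opposite `x i`. After the subdivision this edge
belongs to the new face `newFace x i`, which is therefore adjacent to `n i` and, through the new
vertex, to the other new faces: exactly the truncation of the dual at the subdivided face. -/
theorem IsTriangulation.exists_truncate_iso {V : Type} {T : SimpleGraph V} {F : Set (Set V)}
    {x : Fin 3 → V} (hx : Function.Injective x) (h : IsTriangulation T F)
    (ht : Set.range x ∈ F) : ∃ n : Fin 3 → F, Function.Injective n ∧
      (∀ u, (dualGraph T F).Adj ⟨_, ht⟩ u ↔ ∃ i, u = n i) ∧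
      Nonempty (truncate (dualGraph T F) ⟨_, ht⟩ n ≃g
        dualGraph (subdivideGraph T (Set.range x)) (subdivideFaces F (Set.range x))) := by
  have hxt : ∀ i, x i ∈ Set.range x := fun i => ⟨i, rfl⟩
  have hx12 : ∀ i, x (i + 1) ≠ x (i + 2) := fun i e => (fin3_add i).2.2.2.2.2.2 (hx e)
  have some_mem : ∀ {y : V} {f : Set V}, some y ∈ some '' f ↔ y ∈ f :=
    (Option.some_injective V).mem_set_image
  have key : ∀ i, ∃ g : F, g.1 ≠ Set.range x ∧ x (i + 1) ∈ g.1 ∧ x (i + 2) ∈ g.1 := by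
    intro i
    obtain ⟨g, ⟨⟨hg, hgt⟩, h1, h2⟩, -⟩ :=
      h.existsUnique _ ht _ (hxt (i + 1)) _ (hxt (i + 2)) (hx12 i)
    exact ⟨⟨g, hg⟩, hgt, h1, h2⟩
  choose n hn1 hn2 hn3 using key
  have hnn : ∀ {g : F} {i : Fin 3}, g.1 ≠ Set.range x → x (i + 1) ∈ g.1 → x (i + 2) ∈ g.1 →
      g = n i := fun {g i} h1 h2 h3 => Subtype.ext (h.eq_of_mem ht g.2 (n i).2 h1 (hn1 i) (hx12 i)
        (hxt _) (hxt _) h2 h3 (hn2 i) (hn3 i))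
  have third : ∀ {a b : Fin 3}, a ≠ b → ∃ i, a = i + 1 ∧ b = i + 2 ∨ a = i + 2 ∧ b = i + 1 := by
    decide
  have hnn' : ∀ {g : F} {a b : Fin 3}, a ≠ b → g.1 ≠ Set.range x → x a ∈ g.1 → x b ∈ g.1 →
      ∃ i, (a ≠ i ∧ b ≠ i) ∧ g = n i := by
    intro g a b hab h1 h2 h3
    have h5 : ∀ i : Fin 3, i + 1 ≠ i ∧ i + 2 ≠ i := by decide
    obtain ⟨i, ⟨rfl, rfl⟩ | ⟨rfl, rfl⟩⟩ := third hab
    · exact ⟨i, h5 i, hnn h1 h2 h3⟩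
    · exact ⟨i, (h5 i).symm, hnn h1 h3 h2⟩
  have hadj : ∀ u, (dualGraph T F).Adj ⟨_, ht⟩ u ↔ ∃ i, u = n i := by
    intro u
    rw [h.dualGraph_adj]
    constructor
    · rintro ⟨h1, _, _, h2, ⟨⟨a, rfl⟩, b, rfl⟩, h3, h4⟩
      obtain ⟨i, -, hi⟩ := hnn' (fun e => h2 (congrArg x e))
        (fun e => h1 (Subtype.ext e.symm)) h3 h4
      exact ⟨i, hi⟩
    · rintro ⟨i, rfl⟩
      exact ⟨fun e => hn1 i (congrArg Subtype.val e).symm, _, _, hx12 i, ⟨hxt _, hxt _⟩, hn2 i,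
        hn3 i⟩
  have hinj : Function.Injective n := by
    intro i j hij
    by_contra hne
    -- A face across two edges of the triangle would contain all its three vertices and so be equal
    -- to it.
    have hall : ∀ {i j : Fin 3}, i ≠ j → ∀ k, k = i + 1 ∨ k = i + 2 ∨ k = j + 1 ∨ k = j + 2 := by
      decide
    have hsub : Set.range x ⊆ (n i).1 := by
      rintro _ ⟨k, rfl⟩
      rcases hall hne k with rfl | rfl | rfl | rfl
      · exact hn2 i
      · exact hn3 i
      · exact hij ▸ hn2 j
      · exact hij ▸ hn3 j
    have h3 := h.ncard _ (n i).2
    exact hn1 i (Set.eq_of_subset_of_ncard_le hsub (by rw [h3, h.ncard _ ht])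
      (Set.finite_of_ncard_ne_zero (by omega))).symm
  refine ⟨n, hinj, hadj, ?_⟩
  let φ : {u : F // u ≠ ⟨_, ht⟩} ⊕ Fin 3 → subdivideFaces F (Set.range x) := Sum.elim
    (fun u => ⟨some '' u.1.1, mem_subdivideFaces.2
      (Or.inl ⟨u.1.1, u.1.2, fun e => u.2 (Subtype.ext e), rfl⟩)⟩)
    (fun i => ⟨newFace x i, mem_subdivideFaces.2 (Or.inr ⟨i, rfl⟩)⟩)
  have hφ : Function.Bijective φ := by
    constructor
    · rintro (u | i) (w | j) e
      · exact congrArg _ (Subtype.ext (Subtype.ext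
          ((Option.some_injective V).image_injective (congrArg Subtype.val e))))
      · have e : some '' u.1.1 = newFace x j := congrArg Subtype.val e
        exact (none_notMem_image u.1.1 (e ▸ none_mem_newFace x j)).elim
      · have e : newFace x i = some '' w.1.1 := congrArg Subtype.val e
        exact (none_notMem_image w.1.1 (e ▸ none_mem_newFace x i)).elim
      · exact congrArg _ (newFace_injective hx (congrArg Subtype.val e))
    · rintro ⟨s, hs⟩
      rcases mem_subdivideFaces.1 hs with ⟨f, hf, hft, rfl⟩ | ⟨i, rfl⟩
      · exact ⟨.inl ⟨⟨f, hf⟩, fun e => hft (congrArg Subtype.val e)⟩, rfl⟩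
      · exact ⟨.inr i, rfl⟩
  have hmixed : ∀ (u : {u : F // u ≠ ⟨_, ht⟩}) (i : Fin 3),
      (dualGraph (subdivideGraph T (Set.range x)) (subdivideFaces F (Set.range x))).Adj
        (φ (.inl u)) (φ (.inr i)) ↔ u.1 = n i := by
    intro u i
    rw [(h.subdivide hx ht).dualGraph_adj]
    constructor
    · rintro ⟨-, u', w', huw, ⟨⟨a, ha, rfl⟩, b, hb, rfl⟩, h3, h4⟩
      obtain ⟨k, hk, rfl⟩ := (some_mem_newFace hx).1 h3
      obtain ⟨l, hl, rfl⟩ := (some_mem_newFace hx).1 h4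
      obtain ⟨j, hj, e⟩ := hnn' (fun e => huw (congrArg _ (congrArg x e)))
        (fun e => u.2 (Subtype.ext e)) ha hb
      have hij : ∀ {k l i j : Fin 3}, k ≠ l → k ≠ i → l ≠ i → k ≠ j ∧ l ≠ j → j = i := by omega
      rw [e, hij (fun e => huw (congrArg _ (congrArg x e))) hk hl hj]
    · intro e
      refine ⟨fun h => (none_notMem_image u.1.1 ?_), some (x (i + 1)), some (x (i + 2)),
        fun h => hx12 i (Option.some_injective V h),
        ⟨some_mem.2 (e ▸ hn2 i), some_mem.2 (e ▸ hn3 i)⟩,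
        (some_apply_mem_newFace hx).2 (fin3_add i).2.2.2.2.1,
        (some_apply_mem_newFace hx).2 (fin3_add i).2.2.2.2.2.1⟩
      have h : some '' u.1.1 = newFace x i := congrArg Subtype.val h
      exact h ▸ none_mem_newFace x i
  refine ⟨⟨Equiv.ofBijective φ hφ, ?_⟩⟩
  rintro (u | i) (w | j)
  · change _ ↔ (dualGraph T F).Adj u.1 w.1
    rw [(h.subdivide hx ht).dualGraph_adj, h.dualGraph_adj]
    refine and_congr ?_ ⟨?_, ?_⟩
    · rw [Ne, Ne, not_iff_not, Equiv.apply_eq_iff_eq, Sum.inl.injEq, Subtype.ext_iff]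
    · rintro ⟨u', w', huw, ⟨⟨a, ha, rfl⟩, b, hb, rfl⟩, h3, h4⟩
      exact ⟨a, b, fun e => huw (congrArg _ e), ⟨ha, hb⟩, some_mem.1 h3, some_mem.1 h4⟩
    · rintro ⟨a, b, hab, ⟨ha, hb⟩, h3, h4⟩
      exact ⟨some a, some b, fun e => hab (Option.some_injective V e),
        ⟨some_mem.2 ha, some_mem.2 hb⟩, some_mem.2 h3, some_mem.2 h4⟩
  · exact (hmixed u j).trans ⟨fun h => ⟨h, (hadj _).2 ⟨j, rfl⟩⟩, fun h => h.1⟩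
  · exact (SimpleGraph.adj_comm _ _ _).trans
      ((hmixed w i).trans ⟨fun h => ⟨h, (hadj _).2 ⟨i, rfl⟩⟩, fun h => h.1⟩)
  · change _ ↔ i ≠ j ∧ _ ∧ _
    rw [(h.subdivide hx ht).dualGraph_adj]
    constructor
    · exact fun h => ⟨fun e => h.1 (e ▸ rfl), (hadj _).2 ⟨i, rfl⟩, (hadj _).2 ⟨j, rfl⟩⟩
    · rintro ⟨hij, -⟩
      obtain ⟨k, hki, hkj⟩ : ∃ k, k ≠ i ∧ k ≠ j := by
        clear_value φ
        revert i j; decide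
      exact ⟨fun e => hij (Sum.inr_injective (hφ.1 e)), none, some (x k), by simp,
        ⟨none_mem_newFace x i, (some_apply_mem_newFace hx).2 hki⟩,
        none_mem_newFace x j, (some_apply_mem_newFace hx).2 hkj⟩

/-! ### The induction over Apollonian networks -/

theorem IsApollonianNetwork.isTriangulation {V : Type} {T : SimpleGraph V} {F : Set (Set V)}
    (h : IsApollonianNetwork V T F) : IsTriangulation T F := by
  induction h with
  | k4 => exact isTriangulation_top
  | subdivide _ ht ih =>
    obtain ⟨x, hx, rfl⟩ := Set.ncard_eq_three_iff_exists_injective.1 (ih.ncard _ ht)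
    exact ih.subdivide hx ht

/-- `K₄` is a separate alternative because the drawings start with the prism: a subdivision leads
from `K₄` to the prism, and from any drawing to a truncated one with one more cell. -/
theorem IsApollonianNetwork.exists_strongDrawing {V : Type} {T : SimpleGraph V} {F : Set (Set V)}
    (h : IsApollonianNetwork V T F) : Nonempty (dualGraph T F ≃g (⊤ : SimpleGraph (Fin 4))) ∨
      ∃ ι : Type, Finite ι ∧ Nonempty (StrongDrawing (dualGraph T F) KleinBottle ι) := by
  induction h with
  | k4 => exact Or.inl nonempty_dualGraph_top_iso
  | subdivide h ht ih =>
    have hF := h.isTriangulation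
    obtain ⟨x, hx, rfl⟩ := Set.ncard_eq_three_iff_exists_injective.1 (hF.ncard _ ht)
    obtain ⟨n, hn, hv, ⟨e⟩⟩ := hF.exists_truncate_iso hx ht
    right
    rcases ih with ⟨⟨f⟩⟩ | ⟨ι, hι, ⟨D⟩⟩
    · obtain ⟨g⟩ := nonempty_prism_iso_truncate (fun u w => by
        rw [← f.map_adj_iff, SimpleGraph.top_adj, f.injective.ne_iff]) hn hv
      exact ⟨Fin 3, inferInstance, ⟨prismDrawing.map (e.symm.trans g)⟩⟩
    · obtain ⟨D'⟩ := D.nonempty_truncate hn hv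
      exact ⟨Option ι, inferInstance, ⟨D'.map e.symm⟩⟩

theorem mainTheorem10 {W : Type*} [Finite W] (G : SimpleGraph W) (hG : IsApollonianDual G)
    (hK4 : ¬ Nonempty (G ≃g (⊤ : SimpleGraph (Fin 4)))) :
    ∃ β : C(realization G, KleinBottle), IsStrongEmbedding β := by
  obtain ⟨V, T, F, hT, ⟨e⟩⟩ := hG
  rcases hT.exists_strongDrawing with ⟨⟨f⟩⟩ | ⟨ι, hι, ⟨D⟩⟩
  · exact (hK4 ⟨e.trans f⟩).elim
  · exact (D.map e).exists_isStrongEmbedding
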